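/- **Conventions.** An arithmetic circuit with $n$ input nodes and $m$ output nodes is a finite acyclic network of gates, each of which computes one of: a constant $\zeta\in\mathbb Q$, $a+b$, $a-b$, $\zeta\cdot a$ with $\zeta\in\mathbb Q$, $a\cdot b$, $\max\{a,b\}$, $\min\{a,b\}$; it represents a function $\mathbb R^n\to\mathbb R^m$. A circuit with comparison gates may also use the gate $G_>$, whose output is $1$ if its input is positive and $0$ otherwise. Constants are written in binary. "Polynomial time" means Turing machine polynomial time in the length of the written instance. A search problem $P$ assigns to every instance $I$ (a finite string) a set $\mathrm{Sol}_P(I)\subseteq\mathbb R^{d_P(I)}$ of solutions. A reduction from $P$ to $Q$ consists of a polynomial-time map $f$ from instances of $P$ to instances of $Q$ and of a polynomial-time map that constructs, from an instance $I$ of $P$, a circuit with comparison gates $g_I:\mathbb R^{d_Q(f(I))}\to\mathbb R^{d_P(I)}$ such that $g_I(y)\in\mathrm{Sol}_P(I)$ for every $y\in\mathrm{Sol}_Q(f(I))$. Borsuk–Ulam is the following search problem. Input: an arithmetic circuit (without comparison gates) that represents a function $f:\mathbb R^{d+1}\to\mathbb R^d$, for some $d \ge 0$. Task: find $x\in\mathbb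 R^{d+1}$ with $\sum_{i=1}^{d+1}|x_i|=1$ and $f(x)=f(-x)$. The class $\mathtt{BU}$ consists of all search problems that reduce to Borsuk–Ulam. An existential formula is a formula $\Phi(x)=\exists z_1\dots\exists z_k\,\psi(x,z)$ with free variables $x=(x_1,\dots,x_n)$, where $\psi$ is built by $\land,\lor,\lnot$ from comparisons ($<,\le,=,\ge,>$) of polynomial expressions with integer coefficients (built from variables and integer constants by $+,-,\cdot$). It is true if $\exists x\,\Phi(x)$ holds over $\mathbb R$. The class $\mathtt{FETR}$ consists of all search problems $P$ for which there are a reduction from $P$ to the problem "given an existential formula $\Phi$, find $x$ with $\Phi(x)$", mapping $I$ to $\Phi_I$, such that moreover, for every instance $I$, $\Phi_I$ is true if and only if $\mathrm{Sol}_P(I)\neq\emptyset$ (in particular, the decision version of $P$ lies in $\mathtt{ETR}$). The class $\mathtt{TFETR}$ consists of those $P \in \mathtt{FETR}$ for which every instance has a solution. **Theorem 3.4.** $\mathtt{BU}\subseteq\mathtt{TFETR}$. Moreover, there is a polynomial-time map that sends every instance of Borsuk–Ulam, a circuit for a function $f:\mathbb R^{d+1}\to\mathbb R^d$, to an existential formula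 $\Phi_f$ with $d+1$ free variables such that, for all $x\in\mathbb R^{d+1}$, $$\Phi_f(x)\iff \sum_{i=1}^{d+1}|x_i|=1\ \text{ and }\ f(x)=f(-x),$$ and every formula $\Phi_f$ is true, i.e. satisfied by some $x\in\mathbb R^{d+1}$. -/

import Mathlib

/-!
# Arithmetic circuits, real-valued search problems, and the existential theory of the reals

Instances are finite strings, "polynomial time" is Turing machine polynomial time
(`Turing.TM2ComputableInPolyTime`), solutions are real vectors.
-/

namespace BorsukUlamETR

/-! ## Strings -/

/-- The finite alphabet in which circuits and formulas are written. -/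
inductive Sym : Type
  | one | sep | zeroBit | oneBit | plusSign | minusSign
  | left | right
  | const | add | sub | smul | mul | max | min | pos
  | var | lt | le | eq | ge | gt | and | or | not
  deriving DecidableEq

instance : Fintype Sym where
  elems := {.one, .sep, .zeroBit, .oneBit, .plusSign, .minusSign, .left, .right, .const, .add, .sub,
    .smul, .mul, .max, .min, .pos, .var, .lt, .le, .eq, .ge, .gt, .and, .or, .not}
  complete x := by cases x <;> decide

/-- An encoding is self-delimiting if the object can be read off from any string that starts with
its encoding. -/
def SelfDelimiting {α : Type} (e : α → List Sym) : Prop :=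
  ∀ a b s t, e a ++ s = e b ++ t → a = b ∧ s = t

theorem SelfDelimiting.injective {α : Type} {e : α → List Sym} (h : SelfDelimiting e) :
    Function.Injective e :=
  fun a b hab => (h a b [] [] (by rw [hab])).1

/-- Unary notation, used for the names of nodes and variables. -/
def encUnary : ℕ → List Sym
  | 0 => [Sym.sep]
  | n + 1 => Sym.one :: encUnary n

theorem encUnary_sd : SelfDelimiting encUnary := by
  intro a
  induction a with
  | zero => intro b s t h; cases b <;> simp_all [encUnary]
  | succ a ih =>
    intro b s t h
    cases b with
    | zero => simp [encUnary] at h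
    | succ b =>
      simp only [encUnary, List.cons_append, List.cons.injEq, true_and] at h
      have := ih b s t h
      simp [this.1, this.2]

/-- Self-delimiting form of a list of bits. -/
def encBits : List Bool → List Sym
  | [] => [Sym.sep]
  | b :: l => (bif b then Sym.oneBit else Sym.zeroBit) :: encBits l

theorem encBits_sd : SelfDelimiting encBits := by
  intro a
  induction a with
  | nil =>
    intro b s t h
    cases b with
    | nil => simpa [encBits] using h
    | cons x b => cases x <;> simp [encBits] at h
  | cons y a ih =>
    intro b s t h
    cases b with
    | nil => cases y <;> simp [encBits] at h
    | cons x b =>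
      simp only [encBits, List.cons_append, List.cons.injEq] at h
      have := ih b s t h.2
      have hxy : y = x := by
        cases x <;> cases y <;> simp_all
      simp [this.1, this.2, hxy]

/-- Binary notation for natural numbers. -/
def encNat (n : ℕ) : List Sym := encBits (Computability.encodeNat n)

theorem encNat_sd : SelfDelimiting encNat := by
  intro a b s t h
  have := encBits_sd _ _ s t h
  refine ⟨?_, this.2⟩
  rw [← Computability.decode_encodeNat a, this.1, Computability.decode_encodeNat]

/-- Binary notation for integers: a sign and the absolute value. -/
def encInt (z : ℤ) : List Sym :=
  (if z < 0 then Sym.minusSign else Sym.plusSign) :: encNat z.natAbs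

theorem encInt_sd : SelfDelimiting encInt := by
  intro a b s t h
  simp only [encInt, List.cons_append, List.cons.injEq] at h
  have := encNat_sd _ _ s t h.2
  refine ⟨?_, this.2⟩
  have h1 := h.1
  have h2 := this.1
  split_ifs at h1 <;> omega

/-- Rational numbers: numerator and denominator (in lowest terms) in binary. -/
def encRat (q : ℚ) : List Sym := encInt q.num ++ encNat q.den

theorem encRat_sd : SelfDelimiting encRat := by
  intro a b s t h
  simp only [encRat, List.append_assoc] at h
  have h1 := encInt_sd _ _ _ _ h
  have h2 := encNat_sd _ _ _ _ h1.2
  exact ⟨Rat.ext h1.1 h2.1, h2.2⟩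

/-- Names from two families, numbered in unary. -/
def encName {n k : ℕ} : Fin n ⊕ Fin k → List Sym
  | Sum.inl i => Sym.left :: encUnary i
  | Sum.inr j => Sym.right :: encUnary j

theorem encName_sd {n k : ℕ} : SelfDelimiting (encName : Fin n ⊕ Fin k → List Sym) := by
  rintro (a | a) (b | b) s t h <;> simp only [encName, List.cons_append, List.cons.injEq,
    reduceCtorEq, false_and, true_and] at h
  all_goals
    have := encUnary_sd _ _ _ _ h
    exact ⟨by rw [Fin.ext this.1], this.2⟩

/-- The encodings of `a 0, …, a (k - 1)`, one after the other. -/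
def encTuple {α : Type} (e : α → List Sym) {k : ℕ} (a : Fin k → α) : List Sym :=
  (List.ofFn fun i => e (a i)).flatten

theorem encTuple_sd {α : Type} {e : α → List Sym} (he : SelfDelimiting e) (k : ℕ) :
    SelfDelimiting (encTuple e : (Fin k → α) → List Sym) := by
  induction k with
  | zero =>
    intro a b s t h
    exact ⟨Subsingleton.elim _ _, by simpa [encTuple] using h⟩
  | succ k ih =>
    intro a b s t h
    simp only [encTuple, List.ofFn_succ, List.flatten_cons, List.append_assoc] at h
    have h1 := he _ _ _ _ h
    have h2 := ih (fun i => a i.succ) (fun i => b i.succ) s t h1.2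
    refine ⟨?_, h2.2⟩
    funext i
    refine Fin.cases h1.1 (fun j => ?_) i
    exact congrFun h2.1 j

/-! ## Arithmetic circuits -/

/-- The gates, with input nodes in `V` (each gate is attached to its output node, which is not
recorded here): `const ζ`, `+`, `-`, multiplication by a rational constant `ζ`, `*`, `max`, `min`,
and the comparison gate `pos`, which outputs `1` if its input is positive and `0` otherwise. -/
inductive Gate (V : Type) : Type
  | const (ζ : ℚ)
  | add (a b : V)
  | sub (a b : V)
  | smul (ζ : ℚ) (a : V)
  | mul (a b : V)
  | max (a b : V)
  | min (a b : V)
  | pos (a : V)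

namespace Gate

variable {V : Type}

/-- The nodes that a gate reads. -/
def operands : Gate V → List V
  | const _ => []
  | add a b => [a, b]
  | sub a b => [a, b]
  | smul _ a => [a]
  | mul a b => [a, b]
  | max a b => [a, b]
  | min a b => [a, b]
  | pos a => [a]

/-- The value at the output node of a gate, from the values `v` at all nodes. -/
noncomputable def eval (v : V → ℝ) : Gate V → ℝ
  | const ζ => (ζ : ℝ)
  | add a b => v a + v b
  | sub a b => v a - v b
  | smul ζ a => v a * (ζ : ℝ)
  | mul a b => v a * v b
  | max a b => Max.max (v a) (v b)
  | min a b => Min.min (v a) (v b)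
  | pos a => if 0 < v a then 1 else 0

/-- All gates except the comparison gate. -/
def IsArithmetic : Gate V → Prop
  | pos _ => False
  | _ => True

theorem eval_congr {v w : V → ℝ} (g : Gate V) (h : ∀ a ∈ g.operands, v a = w a) :
    g.eval v = g.eval w := by
  cases g <;> simp_all [operands, eval]

/-- A gate as a string. -/
def enc (e : V → List Sym) : Gate V → List Sym
  | const ζ => Sym.const :: encRat ζ
  | add a b => Sym.add :: (e a ++ e b)
  | sub a b => Sym.sub :: (e a ++ e b)
  | smul ζ a => Sym.smul :: (encRat ζ ++ e a)
  | mul a b => Sym.mul :: (e a ++ e b)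
  | max a b => Sym.max :: (e a ++ e b)
  | min a b => Sym.min :: (e a ++ e b)
  | pos a => Sym.pos :: e a

theorem enc_sd {e : V → List Sym} (he : SelfDelimiting e) : SelfDelimiting (enc e) := by
  intro a b s t h
  have two : ∀ x y x' y' : V, e x ++ (e y ++ s) = e x' ++ (e y' ++ t) →
      x = x' ∧ y = y' ∧ s = t := by
    intro x y x' y' h
    have h1 := he _ _ _ _ h
    have h2 := he _ _ _ _ h1.2
    exact ⟨h1.1, h2.1, h2.2⟩
  cases a <;> cases b <;>
    simp only [enc, List.cons_append, List.append_assoc, List.cons.injEq, reduceCtorEq, false_and,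
      true_and] at h
  case const.const => have := encRat_sd _ _ _ _ h; simp [this.1, this.2]
  case smul.smul =>
    have h1 := encRat_sd _ _ _ _ h
    have h2 := he _ _ _ _ h1.2
    simp [h1.1, h2.1, h2.2]
  case pos.pos => have := he _ _ _ _ h; simp [this.1, this.2]
  all_goals
    have := two _ _ _ _ h
    simp [this.1, this.2.1, this.2.2]

end Gate

/-- An arithmetic circuit with `n` input nodes and `m` output nodes. The nodes are the input nodes
(`Sum.inl`) and one node for each of the `size` gates (`Sum.inr`), the output of that gate. The
gates come in any order; following gates from output to input never leads into a cycle. -/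
structure Circuit (n m : ℕ) : Type where
  size : ℕ
  gate : Fin size → Gate (Fin n ⊕ Fin size)
  out : Fin m → Fin n ⊕ Fin size
  acyclic : ∀ j, ¬ Relation.TransGen
    (fun i j : Fin size => (Sum.inr i : Fin n ⊕ Fin size) ∈ (gate j).operands) j j

namespace Circuit

variable {n m : ℕ}

/-- Values at all nodes that satisfy the constraints of all gates and agree with `x` at the
input nodes. -/
def IsValuation (c : Circuit n m) (x : Fin n → ℝ) (v : Fin n ⊕ Fin c.size → ℝ) : Prop :=
  (∀ i, v (Sum.inl i) = x i) ∧ ∀ j, v (Sum.inr j) = (c.gate j).eval v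

theorem wellFounded (c : Circuit n m) : WellFounded
    (fun i j : Fin c.size => (Sum.inr i : Fin n ⊕ Fin c.size) ∈ (c.gate j).operands) := by
  have : Std.Irrefl (Relation.TransGen
    (fun i j : Fin c.size => (Sum.inr i : Fin n ⊕ Fin c.size) ∈ (c.gate j).operands)) :=
    ⟨c.acyclic⟩
  exact Subrelation.wf (fun h => Relation.TransGen.single h)
    (Finite.wellFounded_of_trans_of_irrefl (Relation.TransGen
    (fun i j : Fin c.size => (Sum.inr i : Fin n ⊕ Fin c.size) ∈ (c.gate j).operands)))

theorem existsUnique_isValuation (c : Circuit n m) (x : Fin n → ℝ) :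
    ∃! v, c.IsValuation x v := by
  classical
  let F : ∀ j : Fin c.size, (∀ i, (Sum.inr i : Fin n ⊕ Fin c.size) ∈ (c.gate j).operands → ℝ) → ℝ :=
    fun j rec => (c.gate j).eval (Sum.elim x fun i =>
      if h : (Sum.inr i : Fin n ⊕ Fin c.size) ∈ (c.gate j).operands then rec i h else 0)
  refine ⟨Sum.elim x (c.wellFounded.fix F), ⟨fun i => rfl, fun j => ?_⟩, ?_⟩
  · simp only [Sum.elim_inr]
    rw [WellFounded.fix_eq]
    refine Gate.eval_congr _ fun a ha => ?_
    rcases a with a | a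
    · rfl
    · simp [ha]
  · rintro w ⟨hw1, hw2⟩
    funext a
    rcases a with i | j
    · exact hw1 i
    · induction j using c.wellFounded.induction with
      | _ j ih =>
        rw [hw2 j, Sum.elim_inr, WellFounded.fix_eq]
        refine Gate.eval_congr _ fun a ha => ?_
        rcases a with a | a
        · exact hw1 a
        · simpa [ha] using ih a ha

/-- The values that the circuit computes at its nodes on the input `x`. -/
noncomputable def value (c : Circuit n m) (x : Fin n → ℝ) : Fin n ⊕ Fin c.size → ℝ :=
  (c.existsUnique_isValuation x).choose

/-- The function `ℝⁿ → ℝᵐ` that the circuit represents. -/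
noncomputable def eval (c : Circuit n m) (x : Fin n → ℝ) : Fin m → ℝ :=
  fun i => c.value x (c.out i)

/-- The circuit has no comparison gate. -/
def IsArithmetic (c : Circuit n m) : Prop := ∀ j, (c.gate j).IsArithmetic

/-- A circuit as a string: the numbers of inputs, gates and outputs, the gates, the outputs. -/
def enc (c : Σ n m : ℕ, Circuit n m) : List Sym :=
  encUnary c.1 ++ (encUnary c.2.2.size ++ (encUnary c.2.1 ++
    (encTuple (Gate.enc encName) c.2.2.gate ++ encTuple encName c.2.2.out)))

theorem enc_injective : Function.Injective enc := by
  rintro ⟨n, m, ⟨k, G, O, hc⟩⟩ ⟨n', m', ⟨k', G', O', hc'⟩⟩ h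
  simp only [enc] at h
  obtain ⟨rfl, h⟩ := encUnary_sd _ _ _ _ h
  obtain ⟨rfl, h⟩ := encUnary_sd _ _ _ _ h
  obtain ⟨rfl, h⟩ := encUnary_sd _ _ _ _ h
  obtain ⟨rfl, hO⟩ := encTuple_sd (Gate.enc_sd encName_sd) _ _ _ _ _ h
  obtain rfl := (encTuple_sd encName_sd _).injective hO
  rfl

end Circuit

/-! ## The existential theory of the reals -/

/-- Polynomial expressions with integer coefficients in the variables `V`. -/
inductive Term (V : Type) : Type
  | var (a : V)
  | const (z : ℤ)
  | add (s t : Term V)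
  | sub (s t : Term V)
  | mul (s t : Term V)

namespace Term

variable {V : Type}

noncomputable def eval (v : V → ℝ) : Term V → ℝ
  | var a => v a
  | const z => (z : ℝ)
  | add s t => s.eval v + t.eval v
  | sub s t => s.eval v - t.eval v
  | mul s t => s.eval v * t.eval v

def enc (e : V → List Sym) : Term V → List Sym
  | var a => Sym.var :: e a
  | const z => Sym.const :: encInt z
  | add s t => Sym.add :: (s.enc e ++ t.enc e)
  | sub s t => Sym.sub :: (s.enc e ++ t.enc e)
  | mul s t => Sym.mul :: (s.enc e ++ t.enc e)

theorem enc_sd {e : V → List Sym} (he : SelfDelimiting e) : SelfDelimiting (enc e) := by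
  intro a
  induction a with
  | var a =>
    intro b s t h
    cases b <;> simp only [enc, List.cons_append, List.append_assoc, List.cons.injEq,
      reduceCtorEq, false_and, true_and] at h
    have := he _ _ _ _ h
    simp [this.1, this.2]
  | const z =>
    intro b s t h
    cases b <;> simp only [enc, List.cons_append, List.append_assoc, List.cons.injEq,
      reduceCtorEq, false_and, true_and] at h
    have := encInt_sd _ _ _ _ h
    simp [this.1, this.2]
  | add p q hp hq | sub p q hp hq | mul p q hp hq =>
    intro b s t h
    cases b <;> simp only [enc, List.cons_append, List.append_assoc, List.cons.injEq,
      reduceCtorEq, false_and, true_and] at h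
    have h1 := hp _ _ _ h
    have h2 := hq _ _ _ h1.2
    simp [h1.1, h2.1, h2.2]

end Term

/-- Quantifier-free formulas: polynomials compared by `<, ≤, =, ≥, >`, and `∧, ∨, ¬`. -/
inductive QF (V : Type) : Type
  | lt (s t : Term V)
  | le (s t : Term V)
  | eq (s t : Term V)
  | ge (s t : Term V)
  | gt (s t : Term V)
  | and (p q : QF V)
  | or (p q : QF V)
  | not (p : QF V)

namespace QF

variable {V : Type}

def Holds (v : V → ℝ) : QF V → Prop
  | lt s t => s.eval v < t.eval v
  | le s t => s.eval v ≤ t.eval v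
  | eq s t => s.eval v = t.eval v
  | ge s t => s.eval v ≥ t.eval v
  | gt s t => s.eval v > t.eval v
  | and p q => p.Holds v ∧ q.Holds v
  | or p q => p.Holds v ∨ q.Holds v
  | not p => ¬ p.Holds v

def enc (e : V → List Sym) : QF V → List Sym
  | lt s t => Sym.lt :: (s.enc e ++ t.enc e)
  | le s t => Sym.le :: (s.enc e ++ t.enc e)
  | eq s t => Sym.eq :: (s.enc e ++ t.enc e)
  | ge s t => Sym.ge :: (s.enc e ++ t.enc e)
  | gt s t => Sym.gt :: (s.enc e ++ t.enc e)
  | and p q => Sym.and :: (p.enc e ++ q.enc e)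
  | or p q => Sym.or :: (p.enc e ++ q.enc e)
  | not p => Sym.not :: p.enc e

theorem enc_sd {e : V → List Sym} (he : SelfDelimiting e) : SelfDelimiting (enc e) := by
  intro a
  induction a with
  | lt p q | le p q | eq p q | ge p q | gt p q =>
    intro b s t h
    cases b <;> simp only [enc, List.cons_append, List.append_assoc, List.cons.injEq,
      reduceCtorEq, false_and, true_and] at h
    have h1 := Term.enc_sd he _ _ _ _ h
    have h2 := Term.enc_sd he _ _ _ _ h1.2
    simp [h1.1, h2.1, h2.2]
  | and p q hp hq | or p q hp hq =>
    intro b s t h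
    cases b <;> simp only [enc, List.cons_append, List.append_assoc, List.cons.injEq,
      reduceCtorEq, false_and, true_and] at h
    have h1 := hp _ _ _ h
    have h2 := hq _ _ _ h1.2
    simp [h1.1, h2.1, h2.2]
  | not p hp =>
    intro b s t h
    cases b <;> simp only [enc, List.cons_append, List.append_assoc, List.cons.injEq,
      reduceCtorEq, false_and, true_and] at h
    have h1 := hp _ _ _ h
    simp [h1.1, h1.2]

end QF

/-- An existential formula `∃ z₁ … z_bound, body (x₁, …, xₙ, z₁, …, z_bound)` with free variables
`x₁, …, xₙ` (`Sum.inl`). -/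
structure ExFormula (n : ℕ) : Type where
  bound : ℕ
  body : QF (Fin n ⊕ Fin bound)

namespace ExFormula

/-- The formula is satisfied by the real numbers `x₁, …, xₙ`. -/
def Holds {n : ℕ} (φ : ExFormula n) (x : Fin n → ℝ) : Prop :=
  ∃ z : Fin φ.bound → ℝ, φ.body.Holds (Sum.elim x z)

/-- The existential closure of the formula is true, that is, belongs to the existential theory of
the reals. -/
def IsTrue {n : ℕ} (φ : ExFormula n) : Prop := ∃ x, φ.Holds x

/-- A formula as a string. -/
def enc (φ : Σ n : ℕ, ExFormula n) : List Sym :=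
  encUnary φ.1 ++ (encUnary φ.2.bound ++ φ.2.body.enc encName)

theorem enc_injective : Function.Injective enc := by
  rintro ⟨n, ⟨k, b⟩⟩ ⟨n', ⟨k', b'⟩⟩ h
  simp only [enc] at h
  obtain ⟨rfl, h⟩ := encUnary_sd _ _ _ _ h
  obtain ⟨rfl, h⟩ := encUnary_sd _ _ _ _ h
  obtain rfl := (QF.enc_sd encName_sd).injective h
  rfl

end ExFormula

/-! ## Search problems and reductions -/

/-- A search problem with real-valued solutions: instances, written as strings over a finite
alphabet, and for each instance `I` the set of its solutions, vectors of `dim I` real numbers. -/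
structure SearchProblem : Type 1 where
  Inst : Type
  Alphabet : Type
  finite_alphabet : Finite Alphabet
  enc : Inst → List Alphabet
  enc_injective : Function.Injective enc
  dim : Inst → ℕ
  Sol : (I : Inst) → Set (Fin (dim I) → ℝ)

/-- The decision version of a search problem: does the instance have a solution? -/
def SearchProblem.Solvable (P : SearchProblem) (I : P.Inst) : Prop := (P.Sol I).Nonempty

/-- `f` is computed by a Turing machine in time polynomial in the length of the input string. -/
def PolyTime {α β Γ Δ : Type} (ea : α → List Γ) (eb : β → List Δ) (f : α → β) : Prop :=
  Nonempty (Turing.TM2ComputableInPolyTime ea eb f)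

/-- Polynomial-time reductions between search problems with real-valued solutions: `f` maps
instances of `P` to instances of `Q`, and `g I` maps the solutions of `f I` to solutions of `I`.
Here `g I` is an arithmetic circuit, which may use comparison gates, and the circuit is
constructed from `I` in polynomial time (so it has polynomial size). -/
def IsReduction (P Q : SearchProblem) (f : P.Inst → Q.Inst)
    (g : (I : P.Inst) → Circuit (Q.dim (f I)) (P.dim I)) : Prop :=
  PolyTime P.enc Q.enc f ∧
  PolyTime P.enc Circuit.enc (fun I => ⟨Q.dim (f I), P.dim I, g I⟩) ∧
  ∀ I, ∀ y ∈ Q.Sol (f I), (g I).eval y ∈ P.Sol I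

/-- The problem Borsuk-Ulam. Input: an arithmetic circuit (without comparison gates) for a function
`f : ℝ^(d+1) → ℝ^d`. Task: find `x` on the unit sphere of the `L₁` norm with `f x = f (-x)`. -/
noncomputable def borsukUlam : SearchProblem where
  Inst := Σ d : ℕ, {c : Circuit (d + 1) d // c.IsArithmetic}
  Alphabet := Sym
  finite_alphabet := inferInstance
  enc I := Circuit.enc ⟨I.1 + 1, I.1, I.2.1⟩
  enc_injective := by
    rintro ⟨d, c, hc⟩ ⟨d', c', hc'⟩ h
    have := Circuit.enc_injective h
    simp only [Sigma.mk.injEq, Nat.add_right_cancel_iff] at this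
    obtain ⟨rfl, h⟩ := this
    simpa using h
  dim I := I.1 + 1
  Sol I := {x | ∑ i, |x i| = 1 ∧ I.2.1.eval x = I.2.1.eval (-x)}

/-- The problem of solving an existential formula: given the formula, find real values of its free
variables that satisfy it. Its decision version is the existential theory of the reals. -/
noncomputable def solveETR : SearchProblem where
  Inst := Σ n : ℕ, ExFormula n
  Alphabet := Sym
  finite_alphabet := inferInstance
  enc := ExFormula.enc
  enc_injective := ExFormula.enc_injective
  dim φ := φ.1
  Sol φ := {x | φ.2.Holds x}

/-! ## The classes -/

/-- `BU`: the search problems that reduce to Borsuk-Ulam in polynomial time. -/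
def BU : Set SearchProblem := {P | ∃ f g, IsReduction P borsukUlam f g}

/-- `FETR`: a polynomial-time map `Φ` sends every instance `I` to an existential formula that is
true if and only if `I` has a solution (so that the decision version lies in `ETR`). As the problem
is to find a solution and not only to decide whether there is one, the values that satisfy `Φ I`
have to give solutions of `I` as in a reduction. -/
def FETR : Set SearchProblem :=
  {P | ∃ Φ g, IsReduction P solveETR Φ g ∧ ∀ I, P.Solvable I ↔ (Φ I).2.IsTrue}

/-- `TFETR`: the problems in `FETR` whose decision version always has the answer "yes". -/
def TFETR : Set SearchProblem := {P | P ∈ FETR ∧ ∀ I, P.Solvable I}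

end BorsukUlamETR

/-! Two facts carry the theorem. First, every instance of Borsuk-Ulam has a solution: a circuit
without comparison gates computes a continuous function, and the Borsuk-Ulam theorem applies.
Second, being a solution is an existential statement that can be printed in polynomial time:
quantify over the values of all nodes on the inputs `x` and `-x`, demand consistency at each gate,
and add that the L₁ norm is 1 and that the outputs agree. A circuit has exactly one valuation for
each input, so the formula says what it should (`antipodalFormula_holds_iff`). A reduction to
Borsuk-Ulam followed by this map is a reduction to formulas with the same solution circuits, which
gives the inclusion of classes.

The Borsuk-Ulam theorem is proved by algebra. By approximation it suffices to find a common zero on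
the unit sphere of `d` odd polynomials `F i` in `d + 1` variables. These are perturbed to the system
`x 0 ^ (2D) + t (∑ x i ^ 2 - 1) = 0`, `x i ^ D + t F i = 0`, with `D` odd and large. Its leading
forms are pure powers, so the monomials below these powers are a basis modulo the system. Exactly
half of them, `D ^ (d + 1)`, have even degree, and this number is odd. The even polynomials modulo
the system thus form a real algebra of odd dimension. Such an algebra has a real point, since
otherwise all residue fields would be `ℂ` (`exists_algHom_real_of_odd_finrank`). The first equation
forbids that all squares are nonpositive at this point, and then the point comes from a real vector
(`algHom_evenPoly_eq_eval`). Letting `t` tend to infinity, compactness yields the zero.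

For polynomial time, stack machines are shown to compose (`PolyTime.comp`), and a small language of
pushes and popping loops is compiled to them step for step (`Run.stepsTo`, `PolyTime.of_run`). The
bound variables are laid out so regularly that a program with two unary counters prints the formula
in one pass over the circuit, in quadratic time (`runs_antipodal`). -/

namespace BorsukUlamETR

/-! ## Real points of odd-dimensional real algebras -/

/-- Induction along a composition series: a maximal submodule `N` has a simple quotient, which is
some `A ⧸ m` and so of even dimension, and `N` is smaller. Modules are needed because `N` is not an
algebra. -/
theorem even_finrank_of_simple_quotients {A : Type*} [CommRing A] [Algebra ℝ A]
    (hA : ∀ m : Ideal A, m.IsMaximal → Even (Module.finrank ℝ (A ⧸ m))) (n : ℕ) :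
    ∀ (M : Type*) [AddCommGroup M] [Module A M] [Module ℝ M] [IsScalarTower ℝ A M]
      [Module.Finite ℝ M], Module.finrank ℝ M = n → Even n := by
  induction n using Nat.strong_induction_on with
  | _ n ih =>
    intro M _ _ _ _ _ hn
    rcases subsingleton_or_nontrivial M with hM | hM
    · rw [← hn, Module.finrank_zero_of_subsingleton]
      exact Even.zero
    have : Module.Finite A M := Module.Finite.of_restrictScalars_finite ℝ A M
    obtain ⟨N, hN, -⟩ := (eq_top_or_exists_le_coatom (⊥ : Submodule A M)).resolve_left bot_ne_top
    have hs : IsSimpleModule A (M ⧸ N) := isSimpleModule_iff_isCoatom.2 hN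
    obtain ⟨m, hm, ⟨e⟩⟩ := isSimpleModule_iff_quot_maximal.1 hs
    have h1 : Module.finrank ℝ (M ⧸ N) = Module.finrank ℝ (A ⧸ m) :=
      (e.restrictScalars ℝ).finrank_eq
    have h2 : Module.finrank ℝ (M ⧸ N.restrictScalars ℝ) = Module.finrank ℝ (M ⧸ N) :=
      (Submodule.Quotient.restrictScalarsEquiv ℝ N).finrank_eq
    have h3 := (N.restrictScalars ℝ).finrank_quotient_add_finrank
    have : Nontrivial (M ⧸ N) := IsSimpleModule.nontrivial A (M ⧸ N)
    have h4 : 0 < Module.finrank ℝ (M ⧸ N.restrictScalars ℝ) := by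
      rw [h2]
      have : Module.Finite ℝ (M ⧸ N) :=
        Module.Finite.equiv (Submodule.Quotient.restrictScalarsEquiv ℝ N)
      exact Module.finrank_pos
    have : Module.Finite ℝ N := inferInstanceAs (Module.Finite ℝ (N.restrictScalars ℝ))
    have h5 := ih (Module.finrank ℝ N) (by
      change Module.finrank ℝ (N.restrictScalars ℝ) < n
      omega) N rfl
    rw [← hn, ← h3, h2, h1]
    exact (hA m hm).add h5

/-- Every residue field is a finite extension of `ℝ`, hence `ℝ` or `ℂ`. A residue field `ℝ` is a
real point; if all of them are `ℂ`, all simple modules have dimension 2 and the dimension of `A` is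
even. -/
theorem exists_algHom_real_of_odd_finrank {A : Type*} [CommRing A] [Algebra ℝ A]
    [Module.Finite ℝ A] (h : Odd (Module.finrank ℝ A)) : Nonempty (A →ₐ[ℝ] ℝ) := by
  by_contra hne
  refine Nat.not_even_iff_odd.2 h (even_finrank_of_simple_quotients (A := A) ?_ _ A rfl)
  intro m hm
  let _ : Field (A ⧸ m) := Ideal.Quotient.field m
  have : Module.Finite ℝ (A ⧸ m) :=
    Module.Finite.of_surjective (Ideal.Quotient.mkₐ ℝ m).toLinearMap
      (Ideal.Quotient.mkₐ_surjective ℝ m)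
  have : Algebra.IsAlgebraic ℝ (A ⧸ m) := Algebra.IsAlgebraic.of_finite ℝ (A ⧸ m)
  rcases Real.nonempty_algEquiv_or (A ⧸ m) with ⟨⟨e⟩⟩ | ⟨⟨e⟩⟩
  · exact (hne ⟨(e : (A ⧸ m) →ₐ[ℝ] ℝ).comp (Ideal.Quotient.mkₐ ℝ m)⟩).elim
  · rw [e.toLinearEquiv.finrank_eq, Complex.finrank_real_complex]
    exact even_two

/-! ## Polynomials modulo a system whose leading forms are pure powers -/

open MvPolynomial

section Lead

variable {ι : Type*}

/-- Real polynomials of total degree less than `n`. -/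
noncomputable def degLT (ι : Type*) (n : ℕ) : Submodule ℝ (MvPolynomial ι ℝ) :=
  restrictSupport ℝ {c | c.degree < n}

theorem degLT_mono {m n : ℕ} (h : m ≤ n) : degLT ι m ≤ degLT ι n :=
  restrictSupport_mono ℝ fun _ hc => lt_of_lt_of_le hc h

theorem monomial_mem_degLT {n : ℕ} {c : ι →₀ ℕ} (h : c.degree < n) (a : ℝ) :
    monomial c a ∈ degLT ι n :=
  (monomial_mem_restrictSupport ℝ).2 (Or.inl h)

theorem mul_mem_degLT {m n : ℕ} {p q : MvPolynomial ι ℝ} (hp : p ∈ degLT ι m)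
    (hq : q ∈ degLT ι (n + 1)) : p * q ∈ degLT ι (m + n) := by
  have h := Submodule.mul_mem_mul hp hq
  unfold degLT at h
  rw [← restrictSupport_add] at h
  refine restrictSupport_mono ℝ ?_ h
  rintro _ ⟨a, ha, b, hb, rfl⟩
  simp only [Set.mem_ofPred_eq, map_add] at *
  omega

/-- The leading form of `p` is the monomial `x ^ c`. -/
def HasLead (p : MvPolynomial ι ℝ) (c : ι →₀ ℕ) : Prop := p - monomial c 1 ∈ degLT ι c.degree

theorem hasLead_monomial (c : ι →₀ ℕ) : HasLead (monomial c (1 : ℝ)) c := by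
  simp [HasLead]

theorem HasLead.mem {p : MvPolynomial ι ℝ} {c : ι →₀ ℕ} (h : HasLead p c) :
    p ∈ degLT ι (c.degree + 1) := by
  have := add_mem (degLT_mono (Nat.le_succ _) h) (monomial_mem_degLT (Nat.lt_succ_self c.degree) 1)
  simpa using this

theorem HasLead.mul {p q : MvPolynomial ι ℝ} {a b : ι →₀ ℕ} (hp : HasLead p a) (hq : HasLead q b) :
    HasLead (p * q) (a + b) := by
  -- The difference splits as `(p - x^a) q + x^a (q - x^b)`, and both terms have degree below `|a| +
  -- |b|`.
  have h1 := mul_mem_degLT hp hq.mem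
  have h2 := mul_mem_degLT hq (hasLead_monomial a).mem
  rw [add_comm] at h2
  have h3 := add_mem h1 h2
  have : (monomial (a + b) (1 : ℝ)) = monomial a 1 * monomial b 1 := by simp [monomial_mul]
  rw [HasLead, this, map_add]
  convert h3 using 1
  ring

theorem HasLead.pow {p : MvPolynomial ι ℝ} {a : ι →₀ ℕ} (hp : HasLead p a) (n : ℕ) :
    HasLead (p ^ n) (n • a) := by
  induction n with
  | zero => simpa using hasLead_monomial (0 : ι →₀ ℕ)
  | succ n ih => rw [pow_succ, succ_nsmul]; exact ih.mul hp

theorem HasLead.prod {κ : Type*} (s : Finset κ) {p : κ → MvPolynomial ι ℝ} {a : κ → ι →₀ ℕ}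
    (hp : ∀ k ∈ s, HasLead (p k) (a k)) : HasLead (∏ k ∈ s, p k) (∑ k ∈ s, a k) := by
  classical
  induction s using Finset.induction_on with
  | empty => simpa using hasLead_monomial (0 : ι →₀ ℕ)
  | insert k s hk ih =>
    rw [Finset.prod_insert hk, Finset.sum_insert hk]
    exact (hp k (Finset.mem_insert_self k s)).mul
      (ih fun j hj => hp j (Finset.mem_insert_of_mem hj))

/-- Such a map is the identity plus an operator that lowers the degree, so it is unitriangular for
the degree filtration. A kernel element equals its own lower-degree error, down to 0; a preimage of
`p` is found by correcting `T p` in lower degrees. -/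
theorem bijective_of_hasLead (T : MvPolynomial ι ℝ →ₗ[ℝ] MvPolynomial ι ℝ)
    (hT : ∀ c, HasLead (T (monomial c 1)) c) : Function.Bijective T := by
  have key : ∀ n, ∀ p ∈ degLT ι (n + 1), T p - p ∈ degLT ι n := by
    intro n p hp
    have : degLT ι (n + 1) ≤ (degLT ι n).comap (T - LinearMap.id) := by
      rw [degLT, restrictSupport_eq_span, Submodule.span_le]
      rintro _ ⟨c, hc, rfl⟩
      have hc : c.degree < n + 1 := hc
      exact degLT_mono (Nat.lt_succ_iff.1 hc) (hT c)
    exact this hp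
  have hz : ∀ p ∈ degLT ι 0, p = 0 := by
    intro p hp
    rw [degLT, mem_restrictSupport_iff] at hp
    rw [← MvPolynomial.support_eq_empty]
    ext c
    refine ⟨fun hc => absurd (hp hc) (by simp), fun hc => by simp at hc⟩
  have hall : ∀ p : MvPolynomial ι ℝ, ∃ n, p ∈ degLT ι n := by
    intro p
    refine ⟨p.support.sup (fun c => c.degree) + 1, ?_⟩
    rw [degLT, mem_restrictSupport_iff]
    intro c hc
    exact Nat.lt_succ_iff.2 (Finset.le_sup (f := fun c : ι →₀ ℕ => c.degree) hc)
  constructor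
  · rw [← LinearMap.ker_eq_bot, LinearMap.ker_eq_bot']
    intro p hp
    obtain ⟨n, hn⟩ := hall p
    induction n with
    | zero => exact hz p hn
    | succ n ih =>
      refine ih ?_
      have := key n p hn
      rw [hp, zero_sub] at this
      simpa using this
  · have : ∀ n, ∀ p ∈ degLT ι n, p ∈ LinearMap.range T := by
      intro n
      induction n with
      | zero => intro p hp; rw [hz p hp]; exact zero_mem _
      | succ n ih =>
        intro p hp
        have := sub_mem (LinearMap.mem_range_self T p) (ih _ (key n p hp))
        simpa using this
    intro p
    obtain ⟨n, hn⟩ := hall p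
    exact this n p hn

end Lead

/-! ### Division by a system with pure-power leading forms -/

section System

variable {ι : Type*} [Fintype ι]

/-- The exponents of `c`, each reduced modulo the corresponding entry of `e`. -/
noncomputable def expMod (e : ι → ℕ) (c : ι →₀ ℕ) : ι →₀ ℕ :=
  Finsupp.equivFunOnFinite.symm fun i => c i % e i

/-- The linear map that replaces in each monomial the power `x i ^ e i` by `G i`, as often as
possible. -/
noncomputable def substPow (e : ι → ℕ) (G : ι → MvPolynomial ι ℝ) :
    MvPolynomial ι ℝ →ₗ[ℝ] MvPolynomial ι ℝ :=
  (basisMonomials ι ℝ).constr ℝ fun c => monomial (expMod e c) 1 * ∏ i, G i ^ (c i / e i)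

theorem substPow_monomial (e : ι → ℕ) (G : ι → MvPolynomial ι ℝ) (c : ι →₀ ℕ) :
    substPow e G (monomial c 1) = monomial (expMod e c) 1 * ∏ i, G i ^ (c i / e i) := by
  have := (basisMonomials ι ℝ).constr_basis ℝ
    (fun c => monomial (expMod e c) 1 * ∏ i, G i ^ (c i / e i)) c
  rwa [coe_basisMonomials] at this

variable {e : ι → ℕ} {G : ι → MvPolynomial ι ℝ}

theorem expMod_add_sum (e : ι → ℕ) (c : ι →₀ ℕ) :
    expMod e c + ∑ i, (c i / e i) • Finsupp.single i (e i) = c := by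
  classical
  ext j
  simp [expMod, Finsupp.single_apply, Nat.mod_add_div']

/-- Division with remainder of each exponent: replacing `x i ^ e i` by `G i`, which has the same
leading form, does not change the leading monomial. Hence `substPow` is bijective. -/
theorem substPow_hasLead (hG : ∀ i, HasLead (G i) (Finsupp.single i (e i))) (c : ι →₀ ℕ) :
    HasLead (substPow e G (monomial c 1)) c := by
  have := (hasLead_monomial (expMod e c)).mul
    (HasLead.prod Finset.univ fun i _ => (hG i).pow (c i / e i))
  rwa [← substPow_monomial, expMod_add_sum] at this

/-- Adding `e i` to the exponent of `x i` keeps all remainders and raises only the `i`-th quotient,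
by one. This turns multiplication by `G i` into a shift of exponents. -/
theorem mul_substPow_monomial [DecidableEq ι] (he : ∀ i, 0 < e i) (i : ι) (c : ι →₀ ℕ) :
    G i * substPow e G (monomial c 1) = substPow e G (monomial (c + Finsupp.single i (e i)) 1) := by
  have h1 : expMod e (c + Finsupp.single i (e i)) = expMod e c := by
    ext j
    rcases eq_or_ne i j with rfl | h <;> simp [expMod, *]
  have h2 : ∏ j, G j ^ ((c + Finsupp.single i (e i)) j / e j) = G i * ∏ j, G j ^ (c j / e j) := by
    rw [← Finset.mul_prod_erase _ _ (Finset.mem_univ i),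
      ← Finset.mul_prod_erase (a := i) Finset.univ (fun j => G j ^ (c j / e j)) (Finset.mem_univ i),
      ← mul_assoc, ← pow_succ']
    congr 1
    · simp [Nat.add_div_right _ (he i)]
    · refine Finset.prod_congr rfl fun j hj => ?_
      simp [(Finset.ne_of_mem_erase hj).symm]
  rw [substPow_monomial, substPow_monomial, h1, h2]
  ring

/-- The ideal is the image of the span of the monomials outside the box `c i < e i`. The image of
such a monomial has a factor `G i`; conversely, any multiplier of `G i` is a value of `substPow`,
and the product is shifted out of the box. So the box gives a basis of the quotient ring. -/
theorem substPow_mem_span_iff (he : ∀ i, 0 < e i)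
    (hG : ∀ i, HasLead (G i) (Finsupp.single i (e i))) (q : MvPolynomial ι ℝ) :
    substPow e G q ∈ Ideal.span (Set.range G) ↔ ∀ c : ι →₀ ℕ, (∀ i, c i < e i) → coeff c q = 0 := by
  classical
  have hT := bijective_of_hasLead (substPow e G) (substPow_hasLead hG)
  have h1 : ∀ i p, G i * substPow e G p ∈
      (restrictSupport ℝ {c : ι →₀ ℕ | ∃ i, e i ≤ c i}).map (substPow e G) := by
    intro i p
    induction p using MvPolynomial.induction_on' with
    | monomial c a =>
      have : monomial c a = a • monomial c (1 : ℝ) := by simp [smul_monomial]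
      rw [this, map_smul, mul_smul_comm]
      refine Submodule.smul_mem _ _ ?_
      rw [mul_substPow_monomial he]
      exact ⟨_, (monomial_mem_restrictSupport ℝ).2 (Or.inl ⟨i, by simp⟩), rfl⟩
    | add p q hp hq => rw [map_add, mul_add]; exact add_mem hp hq
  constructor
  · intro h c hc
    obtain ⟨r, hr⟩ := Ideal.mem_span_range_iff_exists_fun.1 h
    have h2 : substPow e G q ∈
        (restrictSupport ℝ {c : ι →₀ ℕ | ∃ i, e i ≤ c i}).map (substPow e G) := by
      rw [← hr]
      refine Submodule.sum_mem _ fun i _ => ?_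
      obtain ⟨p, hp⟩ := hT.2 (r i)
      rw [← hp, mul_comm]
      exact h1 i p
    obtain ⟨q', hq', h3⟩ := h2
    rw [← hT.1 h3]
    by_contra h4
    obtain ⟨i, hi⟩ := (mem_restrictSupport_iff ℝ).1 hq' (mem_support_iff.2 h4)
    exact absurd (hc i) (not_lt.2 hi)
  · intro h
    rw [q.as_sum, map_sum]
    refine Ideal.sum_mem _ fun c hc => ?_
    have : monomial c (coeff c q) = coeff c q • monomial c (1 : ℝ) := by simp [smul_monomial]
    rw [this, map_smul, smul_eq_C_mul]
    refine Ideal.mul_mem_left _ _ ?_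
    have : ∃ i, e i ≤ c i := by
      by_contra! h'
      exact mem_support_iff.1 hc (h c h')
    obtain ⟨i, hi⟩ := this
    rw [substPow_monomial]
    refine Ideal.mul_mem_left _ _ ?_
    refine Ideal.mem_of_dvd _ (Finset.dvd_prod_of_mem _ (Finset.mem_univ i)) ?_
    exact Ideal.pow_mem_of_mem _ (Ideal.subset_span (Set.mem_range_self i)) _ (Nat.div_pos hi (he i))

end System

/-! ### Even polynomials modulo the system -/

section Parity

variable {ι : Type*}

/-- The substitution `x ↦ -x`. -/
noncomputable def negVars (ι : Type*) : MvPolynomial ι ℝ →ₐ[ℝ] MvPolynomial ι ℝ :=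
  aeval fun i => -X i

theorem negVars_monomial (c : ι →₀ ℕ) (a : ℝ) :
    negVars ι (monomial c a) = (-1) ^ c.degree * monomial c a := by
  rw [negVars, aeval_monomial, monomial_eq, Finsupp.prod, Finsupp.prod]
  have : ∀ i ∈ c.support, (-X i : MvPolynomial ι ℝ) ^ c i = (-1) ^ c i * X i ^ c i := by
    intro i _
    rw [neg_pow]
  rw [Finset.prod_congr rfl this, Finset.prod_mul_distrib, Finset.prod_pow_eq_pow_sum,
    Finsupp.degree_apply, algebraMap_eq]
  ring

theorem coeff_negVars (p : MvPolynomial ι ℝ) (c : ι →₀ ℕ) :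
    coeff c (negVars ι p) = (-1) ^ c.degree * coeff c p := by
  classical
  induction p using MvPolynomial.induction_on' with
  | monomial u a =>
    rw [negVars_monomial]
    have h : ((-1) ^ u.degree : MvPolynomial ι ℝ) = C ((-1) ^ u.degree) := by simp
    rw [h, coeff_C_mul, coeff_monomial]
    split_ifs with h'
    · rw [h']
    · simp
  | add p q hp hq => rw [map_add, coeff_add, coeff_add, hp, hq, mul_add]

theorem eval_negVars (p : MvPolynomial ι ℝ) (x : ι → ℝ) :
    eval x (negVars ι p) = eval (-x) p := by
  have : (aeval x : MvPolynomial ι ℝ →ₐ[ℝ] ℝ).comp (negVars ι) = aeval (-x) := by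
    ext i
    simp [negVars]
  simpa using congrArg (fun f => f p) this

/-- Polynomials `p` with `p (-x) = p x`. -/
noncomputable def evenPoly (ι : Type*) : Subalgebra ℝ (MvPolynomial ι ℝ) :=
  AlgHom.equalizer (negVars ι) (AlgHom.id ℝ _)

theorem mem_evenPoly {p : MvPolynomial ι ℝ} : p ∈ evenPoly ι ↔ negVars ι p = p := Iff.rfl

theorem coeff_eq_zero_of_mem_evenPoly {p : MvPolynomial ι ℝ} (hp : p ∈ evenPoly ι) {c : ι →₀ ℕ}
    (hc : ¬ Even c.degree) : coeff c p = 0 := by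
  have := coeff_negVars p c
  rw [mem_evenPoly.1 hp, (Nat.not_even_iff_odd.1 hc).neg_one_pow] at this
  linarith

theorem monomial_mem_evenPoly {c : ι →₀ ℕ} (hc : Even c.degree) (a : ℝ) :
    monomial c a ∈ evenPoly ι := by
  rw [mem_evenPoly, negVars_monomial, hc.neg_one_pow, one_mul]

variable [Fintype ι] {e : ι → ℕ} {G : ι → MvPolynomial ι ℝ}

/-- Each `G i` has the parity of the power `x i ^ e i` that it replaces, so the substitution
respects parity and restricts to the even polynomials. -/
theorem negVars_substPow (hσ : ∀ i, negVars ι (G i) = (-1) ^ e i * G i) (p : MvPolynomial ι ℝ) :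
    negVars ι (substPow e G p) = substPow e G (negVars ι p) := by
  induction p using MvPolynomial.induction_on' with
  | monomial c a =>
    have h1 : monomial c a = a • monomial c (1 : ℝ) := by simp [smul_monomial]
    have h2 : ((-1) ^ c.degree : MvPolynomial ι ℝ) * monomial c 1
        = ((-1) ^ c.degree : ℝ) • monomial c 1 := by
      rw [smul_eq_C_mul]; simp
    rw [h1, map_smul, map_smul, map_smul, map_smul, negVars_monomial, h2, map_smul,
      substPow_monomial, map_mul, map_prod, negVars_monomial]
    have h3 : ∏ i, negVars ι (G i ^ (c i / e i)) =
        (-1) ^ (∑ i, e i * (c i / e i)) * ∏ i, G i ^ (c i / e i) := by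
      rw [← Finset.prod_pow_eq_pow_sum, ← Finset.prod_mul_distrib]
      refine Finset.prod_congr rfl fun i _ => ?_
      rw [map_pow, hσ, mul_pow, pow_mul]
    have h4 : c.degree = (expMod e c).degree + ∑ i, e i * (c i / e i) := by
      rw [Finsupp.degree_eq_sum, Finsupp.degree_eq_sum, ← Finset.sum_add_distrib]
      refine Finset.sum_congr rfl fun i _ => ?_
      exact (Nat.mod_add_div (c i) (e i)).symm
    rw [h3, h4]
    simp only [smul_eq_C_mul, C_mul, C_pow, C_neg, C_1, pow_add]
    ring
  | add p q hp hq => simp only [map_add, hp, hq]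

/-- Exponent vectors below `e` with even sum. -/
def evenBox (e : ι → ℕ) [DecidableEq ι] : Finset (ι → ℕ) :=
  (Fintype.piFinset fun i => Finset.range (e i)).filter fun c => Even (∑ i, c i)

/-- If there is an odd number of even monomials below the leading monomials `x i ^ e i` of the
`G i`, then the even polynomials have a real point modulo the `G i`. -/
theorem exists_algHom_evenPoly [DecidableEq ι] (he : ∀ i, 0 < e i)
    (hG : ∀ i, HasLead (G i) (Finsupp.single i (e i)))
    (hσ : ∀ i, negVars ι (G i) = (-1) ^ e i * G i) (hodd : Odd (evenBox e).card) :
    ∃ φ : evenPoly ι →ₐ[ℝ] ℝ, ∀ p : evenPoly ι, (p : MvPolynomial ι ℝ) ∈ Ideal.span (Set.range G) →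
      φ p = 0 := by
  have hT := bijective_of_hasLead (substPow e G) (substPow_hasLead hG)
  let T := LinearEquiv.ofBijective (substPow e G) hT
  have hTa : ∀ p, T p = substPow e G p := fun p => rfl
  have hTE : ∀ p, T p ∈ evenPoly ι ↔ p ∈ evenPoly ι := by
    intro p
    rw [mem_evenPoly, mem_evenPoly, hTa, negVars_substPow hσ]
    exact hT.1.eq_iff
  let J : Ideal (evenPoly ι) := (Ideal.span (Set.range G)).comap (evenPoly ι).val
  -- The coordinates of an even polynomial at the even box monomials, after undoing the
  -- substitution. This map is onto with kernel `J`, so the quotient by `J` has dimension `(evenBox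
  -- e).card`.
  let P : evenPoly ι →ₗ[ℝ] (evenBox e → ℝ) :=
    LinearMap.pi fun c => (lcoeff ℝ (Finsupp.equivFunOnFinite.symm c.1)).comp
      (T.symm.toLinearMap.comp (evenPoly ι).val.toLinearMap)
  have hP : ∀ p c, P p c = coeff (Finsupp.equivFunOnFinite.symm c.1) (T.symm p) := fun p c => rfl
  have hsurj : Function.Surjective P := by
    intro b
    let q : MvPolynomial ι ℝ := ∑ c : evenBox e, monomial (Finsupp.equivFunOnFinite.symm c.1) (b c)
    have hq : q ∈ evenPoly ι := by
      refine Subalgebra.sum_mem _ fun c _ => monomial_mem_evenPoly ?_ _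
      have := (Finset.mem_filter.1 c.2).2
      simpa [Finsupp.degree_eq_sum] using this
    refine ⟨⟨T q, (hTE q).2 hq⟩, ?_⟩
    ext c
    rw [hP]
    simp only [LinearEquiv.symm_apply_apply, q, coeff_sum, coeff_monomial,
      EmbeddingLike.apply_eq_iff_eq]
    rw [Finset.sum_eq_single c]
    · simp
    · intro c' _ h
      rw [if_neg]
      exact fun h' => h (Subtype.ext h')
    · simp
  have hker : LinearMap.ker P = J.restrictScalars ℝ := by
    ext p
    obtain ⟨q, hq⟩ : ∃ q, T q = p := T.surjective p
    have hqE : q ∈ evenPoly ι := by rw [← hTE, hq]; exact p.2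
    have : p ∈ J.restrictScalars ℝ ↔ substPow e G q ∈ Ideal.span (Set.range G) := by
      rw [← hTa, hq]; rfl
    rw [this, substPow_mem_span_iff he hG, LinearMap.mem_ker]
    constructor
    · intro h c hc
      -- Coefficients at odd monomials of the box vanish by parity, so the even box decides
      -- membership in the ideal.
      by_cases hev : Even c.degree
      · have hmem : (c : ι → ℕ) ∈ evenBox e := by
          rw [evenBox, Finset.mem_filter, Fintype.mem_piFinset]
          refine ⟨fun i => Finset.mem_range.2 (hc i), ?_⟩
          rwa [Finsupp.degree_eq_sum] at hev
        have := congrFun h ⟨c, hmem⟩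
        rw [hP, ← hq, LinearEquiv.symm_apply_apply] at this
        simpa using this
      · exact coeff_eq_zero_of_mem_evenPoly hqE hev
    · intro h
      ext c
      rw [hP, ← hq, LinearEquiv.symm_apply_apply]
      refine h _ fun i => ?_
      exact Finset.mem_range.1 (Fintype.mem_piFinset.1 (Finset.mem_filter.1 c.2).1 i)
  let E1 : (evenPoly ι ⧸ J.restrictScalars ℝ) ≃ₗ[ℝ] (evenBox e → ℝ) :=
    (Submodule.quotEquivOfEq _ _ hker.symm).trans (P.quotKerEquivOfSurjective hsurj)
  let E2 : (evenPoly ι ⧸ J) ≃ₗ[ℝ] (evenBox e → ℝ) :=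
    (Submodule.Quotient.restrictScalarsEquiv ℝ J).symm.trans E1
  have : Module.Finite ℝ (evenPoly ι ⧸ J) := Module.Finite.equiv E2.symm
  have hfr : Module.finrank ℝ (evenPoly ι ⧸ J) = (evenBox e).card := by
    rw [E2.finrank_eq, Module.finrank_fintype_fun_eq_card, Fintype.card_coe]
  obtain ⟨ψ⟩ := exists_algHom_real_of_odd_finrank (A := evenPoly ι ⧸ J) (by rwa [hfr])
  refine ⟨ψ.comp (Ideal.Quotient.mkₐ ℝ J), fun p hp => ?_⟩
  have : (Ideal.Quotient.mkₐ ℝ J) p = 0 := Ideal.Quotient.eq_zero_iff_mem.2 hp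
  rw [AlgHom.comp_apply, this, map_zero]

end Parity

/-- The sum of the signs `(-1) ^ (∑ c i)` over the box factors into alternating geometric sums, and
the one for the even `e i₀` is 0. So even and odd vectors are equally many. -/
theorem two_mul_card_evenBox {ι : Type*} [Fintype ι] [DecidableEq ι] (e : ι → ℕ) {i₀ : ι}
    (h : Even (e i₀)) : 2 * (evenBox e).card = ∏ i, e i := by
  have h1 : ∑ c ∈ Fintype.piFinset (fun i => Finset.range (e i)), (-1 : ℤ) ^ (∑ i, c i) = 0 := by
    simp_rw [← Finset.prod_pow_eq_pow_sum]
    rw [← Finset.prod_univ_sum (fun i => Finset.range (e i)) (fun _ k => (-1 : ℤ) ^ k)]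
    refine Finset.prod_eq_zero (Finset.mem_univ i₀) ?_
    rw [neg_one_geom_sum, if_pos h]
  have h2 : ∀ c : ι → ℕ, (-1 : ℤ) ^ (∑ i, c i) = 2 * (if Even (∑ i, c i) then 1 else 0) - 1 := by
    intro c
    split_ifs with hc
    · rw [hc.neg_one_pow]; norm_num
    · rw [(Nat.not_even_iff_odd.1 hc).neg_one_pow]; norm_num
  simp_rw [h2] at h1
  rw [Finset.sum_sub_distrib, ← Finset.mul_sum, Finset.sum_boole, Finset.sum_const,
    Fintype.card_piFinset] at h1
  simp only [Finset.card_range, nsmul_eq_mul, mul_one] at h1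
  have h3 : (2 * (evenBox e).card : ℤ) = (∏ i, e i : ℕ) := by
    rw [evenBox]; linarith
  exact_mod_cast h3

theorem mul_mem_evenPoly {ι : Type*} {p q : MvPolynomial ι ℝ} (hp : negVars ι p = -p)
    (hq : negVars ι q = -q) : p * q ∈ evenPoly ι := by
  rw [mem_evenPoly, map_mul, hp, hq, neg_mul_neg]

theorem negVars_X {ι : Type*} (i : ι) : negVars ι (X i) = -X i := by
  simp [negVars]

/-- A real point of the even polynomials in which some square `x k ^ 2` is positive is the
evaluation at a point of real space. -/
theorem algHom_evenPoly_eq_eval {ι : Type*} [Fintype ι] (φ : evenPoly ι →ₐ[ℝ] ℝ) (k : ι)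
    (hk : 0 < φ ⟨X k * X k, mul_mem_evenPoly (negVars_X k) (negVars_X k)⟩) :
    ∃ x : ι → ℝ, x k ≠ 0 ∧ ∀ p : evenPoly ι, φ p = eval x p := by
  -- Only products of two variables are available. With `r = √φ(x k ^ 2)` in the role of `x k`, the
  -- coordinate `x i` has to be `φ(x i * x k) / r`.
  let P : ι → evenPoly ι := fun i => ⟨X i * X k, mul_mem_evenPoly (negVars_X i) (negVars_X k)⟩
  obtain ⟨r, hr0, hr⟩ : ∃ r : ℝ, 0 < r ∧ φ (P k) = r * r :=
    ⟨√(φ (P k)), Real.sqrt_pos.2 hk, (Real.mul_self_sqrt hk.le).symm⟩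
  have hr' := hr0.ne'
  have hmono : ∀ (c : ι →₀ ℕ) (hc : Even c.degree) (a : ℝ),
      φ ⟨monomial c a, monomial_mem_evenPoly hc a⟩ = a * ∏ i, (φ (P i) / r) ^ c i := by
    intro c hc a
    obtain ⟨m, hm⟩ := id hc
    -- In degree `2m`, multiplying `x ^ c` by `x k ^ (2m)` supplies one factor `x k` for each
    -- variable, and the product regroups into the `P i`.
    have h1 : (⟨monomial c a, monomial_mem_evenPoly hc a⟩ : evenPoly ι) * P k ^ m =
        a • ∏ i, P i ^ c i := by
      refine Subtype.ext ?_
      simp only [P, MulMemClass.coe_mul, SubmonoidClass.coe_pow, SetLike.val_smul,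
        SubmonoidClass.coe_finsetProd]
      rw [monomial_eq, Finsupp.prod_fintype _ _ (by simp), smul_eq_C_mul]
      simp_rw [mul_pow]
      rw [Finset.prod_mul_distrib, Finset.prod_pow_eq_pow_sum, ← Finsupp.degree_eq_sum, hm, pow_add]
      ring
    have h2 := congrArg φ h1
    rw [map_mul, map_pow, map_smul, map_prod, hr, smul_eq_mul] at h2
    simp_rw [map_pow] at h2
    generalize φ ⟨monomial c a, _⟩ = y at h2 ⊢
    simp_rw [div_pow]
    rw [Finset.prod_div_distrib, Finset.prod_pow_eq_pow_sum, ← Finsupp.degree_eq_sum, hm, pow_add,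
      ← mul_pow, mul_div_assoc', ← h2]
    field_simp
  refine ⟨fun i => φ (P i) / r, ?_, fun p => ?_⟩
  · change φ (P k) / r ≠ 0
    rw [hr]; simpa using hr'
  · have hev : ∀ c : p.1.support, Even c.1.degree := fun c => by
      by_contra h
      exact mem_support_iff.1 c.2 (coeff_eq_zero_of_mem_evenPoly p.2 h)
    have h1 : p = ∑ c : p.1.support,
        (⟨monomial c.1 (coeff c.1 p.1), monomial_mem_evenPoly (hev c) _⟩ : evenPoly ι) := by
      refine Subtype.ext ?_
      rw [AddSubmonoidClass.coe_finsetSum,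
        Finset.sum_coe_sort p.1.support fun c => monomial c (coeff c p.1)]
      exact p.1.as_sum
    conv_lhs => rw [h1]
    rw [map_sum, eval_eq']
    exact (Finset.sum_congr rfl fun c _ => hmono c.1 (hev c) _).trans
      (Finset.sum_coe_sort p.1.support fun c => coeff c p.1 * ∏ i, (φ (P i) / r) ^ c i)

theorem hasLead_X_pow_add {ι : Type*} (i : ι) (n : ℕ) {p : MvPolynomial ι ℝ} (hp : p ∈ degLT ι n) :
    HasLead (X i ^ n + p) (Finsupp.single i n) := by
  rw [HasLead, X_pow_eq_monomial, add_sub_cancel_left]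
  simpa using hp

/-- The perturbed system for a common zero of `d` odd polynomials on the unit sphere. -/
theorem exists_real_zero_of_odd {d : ℕ} (F : Fin d → MvPolynomial (Fin (d + 1)) ℝ)
    (hF : ∀ i, negVars _ (F i) = -F i) {D : ℕ} (hD : Odd D) (hD1 : 1 < D)
    (hdeg : ∀ i, F i ∈ degLT _ D) {t : ℝ} (ht : 0 < t) :
    ∃ x : Fin (d + 1) → ℝ, x 0 ^ (2 * D) + t * (∑ i, x i ^ 2 - 1) = 0 ∧
      ∀ i : Fin d, x i.succ ^ D + t * eval x (F i) = 0 := by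
  let Q : MvPolynomial (Fin (d + 1)) ℝ := ∑ i, X i ^ 2 - 1
  -- The single even exponent makes the two parities equally frequent, leaving `D * D ^ d` even
  -- monomials, an odd number.
  let e : Fin (d + 1) → ℕ := Fin.cons (2 * D) fun _ => D
  let G : Fin (d + 1) → MvPolynomial (Fin (d + 1)) ℝ :=
    Fin.cons (X 0 ^ (2 * D) + t • Q) fun i => X i.succ ^ D + t • F i
  have he : ∀ i, 0 < e i := by
    intro i
    refine Fin.cases ?_ (fun i => ?_) i <;> simp only [e, Fin.cons_zero, Fin.cons_succ] <;> omega
  have hG : ∀ i, HasLead (G i) (Finsupp.single i (e i)) := by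
    intro i
    refine Fin.cases ?_ (fun i => ?_) i <;> simp only [e, G, Fin.cons_zero, Fin.cons_succ]
    · refine hasLead_X_pow_add _ _ (Submodule.smul_mem _ _ (sub_mem (sum_mem fun i _ => ?_) ?_))
      · rw [X_pow_eq_monomial]
        refine monomial_mem_degLT ?_ _
        simp only [Finsupp.degree_single]
        -- Here `1 < D` enters: the squares in `Q` must have degree below `2 * D`.
        omega
      · exact monomial_mem_degLT (c := 0) (by simp only [map_zero]; omega) 1
    · exact hasLead_X_pow_add _ _ (Submodule.smul_mem _ _ (hdeg i))
  have hQ : negVars _ Q = Q := by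
    simp [Q, negVars_X]
  have hσ : ∀ i, negVars _ (G i) = (-1) ^ e i * G i := by
    intro i
    refine Fin.cases ?_ (fun i => ?_) i <;> simp only [e, G, Fin.cons_zero, Fin.cons_succ]
    · rw [map_add, map_smul, hQ, map_pow, negVars_X, (even_two_mul D).neg_pow,
        (even_two_mul D).neg_one_pow, one_mul]
    · rw [map_add, map_smul, hF, map_pow, negVars_X, hD.neg_pow, hD.neg_one_pow, smul_neg]
      ring
  have hcard : Odd (evenBox e).card := by
    have h1 := two_mul_card_evenBox e (i₀ := 0) (by simp [e])
    rw [Fin.prod_univ_succ] at h1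
    simp only [e, Fin.cons_zero, Fin.cons_succ, Finset.prod_const, mul_assoc] at h1
    rw [Nat.eq_of_mul_eq_mul_left two_pos h1]
    exact hD.mul hD.pow
  obtain ⟨φ, hφ⟩ := exists_algHom_evenPoly he hG hσ hcard
  let S : Fin (d + 1) → evenPoly (Fin (d + 1)) := fun i =>
    ⟨X i * X i, mul_mem_evenPoly (negVars_X i) (negVars_X i)⟩
  have h0 : φ (S 0) ^ D + t * (∑ i, φ (S i) - 1) = 0 := by
    have : ((S 0 ^ D + t • (∑ i, S i - 1) : evenPoly (Fin (d + 1))) : MvPolynomial _ ℝ) = G 0 := by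
      simp only [S, G, Q, Fin.cons_zero, AddMemClass.coe_add, SubmonoidClass.coe_pow,
        SetLike.val_smul, AddSubgroupClass.coe_sub, AddSubmonoidClass.coe_finsetSum,
        OneMemClass.coe_one, ← pow_two, ← pow_mul]
    have := hφ (S 0 ^ D + t • (∑ i, S i - 1)) (by
      rw [this]; exact Ideal.subset_span (Set.mem_range_self 0))
    simpa using this
  -- If all squares went to nonpositive numbers, then, as `D` is odd, the left side of the first
  -- equation would be at most `-t`.
  obtain ⟨k, hk⟩ : ∃ k, 0 < φ (S k) := by
    by_contra! h
    have h1 : φ (S 0) ^ D ≤ 0 := hD.pow_nonpos_iff.2 (h 0)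
    have h2 : ∑ i, φ (S i) ≤ 0 := Finset.sum_nonpos fun i _ => h i
    nlinarith
  obtain ⟨x, hxk, hx⟩ := algHom_evenPoly_eq_eval φ k hk
  refine ⟨x, ?_, fun i => ?_⟩
  · rw [hx] at h0
    simp_rw [hx] at h0
    simpa [S, ← pow_two, ← pow_mul] using h0
  · have hodd : negVars _ (G i.succ) = -G i.succ := by
      rw [hσ]; simp [e, hD.neg_one_pow]
    -- The remaining equations are odd, so `φ` does not apply to them directly. Multiplication by `x
    -- k` makes them even, and `x k ≠ 0` can be cancelled afterwards.
    have h1 := hφ ⟨X k * G i.succ, mul_mem_evenPoly (negVars_X k) hodd⟩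
      (Ideal.mul_mem_left _ _ (Ideal.subset_span (Set.mem_range_self _)))
    rw [hx] at h1
    simpa [G, hxk, smul_eq_C_mul] using h1

/-! ## The Borsuk-Ulam theorem -/

theorem exists_zero_of_forall_exists_lt {X : Type*} [TopologicalSpace X] {K : Set X}
    (hK : IsCompact K) {g : X → ℝ} (hg : Continuous g) (hg0 : ∀ x, 0 ≤ g x)
    (h : ∀ ε > 0, ∃ x ∈ K, g x < ε) : ∃ x ∈ K, g x = 0 := by
  obtain ⟨y, hy, -⟩ := h 1 one_pos
  obtain ⟨x, hx, hmin⟩ := hK.exists_isMinOn ⟨y, hy⟩ hg.continuousOn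
  refine ⟨x, hx, le_antisymm (not_lt.1 fun hlt => ?_) (hg0 x)⟩
  obtain ⟨z, hz, hlt'⟩ := h (g x) hlt
  exact absurd (hmin hz) (not_le.2 hlt')

/-- The first perturbed equation keeps its solutions in the unit ball, where all pure powers are at
most 1 in absolute value. Division by `t` then bounds each unperturbed expression by `1 / t`, and
compactness gives an exact zero. -/
theorem borsukUlam_polynomial {d : ℕ} (F : Fin d → MvPolynomial (Fin (d + 1)) ℝ)
    (hF : ∀ i, negVars _ (F i) = -F i) :
    ∃ x : Fin (d + 1) → ℝ, ∑ i, x i ^ 2 = 1 ∧ ∀ i, eval x (F i) = 0 := by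
  obtain ⟨N, hN⟩ : ∃ N, ∀ i, F i ∈ degLT _ N := by
    refine ⟨(Finset.univ.sup fun i => (F i).support.sup fun c => c.degree) + 1, fun i => ?_⟩
    refine (mem_restrictSupport_iff ℝ).2 fun c hc => Nat.lt_succ_iff.2 ?_
    exact (Finset.le_sup (f := fun c : Fin (d + 1) →₀ ℕ => c.degree) hc).trans
      (Finset.le_sup (f := fun i => (F i).support.sup fun c => c.degree) (Finset.mem_univ i))
  let g : (Fin (d + 1) → ℝ) → ℝ := fun x => |∑ i, x i ^ 2 - 1| + ∑ i, |eval x (F i)|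
  have hg : Continuous g := by
    have : ∀ i, Continuous fun x => eval x (F i) := fun i => MvPolynomial.continuous_eval (F i)
    fun_prop
  obtain ⟨x, -, hx⟩ := exists_zero_of_forall_exists_lt
    (K := Set.Icc (-1) 1) isCompact_Icc hg (fun x => by positivity) (by
    intro ε hε
    -- The quantity `g` consists of `d + 1` terms, each at most `1 / t = ε / (d + 2)`, so their sum
    -- stays strictly below `ε`.
    let t : ℝ := (d + 2) / ε
    have ht : 0 < t := by positivity
    -- The exponent `2 * N + 3` is odd, larger than 1 and at least the degree bound `N`.
    obtain ⟨x, hx0, hx⟩ := exists_real_zero_of_odd F hF (D := 2 * N + 3)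
      ⟨N + 1, by ring⟩ (by omega) (fun i => degLT_mono (by omega) (hN i)) ht
    have hsum : ∑ i, x i ^ 2 ≤ 1 := by
      have : 0 ≤ x 0 ^ (2 * (2 * N + 3)) := (even_two_mul _).pow_nonneg _
      nlinarith
    have habs : ∀ i, |x i| ≤ 1 := fun i => by
      rw [← sq_le_one_iff_abs_le_one]
      exact (Finset.single_le_sum (f := fun i => x i ^ 2) (fun i _ => sq_nonneg _)
        (Finset.mem_univ i)).trans hsum
    have hpow : ∀ i n, |x i ^ n| ≤ 1 := fun i n => by
      rw [abs_pow]; exact pow_le_one₀ (abs_nonneg _) (habs i)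
    have hsmall : ∀ a b : ℝ, |a| ≤ 1 → a + t * b = 0 → |b| ≤ 1 / t := by
      intro a b ha hab
      have : b = -a / t := by field_simp; linarith
      rw [this, abs_div, abs_neg, abs_of_pos ht]
      gcongr
    refine ⟨x, ⟨fun i => (abs_le.1 (habs i)).1, fun i => (abs_le.1 (habs i)).2⟩, ?_⟩
    have h1 := hsmall _ _ (hpow _ _) hx0
    have h2 : ∑ i, |eval x (F i)| ≤ ∑ _i : Fin d, 1 / t :=
      Finset.sum_le_sum fun i _ => hsmall _ _ (hpow _ _) (hx i)
    rw [Finset.sum_const, Finset.card_univ, Fintype.card_fin, nsmul_eq_mul] at h2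
    have h3 : (d + 2) * (1 / t) = ε := by simp only [t]; field_simp
    have h4 : 0 < 1 / t := by positivity
    simp only [g]
    linarith)
  have hs : 0 ≤ ∑ i, |eval x (F i)| := Finset.sum_nonneg fun i _ => abs_nonneg _
  have h1 : |∑ i, x i ^ 2 - 1| = 0 := by
    have := abs_nonneg (∑ i, x i ^ 2 - 1); simp only [g] at hx; linarith
  have h2 : ∑ i, |eval x (F i)| = 0 := by simp only [g] at hx; linarith
  refine ⟨x, by linarith [abs_eq_zero.1 h1], fun i => abs_eq_zero.1 ?_⟩
  exact (Finset.sum_eq_zero_iff_of_nonneg fun i _ => abs_nonneg _).1 h2 i (Finset.mem_univ i)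

/-- Stone-Weierstrass for the algebra generated by the coordinate functions, which separate points.
-/
theorem exists_mvPolynomial_near {ι : Type*} [Fintype ι] {K : Set (ι → ℝ)} (hK : IsCompact K)
    {h : (ι → ℝ) → ℝ} (hh : Continuous h) {ε : ℝ} (hε : 0 < ε) :
    ∃ p : MvPolynomial ι ℝ, ∀ x ∈ K, |eval x p - h x| < ε := by
  let c : ι → C(ι → ℝ, ℝ) := fun i => ⟨fun x => x i, continuous_apply i⟩
  have hA : (aeval c : MvPolynomial ι ℝ →ₐ[ℝ] C(ι → ℝ, ℝ)).range.SeparatesPoints := by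
    intro x y hxy
    obtain ⟨i, hi⟩ := Function.ne_iff.1 hxy
    exact ⟨c i, ⟨c i, ⟨X i, by simp⟩, rfl⟩, hi⟩
  obtain ⟨_, ⟨p, rfl⟩, hp⟩ :=
    ContinuousMap.exists_mem_subalgebra_near_continuous_of_isCompact_of_separatesPoints hA
      ⟨h, hh⟩ hK hε
  refine ⟨p, fun x hx => ?_⟩
  have h1 : (aeval c p) x = eval x p := by
    have : (ContinuousMap.evalAlgHom ℝ ℝ x).comp (aeval c) = aeval x := by
      ext i
      simp [c]
    simpa using congrArg (fun f => f p) this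
  have : |(aeval c p) x - h x| < ε := hp x hx
  rwa [h1] at this

theorem borsukUlam_odd_of_continuous {d : ℕ} {h : (Fin (d + 1) → ℝ) → Fin d → ℝ}
    (hc : Continuous h) (hodd : ∀ x, h (-x) = -h x) :
    ∃ x : Fin (d + 1) → ℝ, ∑ i, x i ^ 2 = 1 ∧ h x = 0 := by
  have hK : IsCompact {x : Fin (d + 1) → ℝ | ∑ i, x i ^ 2 = 1} := by
    refine (isCompact_Icc (a := (-1 : Fin (d + 1) → ℝ)) (b := 1)).of_isClosed_subset
      (isClosed_eq (by fun_prop) continuous_const) fun x hx => ?_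
    have habs : ∀ i, |x i| ≤ 1 := fun i => by
      rw [← sq_le_one_iff_abs_le_one, ← show ∑ i, x i ^ 2 = 1 from hx]
      exact Finset.single_le_sum (f := fun i => x i ^ 2) (fun i _ => sq_nonneg _)
        (Finset.mem_univ i)
    exact ⟨fun i => (abs_le.1 (habs i)).1, fun i => (abs_le.1 (habs i)).2⟩
  obtain ⟨x, hx, hx0⟩ := exists_zero_of_forall_exists_lt hK (g := fun x => ∑ i, |h x i|)
    (by fun_prop) (fun x => Finset.sum_nonneg fun i _ => abs_nonneg _) (by
    intro ε hε
    have hδ : 0 < ε / (d + 1) := by positivity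
    choose p hp using fun i : Fin d => exists_mvPolynomial_near hK
      (h := fun x => h x i) (by fun_prop) hδ
    -- The odd part of an approximation to an odd function on a symmetric set is as good an
    -- approximation, so a zero of `F` makes each component of `h` smaller than `ε / (d + 1)`.
    let F : Fin d → MvPolynomial (Fin (d + 1)) ℝ := fun i => (1 / 2 : ℝ) • (p i - negVars _ (p i))
    have hinv : ∀ q : MvPolynomial (Fin (d + 1)) ℝ, negVars _ (negVars _ q) = q := by
      intro q
      have : (negVars (Fin (d + 1))).comp (negVars _) = AlgHom.id ℝ _ := by
        ext i
        simp [negVars]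
      exact congrArg (fun f => f q) this
    obtain ⟨x, hx, hxF⟩ := borsukUlam_polynomial F fun i => by
      simp only [F, map_smul, map_sub, hinv, ← smul_neg, neg_sub]
    refine ⟨x, hx, ?_⟩
    have hb : ∀ i, |h x i| ≤ ε / (d + 1) := by
      intro i
      have h1 := hp i x hx
      have h2 := hp i (-x) (by simpa using hx)
      have h3 := hxF i
      simp only [F, smul_eval, map_sub, eval_negVars, hodd, Pi.neg_apply] at h1 h2 h3
      rw [abs_lt] at h1 h2
      rw [abs_le]
      constructor <;> linarith
    have := Finset.sum_le_sum fun i (_ : i ∈ Finset.univ) => hb i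
    rw [Finset.sum_const, Finset.card_univ, Fintype.card_fin, nsmul_eq_mul] at this
    refine this.trans_lt ?_
    rw [mul_div_assoc', div_lt_iff₀ (by positivity)]
    nlinarith)
  refine ⟨x, hx, funext fun i => abs_eq_zero.1 ?_⟩
  exact (Finset.sum_eq_zero_iff_of_nonneg fun i _ => abs_nonneg _).1 hx0 i (Finset.mem_univ i)

/-- The Borsuk-Ulam theorem on the unit sphere of the `L₁` norm. -/
theorem exists_antipodal_eq_of_continuous {d : ℕ} {f : (Fin (d + 1) → ℝ) → Fin d → ℝ}
    (hf : Continuous f) : ∃ x : Fin (d + 1) → ℝ, ∑ i, |x i| = 1 ∧ f x = f (-x) := by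
  -- On the Euclidean sphere the L₁ norm is at least 1, so there `s` is the L₁ norm and `x / s x` is
  -- the radial projection to the L₁ sphere. The maximum with 1 keeps it continuous on all of space.
  let s : (Fin (d + 1) → ℝ) → ℝ := fun x => max (∑ i, |x i|) 1
  have hs0 : ∀ x, 0 < s x := fun x => lt_max_of_lt_right one_pos
  have hs : Continuous s := by fun_prop
  have hs' : ∀ x, s (-x) = s x := fun x => by simp [s]
  have hsc : Continuous fun x => (s x)⁻¹ • x := (hs.inv₀ fun x => (hs0 x).ne').smul continuous_id
  obtain ⟨x, hx, hx0⟩ := borsukUlam_odd_of_continuous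
    (h := fun x => f ((s x)⁻¹ • x) - f (-((s x)⁻¹ • x)))
    ((hf.comp hsc).sub (hf.comp hsc.neg)) (fun x => by simp [hs'])
  refine ⟨(s x)⁻¹ • x, ?_, sub_eq_zero.1 hx0⟩
  have h1 : 1 ≤ ∑ i, |x i| := by
    rw [← hx]
    refine Finset.sum_le_sum fun i _ => ?_
    have : |x i| ≤ 1 := by
      rw [← sq_le_one_iff_abs_le_one, ← hx]
      exact Finset.single_le_sum (f := fun i => x i ^ 2) (fun i _ => sq_nonneg _)
        (Finset.mem_univ i)
    rw [← sq_abs]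
    nlinarith [abs_nonneg (x i)]
  have h2 : s x = ∑ i, |x i| := max_eq_left h1
  simp only [Pi.smul_apply, smul_eq_mul, abs_mul, abs_inv, abs_of_pos (hs0 x)]
  rw [← Finset.mul_sum, ← h2, inv_mul_cancel₀ (hs0 x).ne']

/-! ## Running a stack machine inside a larger one -/

open Turing

/-! ### Counted runs and simulation -/

section Iterate

/-- `n` steps of `f` lead from `a` to `b`. -/
def StepsTo {α : Type*} (f : α → Option α) (n : ℕ) (a b : α) : Prop :=
  (flip bind f)^[n] (some a) = some b

variable {α β : Type*} {f : α → Option α} {g : β → Option β}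

theorem StepsTo.refl (f : α → Option α) (a : α) : StepsTo f 0 a a := rfl

theorem stepsTo_succ {n : ℕ} {a b : α} :
    StepsTo f (n + 1) a b ↔ ∃ c, f a = some c ∧ StepsTo f n c b := by
  have hnone : ∀ n, (flip bind f)^[n] none = (none : Option α) := by
    intro n
    induction n with
    | zero => rfl
    | succ n ih => rw [Function.iterate_succ_apply]; exact ih
  have h : (flip bind f) (some a) = f a := rfl
  rw [StepsTo, Function.iterate_succ_apply, h]
  cases hf : f a with
  | none =>
    refine ⟨fun h' => ?_, fun ⟨c, hc, _⟩ => nomatch hc⟩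
    rw [hnone] at h'
    nomatch h'
  | some c => simp [StepsTo]

theorem StepsTo.trans {m n : ℕ} {a b c : α} (h₁ : StepsTo f m a b) (h₂ : StepsTo f n b c) :
    StepsTo f (m + n) a c := by
  rw [StepsTo, add_comm, Function.iterate_add_apply, h₁, h₂]

theorem StepsTo.head {n : ℕ} {a b c : α} (h₁ : f a = some b) (h₂ : StepsTo f n b c) :
    StepsTo f (n + 1) a c :=
  stepsTo_succ.2 ⟨b, h₁, h₂⟩

theorem StepsTo.simulate {r : α → β → Prop}
    (h : ∀ a b a', r a a' → f a = some b → ∃ b', g a' = some b' ∧ r b b') {n : ℕ} :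
    ∀ {a b : α} {a' : β}, StepsTo f n a b → r a a' → ∃ b', StepsTo g n a' b' ∧ r b b' := by
  induction n with
  | zero =>
    intro a b a' hab hr
    obtain rfl : a = b := Option.some_injective _ hab
    exact ⟨a', StepsTo.refl g a', hr⟩
  | succ n ih =>
    intro a b a' hab hr
    obtain ⟨c, hc, hcb⟩ := stepsTo_succ.1 hab
    obtain ⟨c', hc', hr'⟩ := h a c a' hr hc
    obtain ⟨b', hb', hr''⟩ := ih hcb hr'
    exact ⟨b', hb'.head hc', hr''⟩

end Iterate

section Lift

variable {K K' : Type} [DecidableEq K] [DecidableEq K'] (i : K → K') {Γ : K' → Type}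
  {Λ Λ' σ σ' : Type} (get : σ' → σ) (put : σ → σ') (lab : Λ → Λ') (fin : Option Λ')

/-- A statement of a machine with stacks `K` as a statement of a machine with more stacks, where
halting is replaced by going to `fin`. -/
def liftStmt : TM2.Stmt (fun k => Γ (i k)) Λ σ → TM2.Stmt Γ Λ' σ'
  | .push k f q => .push (i k) (fun s => f (get s)) (liftStmt q)
  | .peek k f q => .peek (i k) (fun s o => put (f (get s) o)) (liftStmt q)
  | .pop k f q => .pop (i k) (fun s o => put (f (get s) o)) (liftStmt q)
  | .load f q => .load (fun s => put (f (get s))) (liftStmt q)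
  | .branch p q r => .branch (fun s => p (get s)) (liftStmt q) (liftStmt r)
  | .goto l => .goto fun s => lab (l (get s))
  | .halt => match fin with
    | some d => .goto fun _ => d
    | none => .halt

/-- The configuration `c'` of the larger machine represents the configuration `c`, and its other
stacks are those of `R`. -/
structure LiftRel (R : ∀ k, List (Γ k)) (c : TM2.Cfg (fun k => Γ (i k)) Λ σ)
    (c' : TM2.Cfg Γ Λ' σ') : Prop where
  label : c'.l = c.l.elim fin (some ∘ lab)
  var : c'.var = put c.var
  stk : ∀ k, c'.stk (i k) = c.stk k
  other : ∀ k', k' ∉ Set.range i → c'.stk k' = R k'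

variable {i get put lab fin}

/-- The simulation is step for step. Injectivity of `i` keeps distinct stacks distinct, stacks
outside its range are untouched, and `get` recovers the inner state from what `put` stores. -/
theorem liftRel_stepAux (hi : Function.Injective i) (hgp : ∀ a, get (put a) = a)
    {R : ∀ k, List (Γ k)} (q : TM2.Stmt (fun k => Γ (i k)) Λ σ) :
    ∀ (v : σ) (S : ∀ k, List (Γ (i k))) (S' : ∀ k, List (Γ k)), (∀ k, S' (i k) = S k) →
      (∀ k', k' ∉ Set.range i → S' k' = R k') →
      LiftRel i put lab fin R (TM2.stepAux q v S)
        (TM2.stepAux (liftStmt i get put lab fin q) (put v) S') := by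
  have hupd : ∀ (S : ∀ k, List (Γ (i k))) (S' : ∀ k, List (Γ k)) (k : K) (L : List (Γ (i k))),
      (∀ k, S' (i k) = S k) → ∀ j, Function.update S' (i k) L (i j) = Function.update S k L j := by
    intro S S' k L h j
    rcases eq_or_ne j k with rfl | hjk
    · simp
    · rw [Function.update_of_ne hjk, Function.update_of_ne (hi.ne hjk), h]
  have hupd' : ∀ (S' : ∀ k, List (Γ k)) (k : K) (L : List (Γ (i k))),
      (∀ k', k' ∉ Set.range i → S' k' = R k') →
      ∀ k', k' ∉ Set.range i → Function.update S' (i k) L k' = R k' := by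
    intro S' k L h k' hk'
    rw [Function.update_of_ne, h k' hk']
    rintro rfl
    exact hk' (Set.mem_range_self k)
  induction q with
  | push k f q ih =>
    intro v S S' h h'
    simp only [liftStmt, TM2.stepAux, hgp, h]
    exact ih _ _ _ (hupd S S' k _ h) (hupd' S' k _ h')
  | peek k f q ih =>
    intro v S S' h h'
    simp only [liftStmt, TM2.stepAux, hgp, h]
    exact ih _ _ _ h h'
  | pop k f q ih =>
    intro v S S' h h'
    simp only [liftStmt, TM2.stepAux, hgp, h]
    exact ih _ _ _ (hupd S S' k _ h) (hupd' S' k _ h')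
  | load f q ih =>
    intro v S S' h h'
    simp only [liftStmt, TM2.stepAux, hgp]
    exact ih _ _ _ h h'
  | branch p q r ihq ihr =>
    intro v S S' h h'
    simp only [liftStmt, TM2.stepAux, hgp]
    cases p v
    · exact ihr _ _ _ h h'
    · exact ihq _ _ _ h h'
  | goto l =>
    intro v S S' h h'
    simp only [liftStmt, TM2.stepAux, hgp]
    exact ⟨rfl, rfl, h, h'⟩
  | halt =>
    intro v S S' h h'
    cases fin <;> exact ⟨rfl, rfl, h, h'⟩

theorem LiftRel.step (hi : Function.Injective i) (hgp : ∀ a, get (put a) = a)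
    {R : ∀ k, List (Γ k)} {m : Λ → TM2.Stmt (fun k => Γ (i k)) Λ σ} {m' : Λ' → TM2.Stmt Γ Λ' σ'}
    (hm : ∀ l, m' (lab l) = liftStmt i get put lab fin (m l))
    (a b : TM2.Cfg (fun k => Γ (i k)) Λ σ) (a' : TM2.Cfg Γ Λ' σ')
    (hr : LiftRel i put lab fin R a a') (hab : TM2.step m a = some b) :
    ∃ b', TM2.step m' a' = some b' ∧ LiftRel i put lab fin R b b' := by
  obtain ⟨_ | l, v, S⟩ := a
  · simp [TM2.step] at hab
  · obtain ⟨l', v', S'⟩ := a'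
    obtain ⟨h1, h2, h3, h4⟩ := hr
    simp only [Option.elim_some, Function.comp_apply] at h1 h2 h3 h4
    subst h1 h2
    simp only [TM2.step, Option.some.injEq] at hab ⊢
    subst hab
    exact ⟨_, rfl, hm l ▸ liftRel_stepAux hi hgp (m l) v S S' h3 h4⟩

end Lift

/-! ## The length of the output -/

section Length

variable {K : Type} [DecidableEq K] {Γ : K → Type} {Λ σ : Type}

/-- The number of symbols that a statement may push. -/
def pushes : TM2.Stmt Γ Λ σ → ℕ
  | .push _ _ q => pushes q + 1
  | .peek _ _ q => pushes q
  | .pop _ _ q => pushes q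
  | .load _ q => pushes q
  | .branch _ q r => pushes q + pushes r
  | .goto _ => 0
  | .halt => 0

theorem length_stepAux_le (q : TM2.Stmt Γ Λ σ) (k : K) : ∀ v S,
    ((TM2.stepAux q v S).stk k).length ≤ (S k).length + pushes q := by
  induction q with
  | push j f q ih =>
    intro v S
    refine (ih _ _).trans ?_
    rcases eq_or_ne k j with rfl | h
    · simp [pushes]; omega
    · simp [pushes, h]
  | pop j f q ih =>
    intro v S
    refine (ih _ _).trans ?_
    rcases eq_or_ne k j with rfl | h
    · simp [pushes]
    · simp [pushes, h]
  | peek j f q ih => intro v S; exact ih _ _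
  | load f q ih => intro v S; exact ih _ _
  | branch p q r ihq ihr =>
    intro v S
    simp only [TM2.stepAux, pushes]
    cases p v
    · exact (ihr v S).trans (by omega)
    · exact (ihq v S).trans (by omega)
  | goto l => intro v S; simp [TM2.stepAux, pushes]
  | halt => intro v S; simp [TM2.stepAux, pushes]

/-- A stack grows by a bounded amount per step. In a composition, this bounds the intermediate
string, hence the copying time and the argument of the second time bound. -/
theorem StepsTo.length_le {m : Λ → TM2.Stmt Γ Λ σ} {C : ℕ} (hC : ∀ l, pushes (m l) ≤ C) (k : K)
    {n : ℕ} : ∀ {a b : TM2.Cfg Γ Λ σ}, StepsTo (TM2.step m) n a b →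
    (b.stk k).length ≤ (a.stk k).length + C * n := by
  induction n with
  | zero => intro a b h; obtain rfl : a = b := Option.some_injective _ h; simp
  | succ n ih =>
    intro a b h
    obtain ⟨c, hc, hcb⟩ := stepsTo_succ.1 h
    refine (ih hcb).trans ?_
    obtain ⟨_ | l, v, S⟩ := a
    · simp [TM2.step] at hc
    · simp only [TM2.step, Option.some.injEq] at hc
      subst hc
      have := length_stepAux_le (m l) k v S
      have := hC l
      simp only [mul_add]
      omega

end Length

/-! ## Composition of polynomial-time machines -/

theorem initList_stk (tm : FinTM2) (s : List (tm.Γ tm.k₀)) :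
    (initList tm s).stk = Function.update (fun _ => []) tm.k₀ s := by
  funext k
  by_cases h : k = tm.k₀
  · subst h; simp [initList]
  · simp [initList, h]

theorem haltList_stk (tm : FinTM2) (s : List (tm.Γ tm.k₁)) :
    (haltList tm s).stk = Function.update (fun _ => []) tm.k₁ s := by
  funext k
  by_cases h : k = tm.k₁
  · subst h; simp [haltList]
  · simp [haltList, h]

section Comp

variable (M₁ M₂ : FinTM2)

/-- Stacks of the composed machine: those of both machines and one more for copying. -/
abbrev CompΓ : M₁.K ⊕ M₂.K ⊕ Unit → Type
  | .inl k => M₁.Γ k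
  | .inr (.inl k) => M₂.Γ k
  | .inr (.inr _) => M₂.Γ M₂.k₀

/-- Labels of the composed machine: those of both machines and two for copying the output of the
first to the input of the second. -/
abbrev CompΛ : Type := M₁.Λ ⊕ M₂.Λ ⊕ Bool

abbrev Compσ : Type := M₁.σ × M₂.σ × Option (M₂.Γ M₂.k₀)

variable (tr : M₁.Γ M₁.k₁ → M₂.Γ M₂.k₀) (junk : M₂.Γ M₂.k₀)

/-- The program of the composed machine. -/
def compProg : CompΛ M₁ M₂ → TM2.Stmt (CompΓ M₁ M₂) (CompΛ M₁ M₂) (Compσ M₁ M₂)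
  | .inl l => liftStmt (Γ := CompΓ M₁ M₂) Sum.inl Prod.fst (fun a => (a, M₂.initialState, none))
      Sum.inl (some (.inr (.inr false))) (M₁.m l)
  | .inr (.inl l) => liftStmt (Γ := CompΓ M₁ M₂) (fun k => .inr (.inl k)) (fun s => s.2.1)
      (fun b => (M₁.initialState, b, none)) (fun l => .inr (.inl l)) none (M₂.m l)
  -- The symbol `junk` is never written: the branch has checked that a symbol was popped.
  | .inr (.inr false) => .pop (.inl M₁.k₁) (fun s o => (s.1, s.2.1, o.map tr)) <|
      .branch (fun s => s.2.2.isSome)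
        (.push (.inr (.inr ())) (fun s => s.2.2.getD junk) <| .goto fun _ => .inr (.inr false))
        (.goto fun _ => .inr (.inr true))
  | .inr (.inr true) => .pop (.inr (.inr ())) (fun s o => (s.1, s.2.1, o)) <|
      .branch (fun s => s.2.2.isSome)
        (.push (.inr (.inl M₂.k₀)) (fun s => s.2.2.getD junk) <| .goto fun _ => .inr (.inr true))
        (.goto fun _ => .inr (.inl M₂.main))

/-- The machine that runs `M₁` and then `M₂` on the output of `M₁`. -/
def compMachine : FinTM2 :=
  letI := M₁.kFin
  letI := M₂.kFin
  letI := M₁.ΛFin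
  letI := M₂.ΛFin
  letI := M₁.σFin
  letI := M₂.σFin
  letI := M₂.Γk₀Fin
  letI : Fintype (CompΓ M₁ M₂ (.inl M₁.k₀)) := M₁.Γk₀Fin
  { K := M₁.K ⊕ M₂.K ⊕ Unit
    k₀ := .inl M₁.k₀
    k₁ := .inr (.inl M₂.k₁)
    Γ := CompΓ M₁ M₂
    Λ := CompΛ M₁ M₂
    main := .inl M₁.main
    σ := Compσ M₁ M₂
    initialState := (M₁.initialState, M₂.initialState, none)
    m := compProg M₁ M₂ tr junk }

/-- Stacks while the output of the first machine is copied. -/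
def copyStk (A : List (M₁.Γ M₁.k₁)) (B T : List (M₂.Γ M₂.k₀)) : ∀ k, List (CompΓ M₁ M₂ k)
  | .inl k => Function.update (β := fun k => List (M₁.Γ k)) (fun _ => []) M₁.k₁ A k
  | .inr (.inl k) => Function.update (β := fun k => List (M₂.Γ k)) (fun _ => []) M₂.k₀ B k
  | .inr (.inr _) => T

variable {M₁ M₂ tr junk}

theorem update_copyStk_inl (A A' : List (M₁.Γ M₁.k₁)) (B T : List (M₂.Γ M₂.k₀)) :
    Function.update (copyStk M₁ M₂ A B T) (.inl M₁.k₁) A' = copyStk M₁ M₂ A' B T := by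
  funext k
  rcases k with k | k | k
  · rcases eq_or_ne k M₁.k₁ with rfl | h <;> simp [copyStk, *]
  all_goals simp [copyStk]

theorem update_copyStk_mid (A : List (M₁.Γ M₁.k₁)) (B B' T : List (M₂.Γ M₂.k₀)) :
    Function.update (copyStk M₁ M₂ A B T) (.inr (.inl M₂.k₀)) B' = copyStk M₁ M₂ A B' T := by
  funext k
  rcases k with k | k | k
  · simp [copyStk]
  · rcases eq_or_ne k M₂.k₀ with rfl | h <;> simp [copyStk, *]
  · simp [copyStk]

theorem update_copyStk_inr (A : List (M₁.Γ M₁.k₁)) (B T T' : List (M₂.Γ M₂.k₀)) :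
    Function.update (copyStk M₁ M₂ A B T) (.inr (.inr ())) T' = copyStk M₁ M₂ A B T' := by
  funext k
  rcases k with k | k | k <;> simp [copyStk]

/-- Moving a stack symbol by symbol reverses it, so the output goes through an auxiliary stack and
`stepsTo_copy_in` reverses it back. The extra step is the pop that finds the stack empty. -/
theorem stepsTo_copy_out (A : List (M₁.Γ M₁.k₁)) :
    ∀ (T : List (M₂.Γ M₂.k₀)) (o : Option (M₂.Γ M₂.k₀)),
    StepsTo (TM2.step (compProg M₁ M₂ tr junk)) (A.length + 1)
      ⟨some (.inr (.inr false)), (M₁.initialState, M₂.initialState, o), copyStk M₁ M₂ A [] T⟩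
      ⟨some (.inr (.inr true)), (M₁.initialState, M₂.initialState, none),
        copyStk M₁ M₂ [] [] ((A.map tr).reverse ++ T)⟩ := by
  have hA : ∀ A T, copyStk M₁ M₂ A [] T (.inl M₁.k₁) = A := fun A T => by simp [copyStk]
  have hT : ∀ A T, copyStk M₁ M₂ A [] T (.inr (.inr ())) = T := fun A T => by simp [copyStk]
  induction A with
  | nil =>
    intro T o
    refine (StepsTo.refl _ _).head ?_
    simp [TM2.step, compProg, hA, update_copyStk_inl]
  | cons a A ih =>
    intro T o
    have := ih (tr a :: T) (some (tr a))
    rw [List.map_cons, List.reverse_cons, List.append_assoc]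
    refine StepsTo.head ?_ this
    simp [TM2.step, compProg, hA, hT, update_copyStk_inl, update_copyStk_inr]

theorem stepsTo_copy_in (T : List (M₂.Γ M₂.k₀)) :
    ∀ (B : List (M₂.Γ M₂.k₀)) (o : Option (M₂.Γ M₂.k₀)),
    StepsTo (TM2.step (compProg M₁ M₂ tr junk)) (T.length + 1)
      ⟨some (.inr (.inr true)), (M₁.initialState, M₂.initialState, o), copyStk M₁ M₂ [] B T⟩
      ⟨some (.inr (.inl M₂.main)), (M₁.initialState, M₂.initialState, none),
        copyStk M₁ M₂ [] (T.reverse ++ B) []⟩ := by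
  have hB : ∀ B T, copyStk M₁ M₂ [] B T (.inr (.inl M₂.k₀)) = B := fun A T => by simp [copyStk]
  have hT : ∀ B T, copyStk M₁ M₂ [] B T (.inr (.inr ())) = T := fun A T => by simp [copyStk]
  induction T with
  | nil =>
    intro T o
    refine (StepsTo.refl _ _).head ?_
    simp [TM2.step, compProg, hT, update_copyStk_inr]
  | cons a A ih =>
    intro T o
    have := ih (a :: T) (some a)
    rw [List.reverse_cons, List.append_assoc]
    refine StepsTo.head ?_ this
    simp [TM2.step, compProg, hB, hT, update_copyStk_mid, update_copyStk_inr]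

/-- Halting with `haltList` leaves a reset state and a single possibly nonempty stack. Hence the end
of the first run is a `copyStk` configuration, and after two copying passes the second machine
starts from its own initial configuration. -/
theorem stepsTo_compMachine {s : List (M₁.Γ M₁.k₀)} {u : List (M₁.Γ M₁.k₁)}
    {v : List (M₂.Γ M₂.k₁)} {n₁ n₂ : ℕ}
    (h₁ : StepsTo M₁.step n₁ (initList M₁ s) (haltList M₁ u))
    (h₂ : StepsTo M₂.step n₂ (initList M₂ (u.map tr)) (haltList M₂ v)) :
    StepsTo (compMachine M₁ M₂ tr junk).step (n₁ + (u.length + 1) + (u.length + 1) + n₂)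
      (initList (compMachine M₁ M₂ tr junk) s) (haltList (compMachine M₁ M₂ tr junk) v) := by
  have hi : Function.Injective (Sum.inl : M₁.K → M₁.K ⊕ M₂.K ⊕ Unit) := Sum.inl_injective
  have hi' : Function.Injective (fun k => .inr (.inl k) : M₂.K → M₁.K ⊕ M₂.K ⊕ Unit) :=
    Sum.inr_injective.comp Sum.inl_injective
  obtain ⟨c₁, hc₁, r₁⟩ := h₁.simulate (g := TM2.step (compProg M₁ M₂ tr junk))
    (LiftRel.step (Γ := CompΓ M₁ M₂) (R := fun _ => []) hi (m := M₁.m) (get := Prod.fst)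
      (put := fun a => (a, M₂.initialState, none)) (lab := Sum.inl)
      (fin := some (.inr (.inr false))) (fun _ => rfl) (fun _ => rfl))
    (a' := ⟨some (.inl M₁.main), (M₁.initialState, M₂.initialState, none),
      Function.update (fun _ => []) (.inl M₁.k₀) s⟩) ⟨rfl, rfl, fun k => by
        rw [initList_stk]
        rcases eq_or_ne k M₁.k₀ with rfl | h <;> simp [*], fun k hk => by
        rcases k with k | k | k
        · exact (hk (Set.mem_range_self k)).elim
        all_goals simp⟩
  have e₁ : c₁ = ⟨some (.inr (.inr false)), (M₁.initialState, M₂.initialState, none),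
      copyStk M₁ M₂ u [] []⟩ := by
    obtain ⟨l, w, S⟩ := c₁
    obtain ⟨r1, r2, r3, r4⟩ := r₁
    simp only at r1 r2 r3 r4
    subst r1 r2
    congr 1
    funext k
    rcases k with k | k | k
    · rw [r3 k, haltList_stk]
      rfl
    all_goals rw [r4 _ (by simp)]; simp [copyStk]
  obtain ⟨c₂, hc₂, r₂⟩ := h₂.simulate (g := TM2.step (compProg M₁ M₂ tr junk))
    (LiftRel.step (Γ := CompΓ M₁ M₂) (R := fun _ => []) hi' (m := M₂.m) (get := fun s => s.2.1)
      (put := fun a => (M₁.initialState, a, none)) (lab := fun l => .inr (.inl l))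
      (fin := none) (fun _ => rfl) (fun _ => rfl))
    (a' := ⟨some (.inr (.inl M₂.main)), (M₁.initialState, M₂.initialState, none),
      copyStk M₁ M₂ [] (u.map tr) []⟩) ⟨rfl, rfl, fun k => by
        rw [initList_stk]
        rfl, fun k hk => by
        rcases k with k | k | k
        · simp [copyStk]
        · exact (hk (Set.mem_range_self k)).elim
        · simp [copyStk]⟩
  have e₂ : c₂ = haltList (compMachine M₁ M₂ tr junk) v := by
    obtain ⟨l, w, S⟩ := c₂
    obtain ⟨r1, r2, r3, r4⟩ := r₂
    simp only at r1 r2 r3 r4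
    subst r1 r2
    have : S = (haltList (compMachine M₁ M₂ tr junk) v).stk := by
      have h0 : (haltList (compMachine M₁ M₂ tr junk) v).stk =
          Function.update (β := fun k => List (CompΓ M₁ M₂ k)) (fun _ => []) (.inr (.inl M₂.k₁)) v :=
        haltList_stk (compMachine M₁ M₂ tr junk) v
      refine Eq.trans ?_ h0.symm
      funext k
      rcases k with k | k | k
      · rw [r4 _ (by simp)]; simp
      · rw [r3 k, haltList_stk]
        rcases eq_or_ne k M₂.k₁ with rfl | h <;> simp [*]
      · rw [r4 _ (by simp)]; simp
    subst this
    rfl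
  have e₀ : initList (compMachine M₁ M₂ tr junk) s = ⟨some (.inl M₁.main),
      (M₁.initialState, M₂.initialState, none),
      Function.update (β := fun k => List (CompΓ M₁ M₂ k)) (fun _ => []) (.inl M₁.k₀) s⟩ := by
    have := initList_stk (compMachine M₁ M₂ tr junk) s
    generalize hc : initList (compMachine M₁ M₂ tr junk) s = c at this
    obtain ⟨l, w, S⟩ := c
    subst this
    have h1 := congrArg TM2.Cfg.l hc
    have h2 := congrArg TM2.Cfg.var hc
    simp only at h1 h2
    subst h1 h2
    rfl
  subst e₁ e₂
  have q₁ := stepsTo_copy_out (tr := tr) (junk := junk) u [] none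
  have q₂ := stepsTo_copy_in (M₁ := M₁) (tr := tr) (junk := junk) (u.map tr).reverse [] none
  simp only [List.append_nil, List.length_reverse, List.length_map, List.reverse_reverse] at q₁ q₂
  have := ((hc₁.trans q₁).trans q₂).trans hc₂
  rw [e₀]
  exact this

theorem polynomial_eval_mono (p : Polynomial ℕ) : Monotone fun n => p.eval n := by
  intro a b h
  simp only [Polynomial.eval_eq_sum, Polynomial.sum]
  gcongr

/-- Polynomial-time functions compose. -/
theorem PolyTime.comp {α β γ Γ Δ Θ : Type} [Inhabited Δ] {ea : α → List Γ} {eb : β → List Δ}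
    {ec : γ → List Θ} {f : α → β} {g : β → γ} (hg : PolyTime eb ec g) (hf : PolyTime ea eb f) :
    PolyTime ea ec (g ∘ f) := by
  obtain ⟨⟨⟨M₁, i₁, o₁⟩, t₁, h₁⟩⟩ := hf
  obtain ⟨⟨⟨M₂, i₂, o₂⟩, t₂, h₂⟩⟩ := hg
  -- The two machines write the intermediate alphabet `Δ` in their own symbols; this translates from
  -- one to the other.
  let tr : M₁.Γ M₁.k₁ → M₂.Γ M₂.k₀ := fun a => i₂.symm (o₁ a)
  let _ := M₁.ΛFin
  obtain ⟨C, hC⟩ : ∃ C, ∀ l, pushes (M₁.m l) ≤ C :=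
    ⟨Finset.univ.sup fun l => pushes (M₁.m l), fun l =>
      Finset.le_sup (f := fun l => pushes (M₁.m l)) (Finset.mem_univ l)⟩
  let len : Polynomial ℕ := Polynomial.X + Polynomial.C C * t₁
  refine ⟨⟨⟨compMachine M₁ M₂ tr (i₂.symm default), i₁, o₂⟩,
    t₁ + 2 * (len + 1) + t₂.comp len, fun a => ?_⟩⟩
  obtain ⟨⟨n₁, r₁⟩, b₁⟩ := h₁ a
  obtain ⟨⟨n₂, r₂⟩, b₂⟩ := h₂ (f a)
  have r₁' : StepsTo M₁.step n₁ _ (haltList M₁ ((eb (f a)).map o₁.symm)) := r₁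
  have r₂' : StepsTo M₂.step n₂ (initList M₂ ((eb (f a)).map i₂.symm))
    (haltList M₂ ((ec (g (f a))).map o₂.symm)) := r₂
  have htr : ((eb (f a)).map o₁.symm).map tr = (eb (f a)).map i₂.symm := by
    simp [tr, Function.comp_def]
  rw [← htr] at r₂'
  have hlen : (eb (f a)).length ≤ len.eval (ea a).length := by
    have h := StepsTo.length_le hC M₁.k₁ r₁'
    rw [haltList_stk, initList_stk, Function.update_self, List.length_map] at h
    refine h.trans ?_
    simp only [len, Polynomial.eval_add, Polynomial.eval_X, Polynomial.eval_mul, Polynomial.eval_C]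
    refine add_le_add ?_ (Nat.mul_le_mul_left C b₁)
    -- The output stack may be the input stack, which starts with the input; otherwise it starts
    -- empty. The summand `X` of `len` covers the first case.
    by_cases hk : M₁.k₁ = M₁.k₀
    · rw [hk]; simp
    · simp [Function.update_of_ne hk]
  refine ⟨⟨_, stepsTo_compMachine r₁' r₂'⟩, ?_⟩
  have b₁ : n₁ ≤ _ := b₁
  have b₂ : n₂ ≤ _ := b₂
  have := b₂.trans (polynomial_eval_mono t₂ hlen)
  simp only [List.length_map, Polynomial.eval_add, Polynomial.eval_mul, Polynomial.eval_ofNat,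
    Polynomial.eval_one, Polynomial.eval_comp] at this ⊢
  omega

end Comp

/-! ## A programming language for stack machines -/

/-- Programs that work on stacks `K` of symbols `A`. The program `loop k body again` pops a symbol
of stack `k` (`none` if the stack is empty), runs the `body` for this symbol, and repeats this if
`again` says so for this symbol. -/
inductive Prog (K A : Type) : Type
  | skip
  | push (k : K) (a : A)
  | seq (p q : Prog K A)
  | loop (k : K) (body : Option A → Prog K A) (again : Option A → Bool)

section Prog

variable {K A : Type}

/-- `Run p s n s'`: the program `p` transforms the stacks `s` into `s'` in `n` steps. -/
inductive Run [DecidableEq K] : Prog K A → (K → List A) → ℕ → (K → List A) → Prop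
  | skip (s) : Run .skip s 0 s
  | push (k a s) : Run (.push k a) s 1 (Function.update s k (a :: s k))
  | seq {p q s s' s'' m n} : Run p s m s' → Run q s' n s'' → Run (.seq p q) s (m + n) s''
  | last {k body again s s' n} : again (s k).head? = false →
      Run (body (s k).head?) (Function.update s k (s k).tail) n s' →
      Run (.loop k body again) s (n + 1) s'
  | next {k body again s s' s'' m n} : again (s k).head? = true →
      Run (body (s k).head?) (Function.update s k (s k).tail) m s' →
      Run (.loop k body again) s' n s'' → Run (.loop k body again) s (m + n + 1) s''

/-- Elementary instructions with their successors. -/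
inductive Instr (K A L : Type) : Type
  | push (k : K) (a : A) (l : L)
  | pop (k : K) (l : Option A → L)

namespace Instr

/-- Rename the successors. -/
def map {L L' : Type} (f : L → L') : Instr K A L → Instr K A L'
  | push k a l => push k a (f l)
  | pop k l => pop k fun o => f (l o)

theorem map_map {L L' L'' : Type} (f : L → L') (g : L' → L'') (i : Instr K A L) :
    (i.map f).map g = i.map fun l => g (f l) := by
  cases i <;> rfl

def toStmt {L : Type} : Instr K A L → TM2.Stmt (fun _ : K => A) L (Option A)
  | push k a l => .push k (fun _ => a) (.goto fun _ => l)
  | pop k l => .pop k (fun _ o => o) (.goto l)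

end Instr

namespace Prog

/-- The labels of a compiled program. -/
def Lab : Prog K A → Type
  | skip => Empty
  | push _ _ => Unit
  | seq p q => p.Lab ⊕ q.Lab
  | loop _ body _ => Option (Σ o : Option A, (body o).Lab)

@[reducible]
noncomputable def labFintype [Fintype A] : (p : Prog K A) → Fintype p.Lab
  | skip => inferInstanceAs (Fintype Empty)
  | push _ _ => inferInstanceAs (Fintype Unit)
  | seq p q =>
    letI := p.labFintype
    letI := q.labFintype
    inferInstanceAs (Fintype (p.Lab ⊕ q.Lab))
  | loop _ body _ =>
    letI := fun o => (body o).labFintype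
    inferInstanceAs (Fintype (Option (Σ o : Option A, (body o).Lab)))

/-- The label at which a compiled program starts, `none` if there is nothing to do. -/
def entry : (p : Prog K A) → Option p.Lab
  | skip => none
  | push _ _ => some ()
  | seq p q => p.entry.elim (q.entry.map Sum.inr) (fun l => some (Sum.inl l))
  | loop _ _ _ => some none

/-- The code of a compiled program, where `none` is the exit. -/
def code : (p : Prog K A) → p.Lab → Instr K A (Option p.Lab)
  | skip, l => nomatch l
  | push k a, _ => .push k a none
  | seq p q, .inl l =>
    (p.code l).map fun t => t.elim (q.entry.map Sum.inr) (fun l => some (Sum.inl l))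
  | seq _ q, .inr l => (q.code l).map (Option.map Sum.inr)
  | loop k body again, none => .pop k fun o =>
      (body o).entry.elim (if again o then some none else none) fun l => some (some ⟨o, l⟩)
  | loop _ body again, some ⟨o, l⟩ => ((body o).code l).map fun t =>
      t.elim (if again o then some none else none) fun l => some (some ⟨o, l⟩)

end Prog

/-- Stated for any machine that contains the code of `p` under an embedding of labels, with any exit
`ret`, so that the induction applies to subprograms in place. Instructions name their successors, so
sequencing and looping back cost nothing and the step counts agree exactly. -/
theorem Run.stepsTo [DecidableEq K] {L : Type} {M : L → TM2.Stmt (fun _ : K => A) L (Option A)}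
    {p : Prog K A} {s s' : K → List A} {n : ℕ} (h : Run p s n s') :
    ∀ (ret : L) (emb : p.Lab → L),
      (∀ l, M (emb l) = ((p.code l).map fun t => t.elim ret emb).toStmt) → ∀ v, ∃ v',
      StepsTo (TM2.step M) n ⟨some (p.entry.elim ret emb), v, s⟩ ⟨some ret, v', s'⟩ := by
  induction h with
  | skip s => intro ret emb _ v; exact ⟨v, StepsTo.refl _ _⟩
  | push k a s =>
    intro ret emb h v
    refine ⟨v, (StepsTo.refl _ _).head ?_⟩
    exact congrArg (fun q => some (TM2.stepAux q v s)) (h ())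
  | @seq p q s s' s'' m n _ _ ihp ihq =>
    intro ret emb h v
    -- The exit of `p` is the entry of `q`, or the common exit when `q` has no instruction at all.
    obtain ⟨v₁, h₁⟩ := ihp (q.entry.elim ret (emb ∘ Sum.inr)) (emb ∘ Sum.inl) (fun l => by
      refine (h (Sum.inl l)).trans ?_
      simp only [Prog.code, Instr.map_map]
      congr 2
      funext t
      rcases t with _ | t
      · cases q.entry <;> rfl
      · rfl) v
    obtain ⟨v₂, h₂⟩ := ihq ret (emb ∘ Sum.inr) (fun l => by
      refine (h (Sum.inr l)).trans ?_
      simp only [Prog.code, Instr.map_map]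
      congr 2
      funext t
      rcases t with _ | t <;> rfl) v₁
    refine ⟨v₂, ?_⟩
    have : (p.seq q).entry.elim ret emb =
        p.entry.elim (q.entry.elim ret (emb ∘ Sum.inr)) (emb ∘ Sum.inl) := by
      rw [Prog.entry]
      cases p.entry <;> cases q.entry <;> rfl
    rw [this]
    exact h₁.trans h₂
  | @last k body again s s' n ha _ ih =>
    intro ret emb h v
    obtain ⟨v₁, h₁⟩ := ih ret (fun l => emb (some ⟨_, l⟩)) (fun l => by
      refine (h (some ⟨_, l⟩)).trans ?_
      simp only [Prog.code, Instr.map_map, ha]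
      congr 2
      funext t
      rcases t with _ | t <;> rfl) (s k).head?
    refine ⟨v₁, h₁.head ?_⟩
    refine (congrArg (fun q => some (TM2.stepAux q v s)) (h none)).trans ?_
    simp only [Prog.code, Instr.map, Instr.toStmt, TM2.stepAux]
    congr 3
    rw [ha]
    cases (body (s k).head?).entry <;> rfl
  | @next k body again s s' s'' m n ha _ _ ih ih' =>
    intro ret emb h v
    -- When the loop goes on, the exit of the body is the head of the loop.
    obtain ⟨v₁, h₁⟩ := ih (emb none) (fun l => emb (some ⟨_, l⟩)) (fun l => by
      refine (h (some ⟨_, l⟩)).trans ?_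
      simp only [Prog.code, Instr.map_map, ha]
      congr 2
      funext t
      rcases t with _ | t <;> rfl) (s k).head?
    obtain ⟨v₂, h₂⟩ := ih' ret emb h v₁
    refine ⟨v₂, (h₁.trans h₂).head ?_⟩
    refine (congrArg (fun q => some (TM2.stepAux q v s)) (h none)).trans ?_
    simp only [Prog.code, Instr.map, Instr.toStmt, TM2.stepAux]
    congr 3
    rw [ha]
    cases (body (s k).head?).entry <;> rfl

/-- The code of a compiled program as a machine, which resets its internal state at the end. -/
def progCode (p : Prog K A) : Option p.Lab → TM2.Stmt (fun _ : K => A) (Option p.Lab) (Option A)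
  | none => .load (fun _ => none) .halt
  | some l => (p.code l).toStmt

/-- The machine that executes a program. -/
noncomputable def progMachine [DecidableEq K] [Fintype K] [Fintype A] (p : Prog K A) (k₀ k₁ : K) :
    FinTM2 :=
  letI := p.labFintype
  letI : Fintype ((fun _ : K => A) k₀) := inferInstanceAs (Fintype A)
  { K := K
    k₀ := k₀
    k₁ := k₁
    Γ := fun _ => A
    Λ := Option p.Lab
    main := p.entry
    σ := Option A
    initialState := none
    m := progCode p }

/-- A program that computes `f` within a polynomial number of steps. -/
theorem PolyTime.of_run [DecidableEq K] [Fintype K] [Fintype A] {α β : Type} {ea : α → List A}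
    {eb : β → List A} {f : α → β} (p : Prog K A) (k₀ k₁ : K) (time : Polynomial ℕ)
    (h : ∀ a, ∃ n ≤ time.eval (ea a).length, Run p (Function.update (fun _ => []) k₀ (ea a)) n
      (Function.update (fun _ => []) k₁ (eb (f a)))) : PolyTime ea eb f := by
  refine ⟨⟨⟨progMachine p k₀ k₁, Equiv.refl A, Equiv.refl A⟩, time + 1, fun a => ?_⟩⟩
  have hsome : ∀ o : Option p.Lab, o.elim none some = o := fun o => by cases o <;> rfl
  have : ∃ n ≤ time.eval (ea a).length + 1, StepsTo (progMachine p k₀ k₁).step n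
      (initList (progMachine p k₀ k₁) (ea a)) (haltList (progMachine p k₀ k₁) (eb (f a))) := by
    obtain ⟨n, hn, hr⟩ := h a
    -- The additional step resets the internal state, which still holds the last popped symbol, and
    -- halts.
    refine ⟨n + 1, by omega, ?_⟩
    obtain ⟨v, hv⟩ := hr.stepsTo (M := progCode p) none some (fun l => by
      change (p.code l).toStmt = _
      congr 1
      simp only [hsome]
      cases p.code l <;> rfl) none
    rw [hsome] at hv
    have e₀ : initList (progMachine p k₀ k₁) (ea a) =
        ⟨some p.entry, none, Function.update (fun _ => []) k₀ (ea a)⟩ := by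
      have h0 := initList_stk (progMachine p k₀ k₁) (ea a)
      exact congrArg (TM2.Cfg.mk (some p.entry) (none : Option A)) h0
    have e₁ : haltList (progMachine p k₀ k₁) (eb (f a)) =
        ⟨none, none, Function.update (fun _ => []) k₁ (eb (f a))⟩ := by
      have h0 := haltList_stk (progMachine p k₀ k₁) (eb (f a))
      exact congrArg (TM2.Cfg.mk (none : Option (Option p.Lab)) (none : Option A)) h0
    rw [e₀, e₁]
    exact hv.trans ((StepsTo.refl _ _).head rfl)
  choose n hn hs using this
  have hmap : ∀ l : List A, l.map (Equiv.refl A).invFun = l := fun l => List.map_id l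
  refine ⟨⟨n, ?_⟩, ?_⟩
  · refine Eq.trans ?_ (Eq.trans hs ?_)
    · exact congrArg (fun l => (flip bind (progMachine p k₀ k₁).step)^[n]
        (some (initList (progMachine p k₀ k₁) l))) (hmap (ea a))
    · exact congrArg (fun l => some (haltList (progMachine p k₀ k₁) l)) (hmap (eb (f a))).symm
  · simpa using hn

end Prog

/-! ## Substitution of variables in formulas -/

namespace Term

variable {V W : Type}

/-- Replace the variables of a term by other variables. -/
def map (f : V → W) : Term V → Term W
  | var a => var (f a)
  | const z => const z
  | add s t => add (s.map f) (t.map f)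
  | sub s t => sub (s.map f) (t.map f)
  | mul s t => mul (s.map f) (t.map f)

theorem eval_map (f : V → W) (v : W → ℝ) (t : Term V) : (t.map f).eval v = t.eval (v ∘ f) := by
  induction t <;> simp_all [map, eval]

theorem enc_map (f : V → W) (e : W → List Sym) (t : Term V) :
    (t.map f).enc e = t.enc (e ∘ f) := by
  induction t <;> simp_all [map, enc]

/-- All variables of the term satisfy `P`. -/
def All (P : V → Prop) : Term V → Prop
  | var a => P a
  | const _ => True
  | add s t => s.All P ∧ t.All P
  | sub s t => s.All P ∧ t.All P
  | mul s t => s.All P ∧ t.All P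

/-- The restriction to occurring variables matters: names printed from the counters agree with the
true names only where the index does not wrap around. -/
theorem enc_congr {e e' : V → List Sym} (t : Term V) (h : t.All fun a => e a = e' a) :
    t.enc e = t.enc e' := by
  induction t <;> simp_all [All, enc]

end Term

namespace QF

variable {V W : Type}

/-- Replace the variables of a formula by other variables. -/
def map (f : V → W) : QF V → QF W
  | lt s t => lt (s.map f) (t.map f)
  | le s t => le (s.map f) (t.map f)
  | eq s t => eq (s.map f) (t.map f)
  | ge s t => ge (s.map f) (t.map f)
  | gt s t => gt (s.map f) (t.map f)
  | and p q => and (p.map f) (q.map f)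
  | or p q => or (p.map f) (q.map f)
  | not p => not (p.map f)

theorem holds_map (f : V → W) (v : W → ℝ) (q : QF V) : (q.map f).Holds v ↔ q.Holds (v ∘ f) := by
  induction q <;> simp_all [map, Holds, Term.eval_map]

theorem enc_map (f : V → W) (e : W → List Sym) (q : QF V) : (q.map f).enc e = q.enc (e ∘ f) := by
  induction q <;> simp_all [map, enc, Term.enc_map]

/-- All variables of the formula satisfy `P`. -/
def All (P : V → Prop) : QF V → Prop
  | lt s t => s.All P ∧ t.All P
  | le s t => s.All P ∧ t.All P
  | eq s t => s.All P ∧ t.All P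
  | ge s t => s.All P ∧ t.All P
  | gt s t => s.All P ∧ t.All P
  | and p q => p.All P ∧ q.All P
  | or p q => p.All P ∧ q.All P
  | not p => p.All P

theorem enc_congr {e e' : V → List Sym} (q : QF V) (h : q.All fun a => e a = e' a) :
    q.enc e = q.enc e' := by
  induction q with
  | lt s t | le s t | eq s t | ge s t | gt s t =>
    simp only [enc, s.enc_congr h.1, t.enc_congr h.2]
  | and p q hp hq | or p q hp hq => simp only [enc, hp h.1, hq h.2]
  | not p hp => simp only [enc, hp h]

/-- A valid formula. -/
def true' : QF V := eq (.const 0) (.const 0)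

/-- The conjunction of a list of formulas. -/
def conj (l : List (QF V)) : QF V := l.foldr and true'

theorem holds_conj (v : V → ℝ) (l : List (QF V)) : (conj l).Holds v ↔ ∀ q ∈ l, q.Holds v := by
  induction l with
  | nil => simp [conj, true', Holds]
  | cons q l ih =>
    rw [List.forall_mem_cons, ← ih]
    rfl

/-- In prefix notation a right-nested conjunction is a plain concatenation of items, each opened by
`and`, with a fixed end. It can be printed item by item without knowing how many follow. -/
theorem enc_conj (e : V → List Sym) (l : List (QF V)) :
    (conj l).enc e = (l.flatMap fun q => Sym.and :: q.enc e) ++ true'.enc e := by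
  induction l with
  | nil => rfl
  | cons q l ih =>
    change Sym.and :: (q.enc e ++ (conj l).enc e) = _
    rw [ih]
    simp

end QF

/-! ## The formula for an instance of Borsuk-Ulam

Bound variables come in rows of eleven. In row `i`, the entries `0`, `1` are the values of `x i` and
`-x i`, entry `2` is `|x i|` and entry `3` is the sum of `|x l|` for `l < i`. The entries `4`, `5` of
row `j` are the outputs of gate `j` on the inputs `x` and `-x`. Its operands are the entries `6`, `7`
on `x` and the entries `9`, `10` on `-x`, and its rational constant is entry `8`. -/

/-- Variables of formula templates: a free variable, or an entry of the row in hand (`cnt`) or of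
the row of an operand (`arg`). -/
inductive Hole : Type
  | free
  | cnt (o : ℕ)
  | arg (o : ℕ)

/-- The variable at a place of a template, from the free variable `x`, the row `j` in hand and the
row `a` of the operand. -/
def Hole.var {n b : ℕ} (x : Fin n ⊕ Fin (b + 1)) (j a : ℕ) : Hole → Fin n ⊕ Fin (b + 1)
  | free => x
  | cnt o => Sum.inr (Fin.ofNat (b + 1) (11 * j + o))
  | arg o => Sum.inr (Fin.ofNat (b + 1) (11 * a + o))

namespace Template

abbrev V (o : ℕ) : Term Hole := .var (.cnt o)

/-- A relation between output and operands of a gate, on both inputs `x` and `-x`. -/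
def twice (r : Term Hole → Term Hole → Term Hole → QF Hole) : QF Hole :=
  .and (r (V 4) (V 6) (V 7)) (r (V 5) (V 9) (V 10))

/-- The absolute value is the nonnegative number with the right square. Entry `14` is entry `3` of
the next row, so the last equation advances the partial sum. -/
def input : QF Hole :=
  .and (.eq (V 0) (.var .free)) <| .and (.eq (V 1) (.sub (.const 0) (.var .free))) <|
    .and (.ge (V 2) (.const 0)) <| .and (.eq (.mul (V 2) (V 2)) (.mul (V 0) (V 0))) <|
    .eq (V 14) (.add (V 3) (V 2))

def sumIs (z : ℤ) : QF Hole := .eq (V 3) (.const z)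

def operand (p p' o : ℕ) : QF Hole :=
  .and (.eq (V p) (.var (.arg o))) (.eq (V p') (.var (.arg (o + 1))))

def output (o : ℕ) : QF Hole := .eq (.var (.arg o)) (.var (.arg (o + 1)))

def const : QF Hole := twice fun v _ _ => .eq v (V 8)
def add : QF Hole := twice fun v p q => .eq v (.add p q)
def sub : QF Hole := twice fun v p q => .eq v (.sub p q)
def smul : QF Hole := twice fun v p _ => .eq v (.mul p (V 8))
def mul : QF Hole := twice fun v p q => .eq v (.mul p q)
def max : QF Hole := twice fun v p q => .and (.ge v p) (.and (.ge v q) (.or (.eq v p) (.eq v q)))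
def min : QF Hole := twice fun v p q => .and (.le v p) (.and (.le v q) (.or (.eq v p) (.eq v q)))

end Template

section Formula

variable {n k b : ℕ}

/-- The row of a node. -/
def nodeRow : Fin n ⊕ Fin k → ℕ
  | Sum.inl i => i
  | Sum.inr j => j

/-- The entry in its row of the value of a node on the input `x`. -/
def nodeEntry : Fin n ⊕ Fin k → ℕ
  | Sum.inl _ => 0
  | Sum.inr _ => 4

/-- A template for the rows `j` and `a`, without free variables. -/
def inst (n b : ℕ) (j a : ℕ) (q : QF Hole) : QF (Fin n ⊕ Fin (b + 1)) :=
  q.map (Hole.var (Sum.inr 0) j a)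

def inputFormula (n b : ℕ) (i : Fin n) : QF (Fin n ⊕ Fin (b + 1)) :=
  Template.input.map (Hole.var (Sum.inl i) i 0)

/-- Copying each operand into the row of its gate ensures that no constraint mentions more than one
foreign row. Two counters then suffice to print it. -/
def operandFormula (b j p p' : ℕ) (a : Fin n ⊕ Fin k) : QF (Fin n ⊕ Fin (b + 1)) :=
  inst n b j (nodeRow a) (Template.operand p p' (nodeEntry a))

def outputFormula (b : ℕ) (a : Fin n ⊕ Fin k) : QF (Fin n ⊕ Fin (b + 1)) :=
  inst n b 0 (nodeRow a) (Template.output (nodeEntry a))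

/-- Coefficients must be integers, so the constant is pinned down by clearing its denominator. Both
integers keep the digits that they have in the circuit. -/
def ratFormula (n b j : ℕ) (ζ : ℚ) : QF (Fin n ⊕ Fin (b + 1)) :=
  .eq (.const ζ.num) (.mul (.var (Hole.var (Sum.inr 0) j 0 (.cnt 8))) (.const ζ.den))

/-- The constraints for gate `j`. -/
def gateFormulas (b j : ℕ) : Gate (Fin n ⊕ Fin k) → List (QF (Fin n ⊕ Fin (b + 1)))
  | .const ζ => [ratFormula n b j ζ, inst n b j 0 Template.const]
  | .add a c => [operandFormula b j 6 9 a, operandFormula b j 7 10 c, inst n b j 0 Template.add]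
  | .sub a c => [operandFormula b j 6 9 a, operandFormula b j 7 10 c, inst n b j 0 Template.sub]
  | .smul ζ a => [ratFormula n b j ζ, operandFormula b j 6 9 a, inst n b j 0 Template.smul]
  | .mul a c => [operandFormula b j 6 9 a, operandFormula b j 7 10 c, inst n b j 0 Template.mul]
  | .max a c => [operandFormula b j 6 9 a, operandFormula b j 7 10 c, inst n b j 0 Template.max]
  | .min a c => [operandFormula b j 6 9 a, operandFormula b j 7 10 c, inst n b j 0 Template.min]
  | .pos _ => []

/-- The constraints for the gates `j`, `j + 1`, … -/
def gateListFormulas (b : ℕ) : ℕ → List (Gate (Fin n ⊕ Fin k)) → List (QF (Fin n ⊕ Fin (b + 1)))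
  | _, [] => []
  | j, g :: l => gateFormulas b j g ++ gateListFormulas b (j + 1) l

theorem mem_gateListFormulas {q : QF (Fin n ⊕ Fin (b + 1))} {l : List (Gate (Fin n ⊕ Fin k))} :
    ∀ {j : ℕ}, q ∈ gateListFormulas b j l ↔
      ∃ i, ∃ h : i < l.length, q ∈ gateFormulas b (j + i) l[i] := by
  induction l with
  | nil => simp [gateListFormulas]
  | cons g l ih =>
    intro j
    rw [gateListFormulas, List.mem_append, ih]
    constructor
    · rintro (h | ⟨i, h, hq⟩)
      · exact ⟨0, by simp, h⟩
      · refine ⟨i + 1, by simpa using h, ?_⟩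
        rw [show j + (i + 1) = j + 1 + i by omega]
        exact hq
    · rintro ⟨_ | i, h, hq⟩
      · exact Or.inl hq
      · refine Or.inr ⟨i, by simpa using h, ?_⟩
        rw [show j + 1 + i = j + (i + 1) by omega]
        exact hq

/-- The constraints that say that `x` lies on the unit sphere, from the last row to the first. -/
def inputFormulas (n b : ℕ) : List (QF (Fin n ⊕ Fin (b + 1))) :=
  inst n b n 0 (Template.sumIs 1) :: ((List.ofFn (inputFormula n b)).reverse ++
    [inst n b 0 0 (Template.sumIs 0)])

end Formula

namespace Circuit

variable {n m : ℕ}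

/-- The existential formula that says that `x` is on the unit sphere and `c` has the same value at
`x` and `-x`. -/
def antipodalFormula (c : Circuit n m) : ExFormula n where
  bound := 11 * (n + c.size) + 10 + 1
  body := QF.conj (inputFormulas n (11 * (n + c.size) + 10) ++
    (gateListFormulas (11 * (n + c.size) + 10) 0 (List.ofFn c.gate) ++
      (List.ofFn c.out).map (outputFormula (11 * (n + c.size) + 10))))

end Circuit

/-! ### Meaning of the constraints -/

section Semantics

variable {n k b : ℕ}

/-- Entry `o` of row `j`. -/
def cell (z : Fin (b + 1) → ℝ) (j o : ℕ) : ℝ := z (Fin.ofNat (b + 1) (11 * j + o))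

/-- The values at the nodes on the input `x` (for `o = 0`) and `-x` (for `o = 1`). -/
def nodeVal (z : Fin (b + 1) → ℝ) (o : ℕ) (a : Fin n ⊕ Fin k) : ℝ :=
  cell z (nodeRow a) (nodeEntry a + o)

theorem comp_holeVar (x : Fin n → ℝ) (z : Fin (b + 1) → ℝ) (y : Fin n ⊕ Fin (b + 1)) (j a : ℕ) :
    Sum.elim x z ∘ Hole.var y j a = fun h : Hole => match h with
      | .free => Sum.elim x z y
      | .cnt o => cell z j o
      | .arg o => cell z a o := by
  funext h
  cases h <;> rfl

theorem holds_inputFormula (x : Fin n → ℝ) (z : Fin (b + 1) → ℝ) (i : Fin n) :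
    (inputFormula n b i).Holds (Sum.elim x z) ↔
      cell z i 0 = x i ∧ cell z i 1 = -x i ∧ cell z i 2 = |x i| ∧
      cell z (i + 1) 3 = cell z i 3 + cell z i 2 := by
  rw [inputFormula, QF.holds_map, comp_holeVar]
  -- Both are the same position, as `11 * i + 14 = 11 * (i + 1) + 3`.
  have h14 : cell z i 14 = cell z (i + 1) 3 := by
    simp only [cell]
    congr 2
  simp only [Template.input, QF.Holds, Term.eval, h14, Int.cast_zero, zero_sub, Sum.elim_inl]
  change cell z i 0 = x i ∧ cell z i 1 = -x i ∧ cell z i 2 ≥ 0 ∧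
    cell z i 2 * cell z i 2 = cell z i 0 * cell z i 0 ∧
    cell z (i + 1) 3 = cell z i 3 + cell z i 2 ↔ _
  constructor
  · rintro ⟨h1, h2, h3, h4, h5⟩
    refine ⟨h1, h2, ?_, h5⟩
    rw [← abs_of_nonneg h3, ← h1]
    exact (abs_eq_abs.2 (mul_self_eq_mul_self_iff.1 h4))
  · rintro ⟨h1, h2, h3, h4⟩
    refine ⟨h1, h2, ?_, ?_, h4⟩
    · rw [h3]; exact abs_nonneg _
    · rw [h3, h1, abs_mul_abs_self]

theorem holds_operandFormula (x : Fin n → ℝ) (z : Fin (b + 1) → ℝ) (j p p' : ℕ)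
    (a : Fin n ⊕ Fin k) :
    (operandFormula b j p p' a).Holds (Sum.elim x z) ↔
      cell z j p = nodeVal z 0 a ∧ cell z j p' = nodeVal z 1 a := by
  rw [operandFormula, inst, QF.holds_map, comp_holeVar]
  rfl

theorem holds_outputFormula (x : Fin n → ℝ) (z : Fin (b + 1) → ℝ) (a : Fin n ⊕ Fin k) :
    (outputFormula b a).Holds (Sum.elim x z) ↔
      nodeVal z 0 a = nodeVal z 1 a := by
  rw [outputFormula, inst, QF.holds_map, comp_holeVar]
  rfl

theorem holds_ratFormula (x : Fin n → ℝ) (z : Fin (b + 1) → ℝ) (j : ℕ) (ζ : ℚ) :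
    (ratFormula n b j ζ).Holds (Sum.elim x z) ↔ cell z j 8 = (ζ : ℝ) := by
  change (ζ.num : ℝ) = cell z j 8 * ((ζ.den : ℤ) : ℝ) ↔ _
  have h : (ζ : ℝ) = ζ.num / ζ.den := by exact_mod_cast ζ.num_div_den.symm
  have h0 : (ζ.den : ℝ) ≠ 0 := by exact_mod_cast ζ.den_nz
  rw [h, eq_div_iff h0, Int.cast_natCast, eq_comm]

theorem holds_inst_twice (x : Fin n → ℝ) (z : Fin (b + 1) → ℝ) (j : ℕ)
    (r : Term Hole → Term Hole → Term Hole → QF Hole) :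
    let v : Hole → ℝ := Sum.elim x z ∘ Hole.var (Sum.inr 0) j 0
    (inst n b j 0 (Template.twice r)).Holds (Sum.elim x z) ↔
      (r (Template.V 4) (Template.V 6) (Template.V 7)).Holds v ∧
      (r (Template.V 5) (Template.V 9) (Template.V 10)).Holds v := by
  intro v
  rw [inst, QF.holds_map]
  rfl

/-- The first operand of a gate. -/
noncomputable def Gate.arg₁ {V : Type} (v : V → ℝ) : Gate V → ℝ
  | .const _ => 0
  | .add a _ => v a
  | .sub a _ => v a
  | .smul _ a => v a
  | .mul a _ => v a
  | .max a _ => v a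
  | .min a _ => v a
  | .pos a => v a

/-- The second operand of a gate. -/
noncomputable def Gate.arg₂ {V : Type} (v : V → ℝ) : Gate V → ℝ
  | .const _ => 0
  | .add _ a => v a
  | .sub _ a => v a
  | .smul _ _ => 0
  | .mul _ a => v a
  | .max _ a => v a
  | .min _ a => v a
  | .pos _ => 0

/-- The constant of a gate. -/
noncomputable def Gate.coef {V : Type} : Gate V → ℝ
  | .const ζ => ζ
  | .smul ζ _ => ζ
  | _ => 0

theorem ge_and_ge_and_or_iff (v p q : ℝ) : (v ≥ p ∧ v ≥ q ∧ (v = p ∨ v = q)) ↔ v = max p q := by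
  constructor
  · rintro ⟨h1, h2, rfl | rfl⟩
    · rw [max_eq_left h2]
    · rw [max_eq_right h1]
  · rintro rfl
    exact ⟨le_max_left _ _, le_max_right _ _, max_choice p q⟩

theorem le_and_le_and_or_iff (v p q : ℝ) : (v ≤ p ∧ v ≤ q ∧ (v = p ∨ v = q)) ↔ v = min p q := by
  constructor
  · rintro ⟨h1, h2, rfl | rfl⟩
    · rw [min_eq_left h2]
    · rw [min_eq_right h1]
  · rintro rfl
    exact ⟨min_le_left _ _, min_le_right _ _, min_choice p q⟩

theorem eval_eq_of_holds_gateFormulas (x : Fin n → ℝ) (z : Fin (b + 1) → ℝ) (j : ℕ)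
    (g : Gate (Fin n ⊕ Fin k)) (hg : g.IsArithmetic) :
    (∀ q ∈ gateFormulas b j g, q.Holds (Sum.elim x z)) →
      cell z j 4 = g.eval (nodeVal z 0) ∧ cell z j 5 = g.eval (nodeVal z 1) := by
  cases g with
  | const ζ =>
    simp only [gateFormulas, List.forall_mem_cons, List.not_mem_nil, false_implies, implies_true,
      and_true, holds_ratFormula, Template.const, holds_inst_twice]
    rintro ⟨h1, h2, h3⟩
    exact ⟨h2.trans h1, h3.trans h1⟩
  | smul ζ a =>
    simp only [gateFormulas, List.forall_mem_cons, List.not_mem_nil, false_implies, implies_true,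
      and_true, holds_ratFormula, Template.smul, holds_inst_twice, holds_operandFormula]
    rintro ⟨h1, ⟨h2, h3⟩, h4, h5⟩
    have h4 : cell z j 4 = cell z j 6 * cell z j 8 := h4
    have h5 : cell z j 5 = cell z j 9 * cell z j 8 := h5
    have h1 : cell z j 8 = ζ := h1
    exact ⟨by rw [h4, h2, h1]; rfl, by rw [h5, h3, h1]; rfl⟩
  | pos a => exact hg.elim
  | add a c =>
    simp only [gateFormulas, List.forall_mem_cons, List.not_mem_nil, false_implies, implies_true,
      and_true, Template.add, holds_inst_twice, holds_operandFormula]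
    rintro ⟨⟨h1, h2⟩, ⟨h3, h4⟩, h5, h6⟩
    have h5 : cell z j 4 = cell z j 6 + cell z j 7 := h5
    have h6 : cell z j 5 = cell z j 9 + cell z j 10 := h6
    exact ⟨by rw [h5, h1, h3]; rfl, by rw [h6, h2, h4]; rfl⟩
  | sub a c =>
    simp only [gateFormulas, List.forall_mem_cons, List.not_mem_nil, false_implies, implies_true,
      and_true, Template.sub, holds_inst_twice, holds_operandFormula]
    rintro ⟨⟨h1, h2⟩, ⟨h3, h4⟩, h5, h6⟩
    have h5 : cell z j 4 = cell z j 6 - cell z j 7 := h5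
    have h6 : cell z j 5 = cell z j 9 - cell z j 10 := h6
    exact ⟨by rw [h5, h1, h3]; rfl, by rw [h6, h2, h4]; rfl⟩
  | mul a c =>
    simp only [gateFormulas, List.forall_mem_cons, List.not_mem_nil, false_implies, implies_true,
      and_true, Template.mul, holds_inst_twice, holds_operandFormula]
    rintro ⟨⟨h1, h2⟩, ⟨h3, h4⟩, h5, h6⟩
    have h5 : cell z j 4 = cell z j 6 * cell z j 7 := h5
    have h6 : cell z j 5 = cell z j 9 * cell z j 10 := h6
    exact ⟨by rw [h5, h1, h3]; rfl, by rw [h6, h2, h4]; rfl⟩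
  | max a c =>
    simp only [gateFormulas, List.forall_mem_cons, List.not_mem_nil, false_implies, implies_true,
      and_true, Template.max, holds_inst_twice, holds_operandFormula]
    rintro ⟨⟨h1, h2⟩, ⟨h3, h4⟩, h5, h6⟩
    have h5 : cell z j 4 = max (cell z j 6) (cell z j 7) := (ge_and_ge_and_or_iff _ _ _).1 h5
    have h6 : cell z j 5 = max (cell z j 9) (cell z j 10) := (ge_and_ge_and_or_iff _ _ _).1 h6
    exact ⟨by rw [h5, h1, h3]; rfl, by rw [h6, h2, h4]; rfl⟩
  | min a c =>
    simp only [gateFormulas, List.forall_mem_cons, List.not_mem_nil, false_implies, implies_true,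
      and_true, Template.min, holds_inst_twice, holds_operandFormula]
    rintro ⟨⟨h1, h2⟩, ⟨h3, h4⟩, h5, h6⟩
    have h5 : cell z j 4 = min (cell z j 6) (cell z j 7) := (le_and_le_and_or_iff _ _ _).1 h5
    have h6 : cell z j 5 = min (cell z j 9) (cell z j 10) := (le_and_le_and_or_iff _ _ _).1 h6
    exact ⟨by rw [h5, h1, h3]; rfl, by rw [h6, h2, h4]; rfl⟩

theorem holds_gateFormulas_of_eval_eq (x : Fin n → ℝ) (z : Fin (b + 1) → ℝ) (j : ℕ)
    (g : Gate (Fin n ⊕ Fin k)) :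
    cell z j 4 = g.eval (nodeVal z 0) → cell z j 5 = g.eval (nodeVal z 1) →
      cell z j 6 = g.arg₁ (nodeVal z 0) → cell z j 7 = g.arg₂ (nodeVal z 0) →
      cell z j 8 = g.coef → cell z j 9 = g.arg₁ (nodeVal z 1) →
      cell z j 10 = g.arg₂ (nodeVal z 1) → ∀ q ∈ gateFormulas b j g, q.Holds (Sum.elim x z) := by
  intro h4 h5 h6 h7 h8 h9 h10
  cases g with
  | pos a => simp [gateFormulas]
  | const ζ =>
    simp only [gateFormulas, List.forall_mem_cons, List.not_mem_nil, false_implies, implies_true,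
      and_true, holds_ratFormula, Template.const, holds_inst_twice]
    exact ⟨h8, h4.trans h8.symm, h5.trans h8.symm⟩
  | smul ζ a =>
    simp only [gateFormulas, List.forall_mem_cons, List.not_mem_nil, false_implies, implies_true,
      and_true, holds_ratFormula, Template.smul, holds_inst_twice, holds_operandFormula]
    refine ⟨h8, ⟨h6, h9⟩, ?_, ?_⟩
    · change cell z j 4 = cell z j 6 * cell z j 8
      rw [h4, h6, h8]; rfl
    · change cell z j 5 = cell z j 9 * cell z j 8
      rw [h5, h9, h8]; rfl
  | add a c =>
    simp only [gateFormulas, List.forall_mem_cons, List.not_mem_nil, false_implies, implies_true,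
      and_true, Template.add, holds_inst_twice, holds_operandFormula]
    refine ⟨⟨h6, h9⟩, ⟨h7, h10⟩, ?_, ?_⟩
    · change cell z j 4 = cell z j 6 + cell z j 7
      rw [h4, h6, h7]; rfl
    · change cell z j 5 = cell z j 9 + cell z j 10
      rw [h5, h9, h10]; rfl
  | sub a c =>
    simp only [gateFormulas, List.forall_mem_cons, List.not_mem_nil, false_implies, implies_true,
      and_true, Template.sub, holds_inst_twice, holds_operandFormula]
    refine ⟨⟨h6, h9⟩, ⟨h7, h10⟩, ?_, ?_⟩
    · change cell z j 4 = cell z j 6 - cell z j 7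
      rw [h4, h6, h7]; rfl
    · change cell z j 5 = cell z j 9 - cell z j 10
      rw [h5, h9, h10]; rfl
  | mul a c =>
    simp only [gateFormulas, List.forall_mem_cons, List.not_mem_nil, false_implies, implies_true,
      and_true, Template.mul, holds_inst_twice, holds_operandFormula]
    refine ⟨⟨h6, h9⟩, ⟨h7, h10⟩, ?_, ?_⟩
    · change cell z j 4 = cell z j 6 * cell z j 7
      rw [h4, h6, h7]; rfl
    · change cell z j 5 = cell z j 9 * cell z j 10
      rw [h5, h9, h10]; rfl
  | max a c =>
    simp only [gateFormulas, List.forall_mem_cons, List.not_mem_nil, false_implies, implies_true,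
      and_true, Template.max, holds_inst_twice, holds_operandFormula]
    refine ⟨⟨h6, h9⟩, ⟨h7, h10⟩, (ge_and_ge_and_or_iff (cell z j 4) (cell z j 6) (cell z j 7)).2 ?_,
      (ge_and_ge_and_or_iff (cell z j 5) (cell z j 9) (cell z j 10)).2 ?_⟩
    · rw [h4, h6, h7]; rfl
    · rw [h5, h9, h10]; rfl
  | min a c =>
    simp only [gateFormulas, List.forall_mem_cons, List.not_mem_nil, false_implies, implies_true,
      and_true, Template.min, holds_inst_twice, holds_operandFormula]
    refine ⟨⟨h6, h9⟩, ⟨h7, h10⟩, (le_and_le_and_or_iff (cell z j 4) (cell z j 6) (cell z j 7)).2 ?_,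
      (le_and_le_and_or_iff (cell z j 5) (cell z j 9) (cell z j 10)).2 ?_⟩
    · rw [h4, h6, h7]; rfl
    · rw [h5, h9, h10]; rfl

end Semantics

namespace Circuit

variable {n m : ℕ}

theorem value_isValuation (c : Circuit n m) (x : Fin n → ℝ) : c.IsValuation x (c.value x) :=
  (c.existsUnique_isValuation x).choose_spec.1

theorem IsValuation.eq_value {c : Circuit n m} {x : Fin n → ℝ} {v : Fin n ⊕ Fin c.size → ℝ}
    (h : c.IsValuation x v) : v = c.value x :=
  (c.existsUnique_isValuation x).unique h (c.value_isValuation x)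

/-- The entries of the rows of bound variables that witness the formula. -/
noncomputable def witness (c : Circuit n m) (x : Fin n → ℝ) (j : ℕ) : ℕ → ℝ
  | 0 => if h : j < n then x ⟨j, h⟩ else 0
  | 1 => if h : j < n then -x ⟨j, h⟩ else 0
  | 2 => if h : j < n then |x ⟨j, h⟩| else 0
  | 3 => ∑ i ∈ Finset.range j, if h : i < n then |x ⟨i, h⟩| else 0
  | 4 => if h : j < c.size then c.value x (.inr ⟨j, h⟩) else 0
  | 5 => if h : j < c.size then c.value (-x) (.inr ⟨j, h⟩) else 0
  | 6 => if h : j < c.size then (c.gate ⟨j, h⟩).arg₁ (c.value x) else 0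
  | 7 => if h : j < c.size then (c.gate ⟨j, h⟩).arg₂ (c.value x) else 0
  | 8 => if h : j < c.size then (c.gate ⟨j, h⟩).coef else 0
  | 9 => if h : j < c.size then (c.gate ⟨j, h⟩).arg₁ (c.value (-x)) else 0
  | 10 => if h : j < c.size then (c.gate ⟨j, h⟩).arg₂ (c.value (-x)) else 0
  | _ => 0

/-- Any witness contains a valuation for `x` and one for `-x`, and valuations are unique, so the
output constraints compare the actual outputs. Conversely, the actual values fill the rows. -/
theorem antipodalFormula_holds_iff (c : Circuit n m) (hc : c.IsArithmetic) (x : Fin n → ℝ) :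
    c.antipodalFormula.Holds x ↔ ∑ i, |x i| = 1 ∧ c.eval x = c.eval (-x) := by
  set b := 11 * (n + c.size) + 10 with hb
  have hsplit : ∀ z : Fin (b + 1) → ℝ, c.antipodalFormula.body.Holds (Sum.elim x z) ↔
      (inst n b n 0 (Template.sumIs 1)).Holds (Sum.elim x z) ∧
      (∀ i, (inputFormula n b i).Holds (Sum.elim x z)) ∧
      (inst n b 0 0 (Template.sumIs 0)).Holds (Sum.elim x z) ∧
      (∀ j : Fin c.size, ∀ q ∈ gateFormulas b j (c.gate j), q.Holds (Sum.elim x z)) ∧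
      ∀ i, (outputFormula b (c.out i)).Holds (Sum.elim x z) := by
    intro z
    change (QF.conj _).Holds _ ↔ _
    rw [QF.holds_conj]
    simp only [inputFormulas, List.cons_append, List.forall_mem_cons, List.forall_mem_append,
      List.mem_reverse, List.forall_mem_map, List.mem_ofFn, List.append_assoc, List.nil_append,
      forall_exists_index, forall_apply_eq_imp_iff, mem_gateListFormulas]
    refine and_congr_right' (and_congr_right' (and_congr_right' (and_congr_left' ?_)))
    constructor
    · intro h j q hq
      exact h q j (by simp) (by simpa using hq)
    · intro h q j hj hq
      exact h ⟨j, by simpa using hj⟩ q (by simpa using hq)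
  have hsumIs : ∀ (z : Fin (b + 1) → ℝ) j t, (inst n b j 0 (Template.sumIs t)).Holds (Sum.elim x z) ↔
      cell z j 3 = t := by
    intro z j t
    rw [inst, QF.holds_map]
    rfl
  constructor
  · rintro ⟨(z : Fin (b + 1) → ℝ), hz⟩
    obtain ⟨h1, h2, h3, h4, h5⟩ := (hsplit z).1 hz
    rw [hsumIs] at h1 h3
    simp only [holds_inputFormula, holds_outputFormula] at h2 h5
    -- The partial sums start at 0 in row `0`; row `n` then holds the L₁ norm, which the first
    -- constraint sets to 1.
    have hsum : ∀ l ≤ n, cell z l 3 = ∑ i ∈ Finset.range l, cell z i 2 := by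
      intro l
      induction l with
      | zero => intro _; simpa using h3
      | succ l ih =>
        intro hl
        rw [Finset.sum_range_succ, ← ih (by omega)]
        exact (h2 ⟨l, hl⟩).2.2.2
    have hv : c.IsValuation x (nodeVal z 0) :=
      ⟨fun i => (h2 i).1, fun j => (eval_eq_of_holds_gateFormulas x z j _ (hc j) (h4 j)).1⟩
    have hw : c.IsValuation (-x) (nodeVal z 1) :=
      ⟨fun i => (h2 i).2.1, fun j => (eval_eq_of_holds_gateFormulas x z j _ (hc j) (h4 j)).2⟩
    refine ⟨?_, ?_⟩
    · rw [← Finset.sum_congr rfl fun i _ => (h2 i).2.2.1,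
        Fin.sum_univ_eq_sum_range (fun i => cell z i 2) n, ← hsum n le_rfl]
      exact h1.trans (by simp)
    · funext i
      rw [eval, eval, ← hv.eq_value, ← hw.eq_value]
      exact h5 i
  · rintro ⟨hx, hf⟩
    let z : Fin (b + 1) → ℝ := fun t => c.witness x (t / 11) (t % 11)
    -- The largest position used is `11 * (n + c.size) + 10 = b`, so reduction modulo `b + 1`
    -- changes nothing for these rows.
    have hZ : ∀ j o, o < 11 → j ≤ n + c.size →
        cell z j o = c.witness x j o := by
      intro j o ho hj
      have : ((Fin.ofNat (b + 1) (11 * j + o) : Fin (b + 1)) : ℕ) = 11 * j + o := by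
        rw [Fin.val_ofNat]
        exact Nat.mod_eq_of_lt (by omega)
      simp only [cell, z, this]
      rw [show (11 * j + o) / 11 = j by omega, show (11 * j + o) % 11 = o by omega]
    have hnode : ∀ a : Fin n ⊕ Fin c.size,
        nodeVal z 0 a = c.value x a ∧ nodeVal z 1 a = c.value (-x) a := by
      rintro (i | j) <;> simp only [nodeVal]
      · rw [hZ _ _ (by simp [nodeEntry]) (by simp only [nodeRow]; omega),
          hZ _ _ (by simp [nodeEntry]) (by simp only [nodeRow]; omega),
          (c.value_isValuation x).1, (c.value_isValuation (-x)).1]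
        simp [nodeEntry, nodeRow, witness]
      · rw [hZ _ _ (by simp [nodeEntry]) (by simp only [nodeRow]; omega),
          hZ _ _ (by simp [nodeEntry]) (by simp only [nodeRow]; omega)]
        simp [nodeEntry, nodeRow, witness]
    refine ⟨z, (hsplit z).2 ⟨?_, fun i => ?_, ?_, fun j => ?_, fun i => ?_⟩⟩
    · rw [hsumIs, hZ _ _ (by simp) (by simp), witness,
        ← Fin.sum_univ_eq_sum_range (fun i => if h : i < n then |x ⟨i, h⟩| else 0) n]
      simpa using hx
    · rw [holds_inputFormula, hZ _ _ (by simp) (by omega), hZ _ _ (by simp) (by omega),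
        hZ _ _ (by simp) (by omega), hZ _ _ (by simp) (by omega), hZ _ _ (by simp) (by omega)]
      simp [witness, Finset.sum_range_succ]
    · rw [hsumIs, hZ _ _ (by simp) (by simp)]
      simp [witness]
    · have e1 : nodeVal z 0 = c.value x :=
        funext fun a => (hnode a).1
      have e2 : nodeVal z 1 = c.value (-x) := funext fun a => (hnode a).2
      have hj : ∀ o < 11, cell z j o = c.witness x j o :=
        fun o ho => hZ j o ho (by omega)
      refine holds_gateFormulas_of_eval_eq x z j (c.gate j) ?_ ?_ ?_ ?_ ?_ ?_ ?_
      · rw [hj _ (by simp), e1, ← (c.value_isValuation x).2]; simp [witness]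
      · rw [hj _ (by simp), e2, ← (c.value_isValuation (-x)).2]; simp [witness]
      · rw [hj _ (by simp), e1]; simp [witness]
      · rw [hj _ (by simp), e1]; simp [witness]
      · rw [hj _ (by simp)]; simp [witness]
      · rw [hj _ (by simp), e2]; simp [witness]
      · rw [hj _ (by simp), e2]; simp [witness]
    · rw [holds_outputFormula, (hnode _).1, (hnode _).2]
      exact congrFun hf i

/-- The function that an arithmetic circuit represents is continuous. -/
theorem continuous_eval {c : Circuit n m} (hc : c.IsArithmetic) : Continuous c.eval := by
  have hj : ∀ j, Continuous fun x => c.value x (.inr j) := by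
    intro j
    induction j using c.wellFounded.induction with
    | _ j ih =>
      have ha : ∀ a ∈ (c.gate j).operands, Continuous fun x => c.value x a := by
        rintro (i | j') h
        · simp_rw [(c.value_isValuation _).1]
          exact continuous_apply i
        · exact ih j' h
      simp_rw [(c.value_isValuation _).2]
      have hcj := hc j
      cases hg : c.gate j with
      | pos a => rw [hg] at hcj; exact hcj.elim
      | const ζ => exact continuous_const
      | smul ζ a => exact (ha a (by simp [hg, Gate.operands])).mul continuous_const
      | add a b =>
        exact (ha a (by simp [hg, Gate.operands])).add (ha b (by simp [hg, Gate.operands]))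
      | sub a b =>
        exact (ha a (by simp [hg, Gate.operands])).sub (ha b (by simp [hg, Gate.operands]))
      | mul a b =>
        exact (ha a (by simp [hg, Gate.operands])).mul (ha b (by simp [hg, Gate.operands]))
      | max a b =>
        exact (ha a (by simp [hg, Gate.operands])).max (ha b (by simp [hg, Gate.operands]))
      | min a b =>
        exact (ha a (by simp [hg, Gate.operands])).min (ha b (by simp [hg, Gate.operands]))
  refine continuous_pi fun i => ?_
  rcases h : c.out i with l | j
  · simp only [eval, h, (c.value_isValuation _).1]
    exact continuous_apply l
  · simp only [eval, h]
    exact hj j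

end Circuit

/-! ## Programs with time bounds -/

section Runs

variable {K A : Type} [DecidableEq K]

/-- The program `p` transforms the stacks `s` into `s'` in at most `T` steps. -/
def Runs (p : Prog K A) (s s' : K → List A) (T : ℕ) : Prop := ∃ n ≤ T, Run p s n s'

theorem Runs.mono {p : Prog K A} {s s' : K → List A} {T T' : ℕ} (h : Runs p s s' T) (hT : T ≤ T') :
    Runs p s s' T' :=
  h.imp fun _ h => ⟨h.1.trans hT, h.2⟩

theorem Runs.skip (s : K → List A) (T : ℕ) : Runs .skip s s T := ⟨0, Nat.zero_le _, .skip s⟩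

theorem Runs.push (k : K) (a : A) (s : K → List A) :
    Runs (.push k a) s (Function.update s k (a :: s k)) 1 := ⟨1, le_rfl, .push k a s⟩

theorem Runs.seq {p q : Prog K A} {s s' s'' : K → List A} {T T' : ℕ} (h : Runs p s s' T)
    (h' : Runs q s' s'' T') : Runs (.seq p q) s s'' (T + T') := by
  obtain ⟨m, hm, h⟩ := h
  obtain ⟨n, hn, h'⟩ := h'
  exact ⟨m + n, by omega, h.seq h'⟩

theorem Runs.last {k : K} {body : Option A → Prog K A} {again : Option A → Bool}
    {s s' : K → List A} {T : ℕ} (ha : again (s k).head? = false)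
    (h : Runs (body (s k).head?) (Function.update s k (s k).tail) s' T) :
    Runs (.loop k body again) s s' (T + 1) := by
  obtain ⟨n, hn, h⟩ := h
  exact ⟨n + 1, by omega, .last ha h⟩

theorem Runs.next {k : K} {body : Option A → Prog K A} {again : Option A → Bool}
    {s s' s'' : K → List A} {T T' : ℕ} (ha : again (s k).head? = true)
    (h : Runs (body (s k).head?) (Function.update s k (s k).tail) s' T)
    (h' : Runs (.loop k body again) s' s'' T') :
    Runs (.loop k body again) s s'' (T + T' + 1) := by
  obtain ⟨m, hm, h⟩ := h
  obtain ⟨n, hn, h'⟩ := h'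
  exact ⟨m + n + 1, by omega, .next ha h h'⟩

/-- Run `p a` for all symbols `a` popped from the stack `k`, until it is empty. -/
def Prog.forEach (k : K) (p : A → Prog K A) : Prog K A :=
  .loop k (fun o => o.elim .skip p) Option.isSome

theorem Runs.forEach_nil {k : K} {p : A → Prog K A} {s : K → List A} (h : s k = []) :
    Runs (.forEach k p) s s 1 := by
  have : Function.update s k (s k).tail = s := by
    rw [h, List.tail_nil, ← h, Function.update_eq_self]
  refine Runs.last (T := 0) (by simp [h]) ?_
  rw [this, h]
  exact Runs.skip _ _

theorem Runs.forEach_cons {k : K} {p : A → Prog K A} {s s' s'' : K → List A} {a : A} {l : List A}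
    {T T' : ℕ} (h : s k = a :: l) (h₁ : Runs (p a) (Function.update s k l) s' T)
    (h₂ : Runs (.forEach k p) s' s'' T') : Runs (.forEach k p) s s'' (T + T' + 1) := by
  refine Runs.next (by simp [h]) ?_ h₂
  rw [h]
  exact h₁

end Runs

/-! ## The program that writes the formula -/

/-- The stacks: input, output in reverse order, output, scratch, and two counters in unary. -/
inductive Reg : Type
  | inp | acc | out | tmp | cnt | arg
  deriving DecidableEq

instance : Fintype Reg where
  elems := {.inp, .acc, .out, .tmp, .cnt, .arg}
  complete x := by cases x <;> decide

/-- The stacks with given contents. -/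
def stk (i a o t c r : List Sym) : Reg → List Sym
  | .inp => i
  | .acc => a
  | .out => o
  | .tmp => t
  | .cnt => c
  | .arg => r

section Update

variable (i a o t c r l : List Sym)

theorem update_stk_inp : Function.update (stk i a o t c r) .inp l = stk l a o t c r := by
  funext k; cases k <;> rfl

theorem update_stk_acc : Function.update (stk i a o t c r) .acc l = stk i l o t c r := by
  funext k; cases k <;> rfl

theorem update_stk_out : Function.update (stk i a o t c r) .out l = stk i a l t c r := by
  funext k; cases k <;> rfl

theorem update_stk_tmp : Function.update (stk i a o t c r) .tmp l = stk i a o l c r := by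
  funext k; cases k <;> rfl

theorem update_stk_cnt : Function.update (stk i a o t c r) .cnt l = stk i a o t l r := by
  funext k; cases k <;> rfl

theorem update_stk_arg : Function.update (stk i a o t c r) .arg l = stk i a o t c l := by
  funext k; cases k <;> rfl

end Update

def ones (n : ℕ) : List Sym := List.replicate n .one

theorem ones_add (m n : ℕ) : ones (m + n) = ones m ++ ones n := List.replicate_add m n _

theorem ones_reverse (n : ℕ) : (ones n).reverse = ones n := List.reverse_replicate

theorem ones_length (n : ℕ) : (ones n).length = n := List.length_replicate

theorem encUnary_eq (n : ℕ) : encUnary n = ones n ++ [Sym.sep] := by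
  induction n with
  | zero => rfl
  | succ n ih => rw [encUnary, ih]; rfl

namespace Prog

/-- Write the string `w`. -/
def write : List Sym → Prog Reg Sym
  | [] => skip
  | a :: w => seq (push .acc a) (write w)

/-- Write `m` ones for each symbol on the counter `k`. -/
def writeOnes (k : Reg) (m : ℕ) : Prog Reg Sym :=
  seq (forEach k fun _ => seq (push .tmp .one) (write (ones m)))
    (forEach .tmp fun _ => push k .one)

/-- Write the name of the variable at a place of a template. -/
def writeHole : Hole → Prog Reg Sym
  | .free => seq (write [.left]) (seq (writeOnes .cnt 1) (write [.sep]))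
  | .cnt o => seq (write [.right]) (seq (writeOnes .cnt 11) (write (encUnary o)))
  | .arg o => seq (write [.right]) (seq (writeOnes .arg 11) (write (encUnary o)))

def writeTerm : Term Hole → Prog Reg Sym
  | .var h => seq (write [.var]) (writeHole h)
  | .const z => write (.const :: encInt z)
  | .add s t => seq (write [.add]) (seq (writeTerm s) (writeTerm t))
  | .sub s t => seq (write [.sub]) (seq (writeTerm s) (writeTerm t))
  | .mul s t => seq (write [.mul]) (seq (writeTerm s) (writeTerm t))

def writeQF : QF Hole → Prog Reg Sym
  | .lt s t => seq (write [.lt]) (seq (writeTerm s) (writeTerm t))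
  | .le s t => seq (write [.le]) (seq (writeTerm s) (writeTerm t))
  | .eq s t => seq (write [.eq]) (seq (writeTerm s) (writeTerm t))
  | .ge s t => seq (write [.ge]) (seq (writeTerm s) (writeTerm t))
  | .gt s t => seq (write [.gt]) (seq (writeTerm s) (writeTerm t))
  | .and p q => seq (write [.and]) (seq (writeQF p) (writeQF q))
  | .or p q => seq (write [.or]) (seq (writeQF p) (writeQF q))
  | .not p => seq (write [.not]) (writeQF p)

/-- Write a formula as an item of a conjunction. -/
def writeItem (q : QF Hole) : Prog Reg Sym := seq (write [.and]) (writeQF q)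

/-- Read a number in unary and push it to `k`. -/
def readUnary (k : Reg) : Prog Reg Sym :=
  loop .inp (fun o => if o = some .one then push k .one else skip) fun o => o = some .one

/-- Copy the input to the output up to the next separator. -/
def copyToSep : Prog Reg Sym :=
  loop .inp (fun o => o.elim skip (push .acc)) fun o => o ≠ some .sep

/-- Empty the stack `k`. -/
def clear (k : Reg) : Prog Reg Sym := forEach k fun _ => skip

end Prog

/-- The name of the variable at a place of a template. -/
def holeEnc (j a : ℕ) : Hole → List Sym
  | .free => Sym.left :: encUnary j
  | .cnt o => Sym.right :: encUnary (11 * j + o)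
  | .arg o => Sym.right :: encUnary (11 * a + o)

/-! ### Running times of the elementary programs -/

section Basic

variable {i a o t c r : List Sym}

theorem runs_push_acc (x : Sym) :
    Runs (.push .acc x) (stk i a o t c r) (stk i (x :: a) o t c r) 1 := by
  have := Runs.push Reg.acc x (stk i a o t c r)
  rwa [update_stk_acc] at this

theorem runs_write (w : List Sym) : ∀ {a : List Sym},
    Runs (.write w) (stk i a o t c r) (stk i (w.reverse ++ a) o t c r) w.length := by
  induction w with
  | nil => intro a; exact Runs.skip _ _
  | cons x w ih =>
    intro a
    rw [List.reverse_cons, List.append_assoc]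
    exact ((runs_push_acc x).seq ih).mono (by simp; omega)

theorem runs_clear_cnt (n : ℕ) :
    Runs (.clear .cnt) (stk i a o t (ones n) r) (stk i a o t [] r) (n + 1) := by
  induction n with
  | zero => exact Runs.forEach_nil rfl
  | succ n ih =>
    refine (Runs.forEach_cons (T := 0) (s' := stk i a o t (ones n) r) rfl ?_ ih).mono (by omega)
    rw [update_stk_cnt]
    exact Runs.skip _ _

theorem runs_clear_arg (n : ℕ) :
    Runs (.clear .arg) (stk i a o t c (ones n)) (stk i a o t c []) (n + 1) := by
  induction n with
  | zero => exact Runs.forEach_nil rfl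
  | succ n ih =>
    refine (Runs.forEach_cons (T := 0) (s' := stk i a o t c (ones n)) rfl ?_ ih).mono (by omega)
    rw [update_stk_arg]
    exact Runs.skip _ _

/-- Reading a counter destroys it, so each symbol is also saved on `tmp` and pushed back afterwards.
-/
theorem runs_writeOnes_cnt (m n : ℕ) : Runs (.writeOnes .cnt m) (stk i a o [] (ones n) r)
    (stk i (ones (m * n) ++ a) o [] (ones n) r) ((m + 4) * (n + 1)) := by
  have h₁ : ∀ n a t, Runs (.forEach .cnt fun _ => .seq (.push .tmp .one) (.write (ones m)))
      (stk i a o t (ones n) r) (stk i (ones (m * n) ++ a) o (ones n ++ t) [] r)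
      (n * (m + 2) + 1) := by
    intro n
    induction n with
    | zero =>
      intro a t
      exact Runs.forEach_nil rfl |>.mono (by omega)
    | succ n ih =>
      intro a t
      have h := (Runs.push Reg.tmp Sym.one (stk i a o t (ones n) r)).seq
        (update_stk_tmp i a o t (ones n) r _ ▸ runs_write (ones m))
      rw [ones_reverse, ones_length] at h
      have := Runs.forEach_cons (s := stk i a o t (ones (n + 1)) r) rfl
        (by rw [update_stk_cnt]; exact h) (ih (ones m ++ a) (.one :: t))
      have e' : ones (m * (n + 1)) ++ a = ones (m * n) ++ (ones m ++ a) := by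
        rw [mul_add, mul_one, ones_add, List.append_assoc]
      rw [e']
      have e : ones (n + 1) ++ t = ones n ++ (.one :: t) := by
        rw [ones_add, List.append_assoc]; rfl
      rw [e]
      exact this.mono (le_of_eq (by ring))
  have h₂ : ∀ n c a, Runs (.forEach .tmp fun _ => .push .cnt .one)
      (stk i a o (ones n) c r) (stk i a o [] (ones n ++ c) r) (n * 2 + 1) := by
    intro n
    induction n with
    | zero => intro c a; exact Runs.forEach_nil rfl
    | succ n ih =>
      intro c a
      have h := Runs.push Reg.cnt Sym.one (stk i a o (ones n) c r)
      rw [update_stk_cnt] at h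
      have := Runs.forEach_cons (s := stk i a o (ones (n + 1)) c r) rfl
        (by rw [update_stk_tmp]; exact h) (ih (.one :: c) a)
      have e : ones (n + 1) ++ c = ones n ++ (.one :: c) := by
        rw [ones_add, List.append_assoc]; rfl
      rw [e]
      exact this.mono (le_of_eq (by ring))
  have h := h₁ n a []
  have h' := h₂ n [] (ones (m * n) ++ a)
  rw [List.append_nil] at h h'
  exact (h.seq h').mono (by nlinarith)

theorem runs_writeOnes_arg (m n : ℕ) : Runs (.writeOnes .arg m) (stk i a o [] c (ones n))
    (stk i (ones (m * n) ++ a) o [] c (ones n)) ((m + 4) * (n + 1)) := by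
  have h₁ : ∀ n a t, Runs (.forEach .arg fun _ => .seq (.push .tmp .one) (.write (ones m)))
      (stk i a o t c (ones n)) (stk i (ones (m * n) ++ a) o (ones n ++ t) c [])
      (n * (m + 2) + 1) := by
    intro n
    induction n with
    | zero =>
      intro a t
      exact Runs.forEach_nil rfl |>.mono (by omega)
    | succ n ih =>
      intro a t
      have h := (Runs.push Reg.tmp Sym.one (stk i a o t c (ones n))).seq
        (update_stk_tmp i a o t c (ones n) _ ▸ runs_write (ones m))
      rw [ones_reverse, ones_length] at h
      have := Runs.forEach_cons (s := stk i a o t c (ones (n + 1))) rfl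
        (by rw [update_stk_arg]; exact h) (ih (ones m ++ a) (.one :: t))
      have e' : ones (m * (n + 1)) ++ a = ones (m * n) ++ (ones m ++ a) := by
        rw [mul_add, mul_one, ones_add, List.append_assoc]
      rw [e']
      have e : ones (n + 1) ++ t = ones n ++ (.one :: t) := by
        rw [ones_add, List.append_assoc]; rfl
      rw [e]
      exact this.mono (le_of_eq (by ring))
  have h₂ : ∀ n r a, Runs (.forEach .tmp fun _ => .push .arg .one)
      (stk i a o (ones n) c r) (stk i a o [] c (ones n ++ r)) (n * 2 + 1) := by
    intro n
    induction n with
    | zero => intro r a; exact Runs.forEach_nil rfl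
    | succ n ih =>
      intro r a
      have h := Runs.push Reg.arg Sym.one (stk i a o (ones n) c r)
      rw [update_stk_arg] at h
      have := Runs.forEach_cons (s := stk i a o (ones (n + 1)) c r) rfl
        (by rw [update_stk_tmp]; exact h) (ih (.one :: r) a)
      have e : ones (n + 1) ++ r = ones n ++ (.one :: r) := by
        rw [ones_add, List.append_assoc]; rfl
      rw [e]
      exact this.mono (le_of_eq (by ring))
  have h := h₁ n a []
  have h' := h₂ n [] (ones (m * n) ++ a)
  rw [List.append_nil] at h h'
  exact (h.seq h').mono (by nlinarith)

theorem runs_readUnary_cnt (n : ℕ) : ∀ {c : List Sym}, Runs (.readUnary .cnt)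
    (stk (encUnary n ++ i) a o t c r) (stk i a o t (ones n ++ c) r) (2 * n + 1) := by
  induction n with
  | zero =>
    intro c
    refine Runs.last (T := 0) rfl ?_
    rw [update_stk_inp]
    exact Runs.skip _ _
  | succ n ih =>
    intro c
    have h := Runs.push Reg.cnt Sym.one (stk (encUnary n ++ i) a o t c r)
    rw [update_stk_cnt] at h
    have := Runs.next (again := fun o => o = some Sym.one)
      (body := fun o => if o = some Sym.one then .push .cnt .one else .skip)
      (s := stk (encUnary (n + 1) ++ i) a o t c r) rfl
      (by rw [update_stk_inp]; exact h) (ih (c := .one :: c))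
    have e : ones (n + 1) ++ c = ones n ++ (.one :: c) := by
      rw [ones_add, List.append_assoc]; rfl
    rw [e]
    exact this.mono (by omega)

theorem runs_readUnary_arg (n : ℕ) : ∀ {r : List Sym}, Runs (.readUnary .arg)
    (stk (encUnary n ++ i) a o t c r) (stk i a o t c (ones n ++ r)) (2 * n + 1) := by
  induction n with
  | zero =>
    intro r
    refine Runs.last (T := 0) rfl ?_
    rw [update_stk_inp]
    exact Runs.skip _ _
  | succ n ih =>
    intro r
    have h := Runs.push Reg.arg Sym.one (stk (encUnary n ++ i) a o t c r)
    rw [update_stk_arg] at h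
    have := Runs.next (again := fun o => o = some Sym.one)
      (body := fun o => if o = some Sym.one then .push .arg .one else .skip)
      (s := stk (encUnary (n + 1) ++ i) a o t c r) rfl
      (by rw [update_stk_inp]; exact h) (ih (r := .one :: r))
    have e : ones (n + 1) ++ r = ones n ++ (.one :: r) := by
      rw [ones_add, List.append_assoc]; rfl
    rw [e]
    exact this.mono (by omega)

theorem runs_copyToSep_cons {x : Sym} (hx : x ≠ .sep) {l : List Sym} {s : Reg → List Sym} {T : ℕ}
    (h : Runs .copyToSep (stk l (x :: a) o t c r) s T) :
    Runs .copyToSep (stk (x :: l) a o t c r) s (T + 2) := by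
  have h' := Runs.next (k := Reg.inp) (again := fun o => decide (o ≠ some Sym.sep))
    (body := fun o : Option Sym => o.elim .skip (.push .acc)) (s := stk (x :: l) a o t c r)
    (s' := stk l (x :: a) o t c r) (T := 1)
    (by simpa [stk] using hx) (by rw [update_stk_inp]; exact runs_push_acc x) h
  exact h'.mono (by omega)

theorem runs_copyToSep_encBits (l : List Bool) : ∀ {a : List Sym}, Runs .copyToSep
    (stk (encBits l ++ i) a o t c r) (stk i ((encBits l).reverse ++ a) o t c r)
    (2 * (encBits l).length) := by
  induction l with
  | nil =>
    intro a
    refine Runs.last (T := 1) rfl ?_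
    rw [update_stk_inp]
    exact runs_push_acc _
  | cons b l ih =>
    intro a
    rw [encBits, List.reverse_cons, List.append_assoc, List.cons_append, List.length_cons]
    exact runs_copyToSep_cons (by cases b <;> simp) ih

/-- The sign is a non-separator like the digits, so the same loop copies it. -/
theorem runs_copyToSep_encInt (z : ℤ) : Runs .copyToSep
    (stk (encInt z ++ i) a o t c r) (stk i ((encInt z).reverse ++ a) o t c r)
    (2 * (encInt z).length) := by
  rw [encInt, List.reverse_cons, List.append_assoc, List.cons_append, List.length_cons]
  exact runs_copyToSep_cons (by split_ifs <;> simp) (runs_copyToSep_encBits _)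

theorem runs_moveAcc : ∀ {a o : List Sym}, Runs (.forEach .acc (.push .out)) (stk i a o t c r)
    (stk i [] (a.reverse ++ o) t c r) (2 * a.length + 1) := by
  intro a
  induction a with
  | nil => intro o; exact Runs.forEach_nil rfl
  | cons x a ih =>
    intro o
    have h := Runs.push Reg.out x (stk i a o t c r)
    rw [update_stk_out] at h
    have := Runs.forEach_cons (s := stk i (x :: a) o t c r) rfl
      (by rw [update_stk_acc]; exact h) (ih (o := x :: o))
    rw [List.reverse_cons, List.append_assoc]
    exact this.mono (by rw [List.length_cons]; omega)

/-- The constant depends on the hole alone. As there are finitely many templates, this gives one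
linear bound for all rows of all circuits. -/
theorem runs_writeHole (h : Hole) : ∃ C, ∀ (i a o : List Sym) (B j r : ℕ), j ≤ B → r ≤ B →
    Runs (.writeHole h) (stk i a o [] (ones j) (ones r))
      (stk i ((holeEnc j r h).reverse ++ a) o [] (ones j) (ones r)) (C * (B + 1)) := by
  cases h with
  | free =>
    refine ⟨7, fun i a o B j r hj _ => ?_⟩
    have := (runs_write (i := i) (a := a) (o := o) (t := []) (c := ones j) (r := ones r) [.left]).seq
      ((runs_writeOnes_cnt 1 j).seq (runs_write [.sep]))
    rw [holeEnc, encUnary_eq]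
    simp only [List.reverse_cons, List.reverse_append, ones_reverse, one_mul, List.reverse_nil,
      List.nil_append, List.cons_append, List.append_assoc, List.length_singleton] at this ⊢
    exact this.mono (by nlinarith)
  | cnt u =>
    refine ⟨u + 17, fun i a o B j r hj _ => ?_⟩
    have := (runs_write (i := i) (a := a) (o := o) (t := []) (c := ones j) (r := ones r) [.right]).seq
      ((runs_writeOnes_cnt 11 j).seq (runs_write (encUnary u)))
    have e : (holeEnc j r (.cnt u)).reverse ++ a =
        (encUnary u).reverse ++ (ones (11 * j) ++ ([Sym.right].reverse ++ a)) := by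
      simp only [holeEnc, encUnary_eq, add_comm (11 * j) u, ones_add, List.reverse_cons,
        List.reverse_append, ones_reverse, List.reverse_nil, List.nil_append, List.cons_append,
        List.append_assoc]
      rw [← List.append_assoc, ← ones_add, add_comm, ones_add, List.append_assoc]
    have hl : (encUnary u).length = u + 1 := by
      rw [encUnary_eq, List.length_append, ones_length, List.length_singleton]
    rw [e]
    rw [hl] at this
    exact this.mono (by rw [List.length_singleton]; nlinarith [Nat.zero_le (u * B)])
  | arg u =>
    refine ⟨u + 17, fun i a o B j r _ hr => ?_⟩
    have := (runs_write (i := i) (a := a) (o := o) (t := []) (c := ones j) (r := ones r) [.right]).seq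
      ((runs_writeOnes_arg 11 r).seq (runs_write (encUnary u)))
    have e : (holeEnc j r (.arg u)).reverse ++ a =
        (encUnary u).reverse ++ (ones (11 * r) ++ ([Sym.right].reverse ++ a)) := by
      simp only [holeEnc, encUnary_eq, add_comm (11 * r) u, ones_add, List.reverse_cons,
        List.reverse_append, ones_reverse, List.reverse_nil, List.nil_append, List.cons_append,
        List.append_assoc]
      rw [← List.append_assoc, ← ones_add, add_comm, ones_add, List.append_assoc]
    have hl : (encUnary u).length = u + 1 := by
      rw [encUnary_eq, List.length_append, ones_length, List.length_singleton]
    rw [e]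
    rw [hl] at this
    exact this.mono (by rw [List.length_singleton]; nlinarith [Nat.zero_le (u * B)])

end Basic

/-- The program `p` writes the string `w j r` if the counters are `j` and `r`, in time linear in
the counters. -/
def Writes (p : Prog Reg Sym) (w : ℕ → ℕ → List Sym) : Prop :=
  ∃ C, ∀ (i a o : List Sym) (B j r : ℕ), j ≤ B → r ≤ B →
    Runs p (stk i a o [] (ones j) (ones r)) (stk i ((w j r).reverse ++ a) o [] (ones j) (ones r))
      (C * (B + 1))

theorem writes_write (l : List Sym) : Writes (.write l) fun _ _ => l :=
  ⟨l.length, fun _ _ _ B _ _ _ _ => (runs_write l).mono (Nat.le_mul_of_pos_right _ B.succ_pos)⟩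

theorem Writes.seq {p q : Prog Reg Sym} {v w : ℕ → ℕ → List Sym} (hp : Writes p v)
    (hq : Writes q w) : Writes (.seq p q) fun j r => v j r ++ w j r := by
  obtain ⟨C, hC⟩ := hp
  obtain ⟨D, hD⟩ := hq
  refine ⟨C + D, fun i a o B j r hj hr => ?_⟩
  have := (hC i a o B j r hj hr).seq (hD i _ o B j r hj hr)
  rw [List.reverse_append, List.append_assoc]
  exact this.mono (le_of_eq (by ring))

theorem writes_writeTerm (t : Term Hole) : Writes (.writeTerm t) fun j r => t.enc (holeEnc j r) := by
  induction t with
  | var h => exact (writes_write [.var]).seq (runs_writeHole h)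
  | const z => exact writes_write _
  | add s t hs ht => exact (writes_write [.add]).seq (hs.seq ht)
  | sub s t hs ht => exact (writes_write [.sub]).seq (hs.seq ht)
  | mul s t hs ht => exact (writes_write [.mul]).seq (hs.seq ht)

theorem writes_writeQF (q : QF Hole) : Writes (.writeQF q) fun j r => q.enc (holeEnc j r) := by
  induction q with
  | lt s t => exact (writes_write [.lt]).seq ((writes_writeTerm s).seq (writes_writeTerm t))
  | le s t => exact (writes_write [.le]).seq ((writes_writeTerm s).seq (writes_writeTerm t))
  | eq s t => exact (writes_write [.eq]).seq ((writes_writeTerm s).seq (writes_writeTerm t))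
  | ge s t => exact (writes_write [.ge]).seq ((writes_writeTerm s).seq (writes_writeTerm t))
  | gt s t => exact (writes_write [.gt]).seq ((writes_writeTerm s).seq (writes_writeTerm t))
  | and p q hp hq => exact (writes_write [.and]).seq (hp.seq hq)
  | or p q hp hq => exact (writes_write [.or]).seq (hp.seq hq)
  | not p hp => exact (writes_write [.not]).seq hp

theorem writes_writeItem (q : QF Hole) :
    Writes (.writeItem q) fun j r => Sym.and :: q.enc (holeEnc j r) :=
  (writes_write [.and]).seq (writes_writeQF q)

/-! ## Strings of instantiated templates -/

section Enc

variable {n k b : ℕ}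

theorem encName_cnt {y : Fin n ⊕ Fin (b + 1)} {j r o : ℕ} (h : 11 * j + o ≤ b) :
    encName (Hole.var y j r (.cnt o)) = holeEnc j r (.cnt o) := by
  simp only [Hole.var, encName, holeEnc, Fin.val_ofNat, Nat.mod_eq_of_lt (Nat.lt_succ_of_le h)]

theorem encName_arg {y : Fin n ⊕ Fin (b + 1)} {j r o : ℕ} (h : 11 * r + o ≤ b) :
    encName (Hole.var y j r (.arg o)) = holeEnc j r (.arg o) := by
  simp only [Hole.var, encName, holeEnc, Fin.val_ofNat, Nat.mod_eq_of_lt (Nat.lt_succ_of_le h)]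

/-- An item of a conjunction as a string. -/
def item (q : QF (Fin n ⊕ Fin (b + 1))) : List Sym := Sym.and :: q.enc encName

theorem item_inst {j r : ℕ} {q : QF Hole}
    (h : q.All fun x => (encName (Hole.var (Sum.inr 0) j r x : Fin n ⊕ Fin (b + 1))) = holeEnc j r x) :
    item (inst n b j r q) = Sym.and :: q.enc (holeEnc j r) := by
  rw [item, inst, QF.enc_map]
  exact congrArg (Sym.and :: ·) (QF.enc_congr q h)

theorem item_inst_gate {j : ℕ} (hj : 11 * j + 10 ≤ b) {q : QF Hole}
    (hq : q ∈ [Template.const, Template.add, Template.sub, Template.smul, Template.mul,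
      Template.max, Template.min]) :
    item (inst n b j 0 q) = Sym.and :: q.enc (holeEnc j 0) := by
  have hV : ∀ o, o ≤ 10 → encName (Hole.var (Sum.inr 0) j 0 (.cnt o) : Fin n ⊕ Fin (b + 1)) =
      holeEnc j 0 (.cnt o) := fun o ho => encName_cnt (by omega)
  refine item_inst ?_
  simp only [List.mem_cons, List.not_mem_nil, or_false] at hq
  rcases hq with rfl | rfl | rfl | rfl | rfl | rfl | rfl <;>
    simp [Template.const, Template.add, Template.sub, Template.smul, Template.mul,
      Template.max, Template.min, Template.twice, QF.All, Term.All, hV]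

theorem item_sumIs {j : ℕ} (hj : 11 * j + 10 ≤ b) (z : ℤ) :
    item (inst n b j 0 (Template.sumIs z)) = Sym.and :: (Template.sumIs z).enc (holeEnc j 0) :=
  item_inst ⟨encName_cnt (by omega), trivial⟩

theorem item_inputFormula (hb : 11 * n + 10 ≤ b) (i : Fin n) :
    item (inputFormula n b i) = Sym.and :: Template.input.enc (holeEnc i 0) := by
  -- Beyond its own row, the template uses entry `14`; since `i < n`, indices up to `11 * i + 20` do
  -- not wrap around.
  have hV : ∀ o, o ≤ 20 → encName (Hole.var (Sum.inl i) i 0 (.cnt o) : Fin n ⊕ Fin (b + 1)) =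
      holeEnc i 0 (.cnt o) := fun o ho => encName_cnt (by omega)
  have hf : encName (Hole.var (Sum.inl i) i 0 .free : Fin n ⊕ Fin (b + 1)) = holeEnc i 0 .free := rfl
  rw [item, inputFormula, QF.enc_map, QF.enc_congr (e' := holeEnc i 0)]
  simp [Template.input, QF.All, Term.All, hV, hf]

theorem nodeRow_lt (a : Fin n ⊕ Fin k) : nodeRow a < n + k := by
  rcases a with i | j
  · exact i.2.trans_le (Nat.le_add_right n k)
  · exact j.2.trans_le (Nat.le_add_left k n)

theorem nodeEntry_le (a : Fin n ⊕ Fin k) : nodeEntry a ≤ 4 := by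
  rcases a with i | j <;> simp [nodeEntry]

theorem item_operandFormula (hb : 11 * (n + k) + 10 ≤ b) {j p p' : ℕ} (hj : 11 * j + 10 ≤ b)
    (hp : p ≤ 10) (hp' : p' ≤ 10) (a : Fin n ⊕ Fin k) : item (operandFormula b j p p' a) =
      Sym.and :: (Template.operand p p' (nodeEntry a)).enc (holeEnc j (nodeRow a)) := by
  have h1 := nodeRow_lt a
  have h2 := nodeEntry_le a
  exact item_inst ⟨⟨encName_cnt (by omega), encName_arg (by omega)⟩,
    encName_cnt (by omega), encName_arg (by omega)⟩

/-- The template does not mention the row in hand, so `j` is free: the formula uses row `0`, while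
the program's counter stands at the number of gates. -/
theorem item_outputFormula (hb : 11 * (n + k) + 10 ≤ b) (j : ℕ) (a : Fin n ⊕ Fin k) :
    item (outputFormula b a) =
      Sym.and :: (Template.output (nodeEntry a)).enc (holeEnc j (nodeRow a)) := by
  have h1 := nodeRow_lt a
  have h2 := nodeEntry_le a
  exact item_inst (j := 0) ⟨encName_arg (by omega), encName_arg (by omega)⟩

/-- The item consists of fixed pieces around the strings of numerator and denominator, in the order
in which the input lists them, so these are copied without arithmetic. -/
theorem item_ratFormula {j : ℕ} (hj : 11 * j + 10 ≤ b) (ζ : ℚ) : item (ratFormula n b j ζ) =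
    [.and, .eq, .const] ++ (encInt ζ.num ++ ([.mul] ++ ((Template.V 8).enc (holeEnc j 0) ++
      ([.const, .plusSign] ++ encNat ζ.den)))) := by
  have h : encInt (ζ.den : ℤ) = Sym.plusSign :: encNat ζ.den := by
    rw [encInt, if_neg (by omega), Int.natAbs_natCast]
  have h8 : encName (Hole.var (Sum.inr 0) j 0 (.cnt 8) : Fin n ⊕ Fin (b + 1)) =
      holeEnc j 0 (.cnt 8) := encName_cnt (by omega)
  simp [item, ratFormula, QF.enc, Term.enc, h, h8]

end Enc

/-! ## Transducers -/

/-- The program `p` reads `u`, writes `w`, and changes the counters from `j`, `r` to `j'`, `r'`,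
in time `T`. -/
def Transduces (p : Prog Reg Sym) (u w : List Sym) (j r j' r' T : ℕ) : Prop :=
  ∀ i a o, Runs p (stk (u ++ i) a o [] (ones j) (ones r))
    (stk i (w.reverse ++ a) o [] (ones j') (ones r')) T

namespace Transduces

variable {p q : Prog Reg Sym} {u w u' w' : List Sym} {j r j' r' j'' r'' T T' : ℕ}

theorem mono (h : Transduces p u w j r j' r' T) (hT : T ≤ T') : Transduces p u w j r j' r' T' :=
  fun i a o => (h i a o).mono hT

theorem seq (h : Transduces p u w j r j' r' T) (h' : Transduces q u' w' j' r' j'' r'' T') :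
    Transduces (.seq p q) (u ++ u') (w ++ w') j r j'' r'' (T + T') := by
  intro i a o
  rw [List.append_assoc, List.reverse_append, List.append_assoc]
  exact (h _ a o).seq (h' i _ o)

theorem write (w : List Sym) : Transduces (.write w) [] w j r j r w.length :=
  fun _ _ _ => runs_write w

theorem writeOnes_cnt (m : ℕ) :
    Transduces (.writeOnes .cnt m) [] (ones (m * j)) j r j r ((m + 4) * (j + 1)) := by
  intro i a o
  rw [ones_reverse]
  exact runs_writeOnes_cnt m j

theorem writeOnes_arg (m : ℕ) :
    Transduces (.writeOnes .arg m) [] (ones (m * r)) j r j r ((m + 4) * (r + 1)) := by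
  intro i a o
  rw [ones_reverse]
  exact runs_writeOnes_arg m r

theorem clear_arg : Transduces (.clear .arg) [] [] j r j 0 (r + 1) :=
  fun _ _ _ => runs_clear_arg r

theorem push_cnt : Transduces (.push .cnt .one) [] [] j r (j + 1) r 1 := by
  intro i a o
  have := Runs.push Reg.cnt Sym.one (stk i a o [] (ones j) (ones r))
  rwa [update_stk_cnt] at this

theorem readUnary_cnt (n : ℕ) :
    Transduces (.readUnary .cnt) (encUnary n) [] j r (n + j) r (2 * n + 1) := by
  intro i a o
  rw [ones_add]
  exact runs_readUnary_cnt n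

theorem readUnary_arg (n : ℕ) :
    Transduces (.readUnary .arg) (encUnary n) [] j r j (n + r) (2 * n + 1) := by
  intro i a o
  rw [ones_add]
  exact runs_readUnary_arg n

theorem copyToSep_encNat (n : ℕ) :
    Transduces .copyToSep (encNat n) (encNat n) j r j r (2 * (encNat n).length) :=
  fun _ _ _ => runs_copyToSep_encBits _

theorem copyToSep_encInt (z : ℤ) :
    Transduces .copyToSep (encInt z) (encInt z) j r j r (2 * (encInt z).length) :=
  fun _ _ _ => runs_copyToSep_encInt z

/-- One pass of a loop over the input. -/
theorem loop_next {f : Sym → Prog Reg Sym} {x : Sym} (h : Transduces (f x) u w j r j' r' T)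
    {i a o : List Sym} {s : Reg → List Sym}
    (h' : Runs (.forEach .inp f) (stk i (w.reverse ++ a) o [] (ones j') (ones r')) s T') :
    Runs (.forEach .inp f) (stk (x :: (u ++ i)) a o [] (ones j) (ones r)) s (T + T' + 1) := by
  refine Runs.forEach_cons (s' := stk i (w.reverse ++ a) o [] (ones j') (ones r')) rfl ?_ h'
  rw [update_stk_inp]
  exact h i a o

end Transduces

theorem Writes.transduces {p : Prog Reg Sym} {w : ℕ → ℕ → List Sym} (h : Writes p w) :
    ∃ C, ∀ B j r, j ≤ B → r ≤ B → Transduces p [] (w j r) j r j r (C * (B + 1)) :=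
  h.imp fun _ h B j r hj hr i a o => h i a o B j r hj hr

namespace Prog

/-- Read a name and run `p o`, where `o` is the entry of the node with this name. -/
def branch (p : ℕ → Prog Reg Sym) : Sym → Prog Reg Sym
  | .left => p 0
  | .right => p 4
  | _ => skip

/-- Read a symbol and use it. -/
def read (p : Sym → Prog Reg Sym) : Prog Reg Sym := loop .inp (fun o => o.elim skip p) fun _ => false

/-- Read the number of a node and write the item `q`. -/
def nodeItem (q : QF Hole) : Prog Reg Sym :=
  seq (readUnary .arg) (seq (writeItem q) (clear .arg))

def operand (p p' : ℕ) : Prog Reg Sym := read (branch fun o => nodeItem (Template.operand p p' o))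

def rat : Prog Reg Sym :=
  seq (write [.and, .eq, .const]) (seq copyToSep (seq (write [.mul])
    (seq (writeTerm (Template.V 8)) (seq (write [.const, .plusSign]) copyToSep))))

def binary (q : QF Hole) : Prog Reg Sym :=
  seq (operand 6 9) (seq (operand 7 10) (seq (writeItem q) (push .cnt .one)))

/-- Read the rest of a gate or the name of an output, after the first symbol. -/
def gateOrOutput : Sym → Prog Reg Sym
  | .const => seq rat (seq (writeItem Template.const) (push .cnt .one))
  | .add => binary Template.add
  | .sub => binary Template.sub
  | .smul => seq rat (seq (operand 6 9) (seq (writeItem Template.smul) (push .cnt .one)))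
  | .mul => binary Template.mul
  | .max => binary Template.max
  | .min => binary Template.min
  -- A name begins with `left` or `right` and a gate never does, so one loop serves gates and
  -- outputs without knowing where the gates end.
  | x => branch (fun o => nodeItem (Template.output o)) x

end Prog

theorem Transduces.read {f : Sym → Prog Reg Sym} {x : Sym} {u w : List Sym} {j r j' r' T : ℕ}
    (h : Transduces (f x) u w j r j' r' T) :
    Transduces (.read f) (x :: u) w j r j' r' (T + 1) := by
  intro i a o
  refine Runs.last rfl ?_
  rw [update_stk_inp]
  exact h i a o

theorem transduces_nodeItem (q : QF Hole) : ∃ C, ∀ B j r, j ≤ B → r ≤ B →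
    Transduces (.nodeItem q) (encUnary r) (Sym.and :: q.enc (holeEnc j r)) j 0 j 0 (C * (B + 1)) := by
  obtain ⟨C, hC⟩ := (writes_writeItem q).transduces
  refine ⟨C + 4, fun B j r hj hr => ?_⟩
  have := (Transduces.readUnary_arg (j := j) (r := 0) r).seq ((hC B j r hj hr).seq Transduces.clear_arg)
  simp only [List.append_nil, List.nil_append] at this
  exact this.mono (by nlinarith)

/-! ### Translating gates, outputs and inputs -/

section Gates

variable {n k b : ℕ}

theorem transduces_branch (q : ℕ → QF Hole) : ∃ C, ∀ {n k : ℕ} (B j : ℕ) (a : Fin n ⊕ Fin k),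
    n ≤ B → k ≤ B → j ≤ B → ∃ x, encName a = x :: encUnary (nodeRow a) ∧
      Transduces (.branch (fun o => .nodeItem (q o)) x) (encUnary (nodeRow a))
        (Sym.and :: (q (nodeEntry a)).enc (holeEnc j (nodeRow a))) j 0 j 0 (C * (B + 1)) := by
  obtain ⟨C, hC⟩ := transduces_nodeItem (q 0)
  obtain ⟨D, hD⟩ := transduces_nodeItem (q 4)
  refine ⟨C + D, fun B j a hn hk hj => ?_⟩
  rcases a with i | i
  · exact ⟨_, rfl, (hC B j i hj (by omega)).mono (by nlinarith)⟩
  · exact ⟨_, rfl, (hD B j i hj (by omega)).mono (by nlinarith)⟩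

theorem transduces_operand {p p' : ℕ} (hp : p ≤ 10) (hp' : p' ≤ 10) :
    ∃ C, ∀ {n k b : ℕ} (B j : ℕ) (a : Fin n ⊕ Fin k), 11 * (n + k) + 10 ≤ b → 11 * j + 10 ≤ b →
      n ≤ B → k ≤ B → j ≤ B → Transduces (.operand p p') (encName a)
        (item (operandFormula b j p p' a)) j 0 j 0 (C * (B + 1)) := by
  obtain ⟨C, hC⟩ := transduces_branch fun o => Template.operand p p' o
  refine ⟨C + 1, fun B j a hb hjb hn hk hj => ?_⟩
  obtain ⟨x, hx, h⟩ := hC B j a hn hk hj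
  rw [hx, item_operandFormula hb hjb hp hp']
  exact h.read.mono (by nlinarith)

theorem transduces_rat : ∃ C, ∀ {n b : ℕ} (B j : ℕ) (ζ : ℚ), 11 * j + 10 ≤ b → j ≤ B →
    (encRat ζ).length ≤ B →
    Transduces .rat (encRat ζ) (item (ratFormula n b j ζ)) j 0 j 0 (C * (B + 1)) := by
  obtain ⟨C, hC⟩ := (writes_writeTerm (Template.V 8)).transduces
  refine ⟨C + 10, fun B j ζ hb hj hB => ?_⟩
  have := (Transduces.write (j := j) (r := 0) [.and, .eq, .const]).seq
    ((Transduces.copyToSep_encInt ζ.num).seq ((Transduces.write [.mul]).seq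
      ((hC B j 0 hj (Nat.zero_le _)).seq ((Transduces.write [.const, .plusSign]).seq
        (Transduces.copyToSep_encNat ζ.den)))))
  rw [item_ratFormula hb]
  simp only [List.nil_append] at this
  rw [encRat, List.length_append] at hB
  exact this.mono (by simp only [List.length_cons, List.length_nil]; nlinarith)

theorem transduces_binary {q : QF Hole}
    (hq : q ∈ [Template.const, Template.add, Template.sub, Template.smul, Template.mul,
      Template.max, Template.min]) : ∃ C, ∀ {n k b : ℕ} (B j : ℕ) (a c : Fin n ⊕ Fin k),
      11 * (n + k) + 10 ≤ b → 11 * j + 10 ≤ b → n ≤ B → k ≤ B → j ≤ B →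
      Transduces (.binary q) (encName a ++ encName c) ([operandFormula b j 6 9 a,
        operandFormula b j 7 10 c, inst n b j 0 q].flatMap item) j 0 (j + 1) 0 (C * (B + 1)) := by
  obtain ⟨C, hC⟩ := transduces_operand (p := 6) (p' := 9) (by omega) (by omega)
  obtain ⟨C', hC'⟩ := transduces_operand (p := 7) (p' := 10) (by omega) (by omega)
  obtain ⟨D, hD⟩ := (writes_writeItem q).transduces
  refine ⟨C + C' + D + 1, fun {n k b} B j a c hb hjb hn hk hj => ?_⟩
  have := (hC B j a hb hjb hn hk hj).seq ((hC' B j c hb hjb hn hk hj).seq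
    ((hD B j 0 hj (Nat.zero_le _)).seq Transduces.push_cnt))
  rw [← item_inst_gate (n := n) hjb hq] at this
  simp only [List.flatMap_cons, List.flatMap_nil, List.append_nil] at this ⊢
  exact this.mono (by nlinarith)

theorem transduces_gate : ∃ C, ∀ {n k b : ℕ} (B j : ℕ) (g : Gate (Fin n ⊕ Fin k)), g.IsArithmetic →
    11 * (n + k) + 10 ≤ b → 11 * j + 10 ≤ b → n ≤ B → k ≤ B → j ≤ B →
    (g.enc encName).length ≤ B → ∃ x u, g.enc encName = x :: u ∧
      Transduces (.gateOrOutput x) u ((gateFormulas b j g).flatMap item) j 0 (j + 1) 0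
        (C * (B + 1)) := by
  obtain ⟨C₁, h₁⟩ := transduces_rat
  obtain ⟨C₂, h₂⟩ := transduces_operand (p := 6) (p' := 9) (by omega) (by omega)
  obtain ⟨C₃, h₃⟩ := (writes_writeItem Template.const).transduces
  obtain ⟨C₄, h₄⟩ := (writes_writeItem Template.smul).transduces
  obtain ⟨D₁, k₁⟩ := transduces_binary (q := Template.add) (by simp)
  obtain ⟨D₂, k₂⟩ := transduces_binary (q := Template.sub) (by simp)
  obtain ⟨D₃, k₃⟩ := transduces_binary (q := Template.mul) (by simp)
  obtain ⟨D₄, k₄⟩ := transduces_binary (q := Template.max) (by simp)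
  obtain ⟨D₅, k₅⟩ := transduces_binary (q := Template.min) (by simp)
  refine ⟨C₁ + C₂ + C₃ + C₄ + D₁ + D₂ + D₃ + D₄ + D₅ + 1,
    fun {n k b} B j g hg hb hjb hn hk hj hB => ?_⟩
  cases g with
  | pos a => exact hg.elim
  | const ζ =>
    refine ⟨_, _, rfl, ?_⟩
    have hB : (encRat ζ).length ≤ B := (Nat.le_succ _).trans hB
    have := (h₁ (n := n) B j ζ hjb hj hB).seq ((h₃ B j 0 hj (Nat.zero_le _)).seq Transduces.push_cnt)
    rw [← item_inst_gate hjb (by simp)] at this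
    simp only [gateFormulas, List.flatMap_cons, List.flatMap_nil, List.append_nil] at this ⊢
    exact this.mono (by nlinarith)
  | smul ζ a =>
    refine ⟨_, _, rfl, ?_⟩
    have hB : (encRat ζ).length ≤ B := by
      simp only [Gate.enc, List.length_cons, List.length_append] at hB
      omega
    have := (h₁ (n := n) B j ζ hjb hj hB).seq ((h₂ B j a hb hjb hn hk hj).seq
      ((h₄ B j 0 hj (Nat.zero_le _)).seq Transduces.push_cnt))
    rw [← item_inst_gate hjb (by simp)] at this
    simp only [gateFormulas, List.flatMap_cons, List.flatMap_nil, List.append_nil] at this ⊢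
    exact this.mono (by nlinarith)
  | add a c => exact ⟨_, _, rfl, (k₁ B j a c hb hjb hn hk hj).mono (by nlinarith)⟩
  | sub a c => exact ⟨_, _, rfl, (k₂ B j a c hb hjb hn hk hj).mono (by nlinarith)⟩
  | mul a c => exact ⟨_, _, rfl, (k₃ B j a c hb hjb hn hk hj).mono (by nlinarith)⟩
  | max a c => exact ⟨_, _, rfl, (k₄ B j a c hb hjb hn hk hj).mono (by nlinarith)⟩
  | min a c => exact ⟨_, _, rfl, (k₅ B j a c hb hjb hn hk hj).mono (by nlinarith)⟩

theorem transduces_output : ∃ C, ∀ {n k b : ℕ} (B j : ℕ) (a : Fin n ⊕ Fin k),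
    11 * (n + k) + 10 ≤ b → n ≤ B → k ≤ B → j ≤ B → ∃ x u, encName a = x :: u ∧
      Transduces (.gateOrOutput x) u (item (outputFormula b a)) j 0 j 0 (C * (B + 1)) := by
  obtain ⟨C, hC⟩ := transduces_branch fun o => Template.output o
  refine ⟨C, fun B j a hb hn hk hj => ?_⟩
  obtain ⟨x, hx, h⟩ := hC B j a hn hk hj
  refine ⟨x, _, hx, ?_⟩
  rw [item_outputFormula hb j]
  rcases a with i | i <;> obtain rfl := (List.cons.inj hx).1 <;> exact h

/-- Since the same loop goes on with the outputs, the gates are treated as a prefix of a run: a run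
from the state after the last gate is extended backwards. -/
theorem runs_gates : ∃ C, ∀ {n k b : ℕ} (B : ℕ), 11 * (n + k) + 10 ≤ b → n ≤ B → k ≤ B →
    ∀ (l : List (Gate (Fin n ⊕ Fin k))) (j : ℕ), (∀ g ∈ l, g.IsArithmetic) → j + l.length = k →
    (l.flatMap (Gate.enc encName)).length ≤ B → ∀ (i a o : List Sym) (s : Reg → List Sym) (T : ℕ),
    Runs (.forEach .inp .gateOrOutput)
      (stk i (((gateListFormulas b j l).flatMap item).reverse ++ a) o [] (ones k) (ones 0)) s T →
    Runs (.forEach .inp .gateOrOutput)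
      (stk (l.flatMap (Gate.enc encName) ++ i) a o [] (ones j) (ones 0)) s
      (l.length * (C * (B + 1)) + T) := by
  obtain ⟨C, hC⟩ := transduces_gate
  refine ⟨C + 1, fun {n k b} B hb hn hk l => ?_⟩
  induction l with
  | nil =>
    intro j _ hj _ i a o s T h
    rw [show k = j from hj.symm] at h
    simpa [gateListFormulas] using h
  | cons g l ih =>
    intro j hl hj hB i a o s T h
    rw [List.length_cons] at hj
    rw [List.flatMap_cons, List.length_append] at hB
    obtain ⟨x, u, hx, hg⟩ := hC (b := b) B j g (hl g (by simp)) hb (by omega)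
      hn hk (by omega) (by omega)
    have h' := ih (j + 1) (fun g' hg' => hl g' (by simp [hg'])) (by omega) (by omega) i
      (((gateFormulas b j g).flatMap item).reverse ++ a) o s T (by
        rw [gateListFormulas, List.flatMap_append, List.reverse_append, List.append_assoc] at h
        exact h)
    rw [List.flatMap_cons, hx, List.cons_append, List.cons_append, List.append_assoc]
    exact (Transduces.loop_next hg h').mono (by rw [List.length_cons]; nlinarith)

theorem runs_outputs : ∃ C, ∀ {n k b : ℕ} (B : ℕ), 11 * (n + k) + 10 ≤ b → n ≤ B → k ≤ B →
    ∀ (l : List (Fin n ⊕ Fin k)) (a o : List Sym),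
    Runs (.forEach .inp .gateOrOutput)
      (stk (l.flatMap encName) a o [] (ones k) (ones 0))
      (stk [] ((l.flatMap fun c => item (outputFormula b c)).reverse ++ a) o [] (ones k) (ones 0))
      (l.length * (C * (B + 1)) + 1) := by
  obtain ⟨C, hC⟩ := transduces_output
  refine ⟨C + 1, fun {n k b} B hb hn hk l => ?_⟩
  induction l with
  | nil =>
    intro a o
    exact (Runs.forEach_nil rfl).mono (by simp)
  | cons c l ih =>
    intro a o
    obtain ⟨x, u, hx, hc⟩ := hC (b := b) B k c hb hn hk hk
    have h' := ih ((item (outputFormula b c)).reverse ++ a) o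
    rw [List.flatMap_cons, List.flatMap_cons, hx, List.cons_append, List.reverse_append,
      List.append_assoc]
    exact (Transduces.loop_next hc h').mono (by rw [List.length_cons]; nlinarith)

theorem flatMap_inputFormulas (hb : 11 * n + 10 ≤ b) :
    ((List.ofFn (inputFormula n b)).reverse.flatMap item) =
      (List.range n).reverse.flatMap fun j => Sym.and :: Template.input.enc (holeEnc j 0) := by
  rw [← List.map_coe_finRange_eq_range, List.ofFn_eq_map, ← List.map_reverse, ← List.map_reverse,
    List.flatMap_map, List.flatMap_map]
  exact congrArg List.flatten (List.map_congr_left fun i _ => item_inputFormula hb i)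

/-- Popping the counter visits the rows `n - 1, …, 0`, hence the descending order of the input
constraints. The counter ends at 0, ready to number the gates. -/
theorem transduces_inputs : ∃ C, ∀ n B, n ≤ B →
    Transduces (.forEach .cnt fun _ => .writeItem Template.input) []
      ((List.range n).reverse.flatMap fun j => Sym.and :: Template.input.enc (holeEnc j 0))
      n 0 0 0 (n * (C * (B + 1)) + 1) := by
  obtain ⟨C, hC⟩ := (writes_writeItem Template.input).transduces
  refine ⟨C + 1, fun n => ?_⟩
  induction n with
  | zero => intro B _ i a o; exact (Runs.forEach_nil rfl).mono (by simp)
  | succ n ih =>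
    intro B hB i a o
    rw [List.range_succ, List.reverse_append, List.reverse_singleton, List.singleton_append,
      List.flatMap_cons, List.reverse_append, List.append_assoc]
    have h := hC B n 0 (by omega) (Nat.zero_le _) i a o
    rw [List.nil_append] at h
    exact (Runs.forEach_cons (s := stk i a o [] (ones (n + 1)) (ones 0)) rfl
      (by rw [update_stk_cnt]; exact h) (ih B (by omega) i _ o)).mono (by nlinarith)

end Gates

/-- Each step pushes at most one symbol. This bounds the accumulated output, and so the time of the
final reversal, by the time already spent. -/
theorem Run.length_le {K A : Type} [DecidableEq K] {p : Prog K A} {s s' : K → List A} {T : ℕ}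
    (h : Run p s T s') (k : K) : (s' k).length ≤ (s k).length + T := by
  have htail : ∀ (k' : K) (s : K → List A),
      (Function.update s k' (s k').tail k).length ≤ (s k).length := by
    intro k' s
    rcases eq_or_ne k k' with rfl | h
    · simp
    · simp [h]
  induction h with
  | skip s => exact le_rfl
  | push k' a s =>
    rcases eq_or_ne k k' with rfl | h
    · simp
    · simp [h]
  | seq _ _ h h' => omega
  | last _ _ h => exact h.trans ((Nat.add_le_add_right (htail _ _) _).trans (by omega))
  | next _ _ _ h h' => have := h.trans (Nat.add_le_add_right (htail _ _) _); omega

namespace Prog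

/-- Skip a number in unary. -/
def skipUnary : Prog Reg Sym := loop .inp (fun _ => skip) fun o => o = some .one

/-- Read the numbers of inputs, gates and outputs, and write the beginning of the formula. -/
def header : Prog Reg Sym :=
  seq (readUnary .cnt) <| seq (readUnary .arg) <| seq skipUnary <| seq (writeOnes .cnt 1) <|
    seq (write [.sep]) <| seq (writeOnes .cnt 11) <| seq (writeOnes .arg 11) <|
    seq (write (encUnary 11)) <| seq (clear .arg) <| seq (writeItem (Template.sumIs 1)) <|
    seq (forEach .cnt fun _ => writeItem Template.input) (writeItem (Template.sumIs 0))

/-- Read a circuit and write the formula that belongs to it. -/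
def antipodal : Prog Reg Sym :=
  seq (seq header (seq (forEach .inp gateOrOutput)
    (seq (write ((QF.true' : QF Hole).enc (holeEnc 0 0))) (clear .cnt)))) (forEach .acc (push .out))

end Prog

theorem transduces_skipUnary {j r : ℕ} (n : ℕ) :
    Transduces .skipUnary (encUnary n) [] j r j r (n + 1) := by
  intro i a o
  induction n with
  | zero =>
    refine Runs.last (T := 0) rfl ?_
    rw [update_stk_inp]
    exact Runs.skip _ _
  | succ n ih =>
    refine (Runs.next (T := 0) rfl ?_ ih).mono (by omega)
    rw [update_stk_inp]
    exact Runs.skip _ _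

/-- The number of bound variables is `11 n + 11 k + 11`, printed in unary from the two counters. The
number of outputs is skipped, as the end of the input marks the last one. The quadratic term comes
from `n` items of linear cost. -/
theorem transduces_header : ∃ C, ∀ n k m b B, 11 * n + 10 ≤ b → n ≤ B → k ≤ B → m ≤ B →
    Transduces .header (encUnary n ++ (encUnary k ++ encUnary m))
      (encUnary n ++ (encUnary (11 * (n + k) + 10 + 1) ++ (inputFormulas n b).flatMap item)) 0 0 0 0
      (C * (B + 1) ^ 2) := by
  obtain ⟨C₁, h₁⟩ := (writes_writeItem (Template.sumIs 1)).transduces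
  obtain ⟨C₂, h₂⟩ := (writes_writeItem (Template.sumIs 0)).transduces
  obtain ⟨C₃, h₃⟩ := transduces_inputs
  refine ⟨C₁ + C₂ + C₃ + 100, fun n k m b B hb hn hk hm => ?_⟩
  have := (Transduces.readUnary_cnt (j := 0) (r := 0) n).seq <| (Transduces.readUnary_arg k).seq <|
    (transduces_skipUnary m).seq <| (Transduces.writeOnes_cnt 1).seq <|
    (Transduces.write [.sep]).seq <| (Transduces.writeOnes_cnt 11).seq <|
    (Transduces.writeOnes_arg 11).seq <| (Transduces.write (encUnary 11)).seq <|
    Transduces.clear_arg.seq <| (h₁ B n 0 hn (Nat.zero_le _)).seq <| (h₃ n B hn).seq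
    (h₂ B 0 0 (Nat.zero_le _) (Nat.zero_le _))
  have e : encUnary n ++ (encUnary (11 * (n + k) + 10 + 1) ++ (inputFormulas n b).flatMap item) =
      [] ++ ([] ++ ([] ++ (ones (1 * n) ++ ([Sym.sep] ++ (ones (11 * n) ++ (ones (11 * k) ++
        (encUnary 11 ++ ([] ++ ((Sym.and :: (Template.sumIs 1).enc (holeEnc n 0)) ++
        (((List.range n).reverse.flatMap fun j => Sym.and :: Template.input.enc (holeEnc j 0)) ++
        (Sym.and :: (Template.sumIs 0).enc (holeEnc 0 0)))))))))))) := by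
    rw [inputFormulas, List.flatMap_cons, List.flatMap_append, List.flatMap_singleton,
      flatMap_inputFormulas hb, item_sumIs (by omega), item_sumIs (by omega), encUnary_eq n,
      encUnary_eq 11, encUnary_eq, one_mul,
      show 11 * (n + k) + 10 + 1 = 11 * n + (11 * k + 11) by ring, ones_add, ones_add]
    simp only [List.append_assoc, List.nil_append]
  rw [e]
  simp only [add_zero, List.append_nil, List.nil_append] at this ⊢
  have hC : ∀ D, D * (B + 1) ≤ D * (B + 1) ^ 2 := fun D => by
    rw [sq, ← mul_assoc]
    exact Nat.le_mul_of_pos_right _ B.succ_pos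
  have g₁ := hC C₁
  have g₂ := hC C₂
  have g₃ : n * (C₃ * (B + 1)) ≤ C₃ * (B + 1) ^ 2 := by
    rw [sq, mul_left_comm]
    exact Nat.mul_le_mul_left _ (Nat.mul_le_mul_right _ (by omega))
  have g₄ := hC 100
  refine this.mono ?_
  rw [show (encUnary 11).length = 12 from rfl, List.length_singleton]
  nlinarith

theorem runs_antipodal : ∃ C, ∀ {n m : ℕ} (c : Circuit n m), c.IsArithmetic →
    Runs .antipodal (stk (Circuit.enc ⟨n, m, c⟩) [] [] [] [] [])
      (stk [] [] (ExFormula.enc ⟨n, c.antipodalFormula⟩) [] [] [])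
      (C * ((Circuit.enc ⟨n, m, c⟩).length + 1) ^ 2) := by
  obtain ⟨C₁, h₁⟩ := transduces_header
  obtain ⟨C₂, h₂⟩ := runs_gates
  obtain ⟨C₃, h₃⟩ := runs_outputs
  -- The translation takes some `N ≤ (C₁ + C₂ + C₃ + 20) * (B + 1) ^ 2` steps. The final reversal
  -- adds at most `2 * N + 1`, as the output has length at most `N`.
  refine ⟨3 * (C₁ + C₂ + C₃ + 20) + 1, fun {n m} c hc => ?_⟩
  set B := (Circuit.enc ⟨n, m, c⟩).length with hB
  set b := 11 * (n + c.size) + 10 with hb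
  have hlen : ∀ u, (encUnary u).length = u + 1 := fun u => by
    rw [encUnary_eq, List.length_append, ones_length, List.length_singleton]
  have hin : Circuit.enc ⟨n, m, c⟩ = (encUnary n ++ (encUnary c.size ++ encUnary m)) ++
      ((List.ofFn c.gate).flatMap (Gate.enc encName) ++ (List.ofFn c.out).flatMap encName) := by
    simp only [Circuit.enc, encTuple, List.flatMap, List.map_ofFn, List.append_assoc]
    rfl
  rw [hin] at hB
  simp only [List.length_append, hlen] at hB
  set w := encUnary n ++ (encUnary (b + 1) ++ (inputFormulas n b).flatMap item)
  set v := (gateListFormulas b 0 (List.ofFn c.gate)).flatMap item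
  set u := (List.ofFn c.out).flatMap fun a => item (outputFormula b a)
  set t := (QF.true' : QF Hole).enc (holeEnc 0 0)
  have hout : ExFormula.enc ⟨n, c.antipodalFormula⟩ =
      (t.reverse ++ (u.reverse ++ (v.reverse ++ (w.reverse ++ [])))).reverse ++ [] := by
    have e : c.antipodalFormula.body.enc encName =
        (inputFormulas n b ++ (gateListFormulas b 0 (List.ofFn c.gate) ++
          (List.ofFn c.out).map (outputFormula b))).flatMap item ++ t := QF.enc_conj _ _
    rw [ExFormula.enc, e]
    simp only [List.flatMap_append, List.flatMap_map, List.reverse_append, List.reverse_reverse,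
      List.append_nil, List.append_assoc, u, v, w, t]
    rfl
  have r₁ := h₁ n c.size m b B (by omega) (by omega) (by omega) (by omega)
    ((List.ofFn c.gate).flatMap (Gate.enc encName) ++ (List.ofFn c.out).flatMap encName) [] []
  have r₃ := h₃ (b := b) B le_rfl (by omega) (by omega) (List.ofFn c.out)
    (v.reverse ++ (w.reverse ++ [])) []
  have r₂ := h₂ (b := b) B le_rfl (by omega) (by omega) (List.ofFn c.gate) 0
    (by rintro g hg; obtain ⟨j, rfl⟩ := List.mem_ofFn.1 hg; exact hc j) (by simp) (by omega)
    _ _ _ _ _ r₃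
  have r₄ := (r₁.seq (r₂.seq ((runs_write t).seq (runs_clear_cnt (r := []) c.size))))
  obtain ⟨N, hN, hr⟩ := r₄
  have hacc := hr.length_le .acc
  have r₅ := runs_moveAcc (i := []) (t := []) (c := []) (r := [])
    (a := t.reverse ++ (u.reverse ++ (v.reverse ++ (w.reverse ++ [])))) (o := [])
  rw [hin, hout]
  rw [List.length_ofFn, List.length_ofFn, show t.length = 7 from rfl] at hN
  have hN' : N ≤ (C₁ + C₂ + C₃ + 20) * (B + 1) ^ 2 := by
    refine hN.trans ?_
    have g₂ : c.size * (C₂ * (B + 1)) ≤ (B + 1) * (C₂ * (B + 1)) :=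
      Nat.mul_le_mul_right _ (by omega)
    have g₃ : m * (C₃ * (B + 1)) ≤ (B + 1) * (C₃ * (B + 1)) := Nat.mul_le_mul_right _ (by omega)
    nlinarith
  refine (Runs.seq ⟨N, le_rfl, hr⟩ r₅).mono ?_
  change (t.reverse ++ (u.reverse ++ (v.reverse ++ (w.reverse ++ [])))).length ≤ 0 + N at hacc
  nlinarith [Nat.zero_le B]

end BorsukUlamETR

theorem theorem3p4 :
    BorsukUlamETR.BU ⊆ BorsukUlamETR.TFETR ∧
    ∃ Φ : (I : BorsukUlamETR.borsukUlam.Inst) →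
        BorsukUlamETR.ExFormula (BorsukUlamETR.borsukUlam.dim I),
      BorsukUlamETR.PolyTime BorsukUlamETR.borsukUlam.enc BorsukUlamETR.ExFormula.enc
        (fun I => ⟨BorsukUlamETR.borsukUlam.dim I, Φ I⟩) ∧
      ∀ I, (∀ x, (Φ I).Holds x ↔ x ∈ BorsukUlamETR.borsukUlam.Sol I) ∧ (Φ I).IsTrue := by
  let Φ : (I : BorsukUlamETR.borsukUlam.Inst) →
      BorsukUlamETR.ExFormula (BorsukUlamETR.borsukUlam.dim I) := fun I => I.2.1.antipodalFormula
  have hΦ : BorsukUlamETR.PolyTime BorsukUlamETR.borsukUlam.enc BorsukUlamETR.ExFormula.enc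
      (fun I => ⟨BorsukUlamETR.borsukUlam.dim I, Φ I⟩) := by
    obtain ⟨C, hC⟩ := BorsukUlamETR.runs_antipodal
    refine BorsukUlamETR.PolyTime.of_run (A := BorsukUlamETR.Sym)
      BorsukUlamETR.Prog.antipodal .inp .out
      (Polynomial.C C * (Polynomial.X + 1) ^ 2) fun I => ?_
    obtain ⟨N, hN, hr⟩ := hC I.2.1 I.2.2
    have h0 : (fun _ => []) = BorsukUlamETR.stk [] [] [] [] [] [] := by
      funext k; cases k <;> rfl
    refine ⟨N, hN.trans (le_of_eq ?_), ?_⟩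
    · simp only [Polynomial.eval_mul, Polynomial.eval_C, Polynomial.eval_pow, Polynomial.eval_add,
        Polynomial.eval_X, Polynomial.eval_one]
      rfl
    · rw [← BorsukUlamETR.update_stk_inp [] [] [] [] [] [] (BorsukUlamETR.Circuit.enc _),
        ← BorsukUlamETR.update_stk_out [] [] [] [] [] [] (BorsukUlamETR.ExFormula.enc _), ← h0] at hr
      exact hr
  have hSol : ∀ I x, (Φ I).Holds x ↔ x ∈ BorsukUlamETR.borsukUlam.Sol I :=
    fun I x => I.2.1.antipodalFormula_holds_iff I.2.2 x
  -- Totality is the Borsuk-Ulam theorem on the L₁ sphere; excluding comparison gates provides the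
  -- continuity.
  have hne : ∀ I, (BorsukUlamETR.borsukUlam.Sol I).Nonempty := by
    intro I
    exact BorsukUlamETR.exists_antipodal_eq_of_continuous
      (BorsukUlamETR.Circuit.continuous_eval I.2.2)
  have hTrue : ∀ I, (Φ I).IsTrue := fun I => (hne I).imp fun x hx => (hSol I x).2 hx
  refine ⟨?_, Φ, hΦ, fun I => ⟨hSol I, hTrue I⟩⟩
  rintro P ⟨f, g, hf, hg, hfg⟩
  have hs : ∀ I, P.Solvable I := fun I => (hne (f I)).imp' _ (hfg I)
  have : Inhabited BorsukUlamETR.borsukUlam.Alphabet := ⟨BorsukUlamETR.Sym.one⟩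
  -- The formula has exactly the solutions of `f I`, in the same coordinates, so the circuits `g`
  -- are kept unchanged.
  refine ⟨⟨fun I => ⟨BorsukUlamETR.borsukUlam.dim (f I), Φ (f I)⟩, g, ⟨?_, hg, ?_⟩, ?_⟩, hs⟩
  · exact BorsukUlamETR.PolyTime.comp hΦ hf
  · exact fun I y hy => hfg I y ((hSol (f I) y).1 hy)
  · exact fun I => iff_of_true (hs I) (hTrue (f I))
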